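/- Let $\mathbb T^3=(\mathbb R/2\pi\mathbb Z)^3$ and $\varepsilon(p)=\sum_{i=1}^3(1-\cos p^{(i)})$. Let $l_1,l_2,l_3>0$ (the inverse masses of three particles on $\mathbb Z^3$) and $\mu_1,\mu_2,\mu_3>0$ (the strengths of the zero-range pair attractions, $\mu_\alpha$ belonging to the pair of particles other than $\alpha$). For $K\in\mathbb R^3$ let $H(K)$ be the three-particle lattice Schrödinger operator with total quasi-momentum $K$, that is, the bounded self-adjoint operator $$H(K)=H_0(K)-V_1-V_2-V_3$$ on $L^2(\mathbb F_K)$, $\mathbb F_K=\{(k_1,k_2,k_3)\in(\mathbb T^3)^3:\ k_1+k_2+k_3=K \bmod 2\pi\mathbb Z^3\}$, identified with $L^2((\mathbb T^3)^2)$ through the coordinates $(k_1,k_2)$, where $$(H_0(K)f)(k)=\Big(\sum_{\alpha=1}^3 l_\alpha\,\varepsilon(k_\alpha)\Big)f(k),$$ and $V_\alpha$ is $\mu_\alpha(2\pi)^{-3}$ times integration over all configurations in $\mathbb F_K$ with the same $k_\alpha$: for $\{\alpha,\beta,\gamma\}=\{1,2,3\}$, $$(V_\alpha f)(k_\alpha,k_\beta,k_\gamma)=\frac{\mu_\alpha}{(2\pi)^3}\int_{\mathbb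 T^3} f(k_\alpha,\,k_\beta+s,\,k_\gamma-s)\,ds .$$ For $\{\alpha,\beta,\gamma\}=\{1,2,3\}$ put $$\mu_\alpha^0=(l_\beta+l_\gamma)(2\pi)^3\Big(\int_{\mathbb T^3}\frac{dq}{\varepsilon(q)}\Big)^{-1},$$ the coupling at which the two-particle subsystem of $\beta$ and $\gamma$ has a zero-energy resonance. **Theorem.** Let $\{\alpha,\beta,\gamma\}=\{1,2,3\}$ and assume that $\mu_\alpha=\mu_\alpha^0$, $\mu_\beta=\mu_\beta^0$ and $\mu_\gamma\le\mu_\gamma^0$. Then there is $\delta>0$ (depending on the $l$'s and $\mu$'s) such that for every $K\in\mathbb R^3$ with $0<|K|<\delta$ the operator $H(K)$ has only finitely many eigenvalues, counted with multiplicity, below the bottom $\tau_{ess}(K)=\inf\sigma_{ess}(H(K))$ of its essential spectrum. -/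

import Mathlib

open MeasureTheory Filter Topology
open scoped ENNReal Real

noncomputable section

namespace LatticeThreeBody

instance factTwoPiPos : Fact (0 < 2 * π) := ⟨Real.two_pi_pos⟩

/-- The three-dimensional torus `𝕋³ = (ℝ / 2πℤ)³` of quasi-momenta. Its `volume` is the product of
the Lebesgue measures, with total mass `(2π)³`. -/
abbrev Torus : Type := Fin 3 → AddCircle (2 * π)

/-- The class of a vector of `ℝ³` modulo `2πℤ³`. -/
def toTorus (K : EuclideanSpace ℝ (Fin 3)) : Torus := fun i => (K i : AddCircle (2 * π))

/-- The cosine on `ℝ / 2πℤ`. -/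
def torusCos : AddCircle (2 * π) → ℝ := Real.cos_periodic.lift

/-- The dispersion function `ε(p) = ∑ᵢ (1 - cos pᵢ)`. -/
def dispersion (p : Torus) : ℝ := ∑ i, (1 - torusCos (p i))

/-- The critical coupling
`μ_α⁰ = (l_β + l_γ) (2π)³ (∫_{𝕋³} ε(q)⁻¹ dq)⁻¹`, where `{α, β, γ} = {1, 2, 3}`. -/
def criticalCoupling (l : Fin 3 → ℝ) (α : Fin 3) : ℝ :=
  (l (α + 1) + l (α + 2)) * (2 * π) ^ 3 * (∫ q : Torus, (dispersion q)⁻¹)⁻¹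

/-- Coordinates on the fibre `𝔽_K = {(k₁, k₂, k₃) : k₁ + k₂ + k₃ = K mod 2π}` of three-particle
configurations with total quasi-momentum `K`: the pair `x = (k₁, k₂)` represents
`(k₁, k₂, K - k₁ - k₂)`. -/
def momenta (K : Torus) (x : Torus × Torus) : Fin 3 → Torus := ![x.1, x.2, K - x.1 - x.2]

/-- The direction in which the pair complementary to particle `α` exchanges momentum: adding
`shift α s` to `(k₁, k₂)` leaves `k_α` unchanged, and changes the two other momenta by `s` and
`-s`. -/
def shift (α : Fin 3) (s : Torus) : Torus × Torus := ![(0, s), (s, 0), (s, -s)] α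

/-- The kinetic energy `ε₁(k₁) + ε₂(k₂) + ε₃(k₃)` on the fibre `𝔽_K`, where `ε_α = l_α ε`. -/
def kineticEnergy (l : Fin 3 → ℝ) (K : Torus) (x : Torus × Torus) : ℝ :=
  ∑ α, l α * dispersion (momenta K x α)

/-- The Hilbert space `L²((𝕋³)²)`, which is `L²(𝔽_K)` in the coordinates `(k₁, k₂)`. -/
abbrev State : Type := Lp ℂ 2 (volume : Measure (Torus × Torus))

lemma continuous_torusCos : Continuous torusCos :=
  continuous_coinduced_dom.mpr Real.continuous_cos

lemma continuous_dispersion : Continuous dispersion := by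
  unfold dispersion
  exact continuous_finsetSum _ fun i _ =>
    continuous_const.sub (continuous_torusCos.comp (continuous_apply i))

lemma continuous_momenta (K : Torus) (α : Fin 3) : Continuous fun x => momenta K x α := by
  fin_cases α <;> simp [momenta] <;> fun_prop

lemma continuous_kineticEnergy (l : Fin 3 → ℝ) (K : Torus) : Continuous (kineticEnergy l K) := by
  unfold kineticEnergy
  exact continuous_finsetSum _ fun α _ =>
    continuous_const.mul (continuous_dispersion.comp (continuous_momenta K α))

lemma memLp_kineticEnergy (l : Fin 3 → ℝ) (K : Torus) :
    MemLp (fun x => (kineticEnergy l K x : ℂ)) ∞ (volume : Measure (Torus × Torus)) := by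
  have hc : Continuous fun x => (kineticEnergy l K x : ℂ) :=
    Complex.continuous_ofReal.comp (continuous_kineticEnergy l K)
  obtain ⟨C, hC⟩ := isCompact_univ.exists_bound_of_continuousOn hc.continuousOn
  exact memLp_top_of_bound hc.aestronglyMeasurable C (Eventually.of_forall fun x => hC x trivial)

/-- The free Hamiltonian `H₀(K)`: multiplication by the kinetic energy. -/
def freeHamiltonian (l : Fin 3 → ℝ) (K : Torus) : State →L[ℂ] State :=
  (ContinuousLinearMap.mul ℂ ℂ).holderL volume ∞ 2 2 (memLp_kineticEnergy l K).toLp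

lemma freeHamiltonian_apply (l : Fin 3 → ℝ) (K : Torus) (f : State) :
    freeHamiltonian l K f =ᵐ[volume] fun x => (kineticEnergy l K x : ℂ) * f x := by
  have h := (ContinuousLinearMap.mul ℂ ℂ).coeFn_holder (r := 2) (memLp_kineticEnergy l K).toLp f
  filter_upwards [h, (memLp_kineticEnergy l K).coeFn_toLp] with x hx hx'
  rw [← hx']
  exact hx

lemma continuous_shift (α : Fin 3) : Continuous (shift α) := by
  fin_cases α
  · change Continuous fun s : Torus => ((0 : Torus), s)
    fun_prop
  · change Continuous fun s : Torus => (s, (0 : Torus))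
    fun_prop
  · change Continuous fun s : Torus => (s, -s)
    fun_prop

lemma measurePreserving_add_const (a : Torus × Torus) :
    MeasurePreserving (fun x : Torus × Torus => x + a) volume volume :=
  (measurePreserving_add_right (volume : Measure Torus) a.1).prod
    (measurePreserving_add_right (volume : Measure Torus) a.2)

/-- `(x, s) ↦ (s, x + shift α s)` preserves the measure. -/
lemma measurePreserving_shear (α : Fin 3) :
    MeasurePreserving (fun z : Torus × (Torus × Torus) => (z.1, z.2 + shift α z.1))
      (volume.prod volume) (volume.prod volume) := by
  refine MeasurePreserving.skew_product (g := fun s x => x + shift α s)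
    (MeasurePreserving.id _) ?_ ?_
  · have := continuous_shift α
    exact Continuous.measurable (by simp only [Function.uncurry_def]; fun_prop)
  · exact Eventually.of_forall fun s => (measurePreserving_add_const (shift α s)).map_eq

lemma quasi_shear (α : Fin 3) :
    Measure.QuasiMeasurePreserving (fun z : (Torus × Torus) × Torus => z.1 + shift α z.2)
      (volume.prod volume) volume := by
  have h := (measurePreserving_shear α).comp
    (Measure.measurePreserving_swap (μ := (volume : Measure (Torus × Torus)))
      (ν := (volume : Measure Torus)))
  exact Measure.quasiMeasurePreserving_snd.comp h.quasiMeasurePreserving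

lemma lintegral_shear (α : Fin 3) (g : Torus × Torus → ℝ≥0∞) (hg : AEMeasurable g volume) :
    ∫⁻ x, ∫⁻ s, g (x + shift α s) = volume (Set.univ : Set Torus) * ∫⁻ x, g x := by
  have hm : AEMeasurable (Function.uncurry fun (x : Torus × Torus) (s : Torus) =>
      g (x + shift α s)) (volume.prod volume) := hg.comp_quasiMeasurePreserving (quasi_shear α)
  rw [lintegral_lintegral_swap hm]
  have h : ∀ s : Torus, ∫⁻ x, g (x + shift α s) = ∫⁻ x, g x := fun s => by
    have hp := measurePreserving_add_const (shift α s)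
    conv_rhs => rw [← hp.map_eq]
    rw [lintegral_map' (by rwa [hp.map_eq]) hp.measurable.aemeasurable]
  simp [h, mul_comm]

/-- The integral of `f` over the configurations in `𝔽_K` with the same momentum of particle `α`. -/
def fibreIntegral (α : Fin 3) (f : Torus × Torus → ℂ) (x : Torus × Torus) : ℂ :=
  ∫ s : Torus, f (x + shift α s)

lemma fibreIntegral_congr (α : Fin 3) {f g : Torus × Torus → ℂ} (h : f =ᵐ[volume] g) :
    fibreIntegral α f =ᵐ[volume] fibreIntegral α g := by
  have h' := Measure.ae_ae_of_ae_prod ((quasi_shear α).ae h)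
  filter_upwards [h'] with x hx
  exact integral_congr_ae hx

lemma integrable_fibre (α : Fin 3) {f : Torus × Torus → ℂ} (hf : MemLp f 2 volume) :
    ∀ᵐ x, Integrable fun s => f (x + shift α s) := by
  have hf1 : Integrable f := hf.integrable (by norm_num)
  have hm : AEStronglyMeasurable (fun z : (Torus × Torus) × Torus => f (z.1 + shift α z.2))
      (volume.prod volume) := hf.1.comp_quasiMeasurePreserving (quasi_shear α)
  have : Integrable (fun z : (Torus × Torus) × Torus => f (z.1 + shift α z.2))
      (volume.prod volume) := by
    refine ⟨hm, ?_⟩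
    rw [HasFiniteIntegral, lintegral_prod _ hm.enorm]
    have := lintegral_shear α (fun x => ‖f x‖ₑ) hf.1.enorm
    simp only at this ⊢
    rw [this]
    exact ENNReal.mul_lt_top (measure_lt_top _ _) hf1.2
  exact this.prod_right_ae

lemma eLpNorm_fibreIntegral_le (α : Fin 3) {f : Torus × Torus → ℂ} (hf : MemLp f 2 volume) :
    eLpNorm (fibreIntegral α f) 2 volume ≤ volume (Set.univ : Set Torus) * eLpNorm f 2 volume := by
  have hpt : ∀ᵐ x, ‖fibreIntegral α f x‖ₑ ^ (2 : ℝ) ≤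
      volume (Set.univ : Set Torus) * ∫⁻ s, ‖f (x + shift α s)‖ₑ ^ (2 : ℝ) := by
    filter_upwards [integrable_fibre α hf] with x hx
    have h1 : ‖fibreIntegral α f x‖ₑ ≤ ∫⁻ s, ‖f (x + shift α s)‖ₑ * 1 := by
      simpa [fibreIntegral] using
        enorm_integral_le_lintegral_enorm (fun s => f (x + shift α s))
    have h2 := ENNReal.lintegral_mul_le_Lp_mul_Lq (volume : Measure Torus)
      Real.HolderConjugate.two_two hx.1.enorm (aemeasurable_const (b := (1 : ℝ≥0∞)))
    simp only [Pi.mul_apply, ENNReal.one_rpow, lintegral_one] at h2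
    have h3 := ENNReal.rpow_le_rpow (h1.trans h2) (zero_le_two (α := ℝ))
    rw [ENNReal.mul_rpow_of_nonneg _ _ zero_le_two, ← ENNReal.rpow_mul, ← ENNReal.rpow_mul] at h3
    norm_num at h3
    rw [mul_comm]
    simpa using h3
  rw [eLpNorm_eq_lintegral_rpow_enorm_toReal (by norm_num) (by norm_num),
    eLpNorm_eq_lintegral_rpow_enorm_toReal (by norm_num) (by norm_num)]
  simp only [ENNReal.toReal_ofNat]
  have h := lintegral_mono_ae hpt
  rw [lintegral_const_mul' _ _ (measure_ne_top _ _),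
    lintegral_shear α (fun x => ‖f x‖ₑ ^ (2 : ℝ)) (hf.1.enorm.pow_const _), ← mul_assoc] at h
  refine (ENNReal.rpow_le_rpow h (by norm_num)).trans ?_
  rw [ENNReal.mul_rpow_of_nonneg _ _ (by norm_num), ← pow_two, ← ENNReal.rpow_natCast,
    ← ENNReal.rpow_mul]
  norm_num

lemma memLp_fibreIntegral (α : Fin 3) {f : Torus × Torus → ℂ} (hf : MemLp f 2 volume) :
    MemLp (fibreIntegral α f) 2 volume :=
  ⟨(hf.1.comp_quasiMeasurePreserving (quasi_shear α)).integral_prod_right',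
    (eLpNorm_fibreIntegral_le α hf).trans_lt (ENNReal.mul_lt_top (measure_lt_top _ _) hf.2)⟩

/-- `fibreIntegral α` as a bounded operator on `L²`. -/
def fibreIntegralL (α : Fin 3) : State →L[ℂ] State :=
  LinearMap.mkContinuous
    { toFun := fun f => (memLp_fibreIntegral α (Lp.memLp f)).toLp
      map_add' := fun f g => by
        rw [← MemLp.toLp_add]
        refine MemLp.toLp_congr _ _ ((fibreIntegral_congr α (Lp.coeFn_add f g)).trans ?_)
        filter_upwards [integrable_fibre α (Lp.memLp f), integrable_fibre α (Lp.memLp g)]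
          with x hf hg
        exact integral_add hf hg
      map_smul' := fun c f => by
        rw [RingHom.id_apply, ← MemLp.toLp_const_smul]
        refine MemLp.toLp_congr _ _ ((fibreIntegral_congr α (Lp.coeFn_smul c f)).trans ?_)
        exact Eventually.of_forall fun x => integral_smul c _ }
    (volume (Set.univ : Set Torus)).toReal
    (fun f => by
      change ‖(memLp_fibreIntegral α (Lp.memLp f)).toLp‖ ≤ _
      rw [Lp.norm_toLp, Lp.norm_def, ← ENNReal.toReal_mul]
      exact ENNReal.toReal_mono (ENNReal.mul_ne_top (measure_ne_top _ _) (Lp.memLp f).2.ne)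
        (eLpNorm_fibreIntegral_le α (Lp.memLp f)))

lemma fibreIntegralL_apply (α : Fin 3) (f : State) :
    fibreIntegralL α f =ᵐ[volume] fibreIntegral α f :=
  (memLp_fibreIntegral α (Lp.memLp f)).coeFn_toLp

/-- The zero-range interaction `V_α` of the pair complementary to particle `α`:
`(V_α f)(k) = μ_α (2π)⁻³ ∫ f(k') dk'`, over the `k' ∈ 𝔽_K` with `k'_α = k_α`. -/
def interaction (μ : Fin 3 → ℝ) (α : Fin 3) : State →L[ℂ] State :=
  ((μ α / (2 * π) ^ 3 : ℝ) : ℂ) • fibreIntegralL α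

/-- The three-particle lattice Schrödinger operator `H(K) = H₀(K) - V₁ - V₂ - V₃`. -/
def hamiltonian (l μ : Fin 3 → ℝ) (K : Torus) : State →L[ℂ] State :=
  freeHamiltonian l K - ∑ α, interaction μ α

section Spectral

variable {E : Type*} [NormedAddCommGroup E] [NormedSpace ℂ E]

/-- The eigenspace `ker (T - z)`. -/
abbrev eigenspace (T : E →L[ℂ] E) (z : ℂ) : Submodule ℂ E :=
  Module.End.eigenspace (T : E →ₗ[ℂ] E) z

/-- The discrete spectrum of a (self-adjoint) operator: the isolated points of the spectrum whose
eigenspace has finite dimension. -/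
def discreteSpectrum (T : E →L[ℂ] E) : Set ℂ :=
  {z ∈ spectrum ℂ T | ¬ AccPt z (𝓟 (spectrum ℂ T)) ∧ FiniteDimensional ℂ (eigenspace T z)}

/-- The essential spectrum: the complement of the discrete spectrum in the spectrum. -/
def essentialSpectrum (T : E →L[ℂ] E) : Set ℂ := spectrum ℂ T \ discreteSpectrum T

/-- The bottom `τ_ess = inf σ_ess(T)` of the essential spectrum of a self-adjoint operator. -/
def essentialBottom (T : E →L[ℂ] E) : ℝ := sInf {x : ℝ | (x : ℂ) ∈ essentialSpectrum T}

/-- The (real) eigenvalues of `T` below the bottom of its essential spectrum. -/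
def eigenvaluesBelow (T : E →L[ℂ] E) : Set ℝ :=
  {x : ℝ | x < essentialBottom T ∧ Module.End.HasEigenvalue (T : E →ₗ[ℂ] E) (x : ℂ)}

end Spectral

end LatticeThreeBody

end

open LatticeThreeBody

/-! Write `E` for the kinetic energy on `𝔽_K`, `τ` for the bottom of the essential spectrum, and
`Δ_α(k) = 1 - μ_α (2π)⁻³ ∫ (E - z)⁻¹` for the pair determinant, the integral running over the
configurations with `k_α = k`. Everything is done at the energy `z = τ`.

(1) `τ < min E` (`essentialBottom_lt_kineticEnergy`). For small `K ≠ 0` a minimizer of `E` does not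
give all the momentum to the particle `α` of the critical pair. The pair then has nonzero total
momentum, so its dispersion is flatter than at rest, and a coupling critical at rest is
supercritical: `Δ_α` is negative somewhere at an energy just below `min E`. A negative pair
determinant yields infinitely many independent trial states `φ(k_α)/(E - z)` of negative form, hence
essential spectrum below `z` (`essentialBottom_lt_of_pairDet_neg`). The same principle shows that
every `Δ_α` is nonnegative at `z = τ`.

(2) `1/Δ_α` is integrable at `z = τ` (`lintegral_inv_pairDet_lt_top`). Since no coupling exceeds its
critical value, `Δ_α(k) > 0` wherever `l_α ε(k) > z` (`pairDet_pos_of_lt`), so for small `K` all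
zeros of `Δ_α` are near the origin. A zero is a minimum of `Δ_α`, and near it `Δ_α` grows at least
quadratically (`exists_growth_radius`); inverse squares are integrable in dimension three. For the
growth, the mean resolvent is expanded in the displacement. Its first-order part inherits a
quadratic lower bound from the concavity of the cosine and of the pair amplitude
(`sq_le_of_nonneg`). The second-order remainder is dominated by means of a variance estimate that
does not deteriorate as the gap above `z` closes (`integral_model_variance_le`, `model_growth`).

(3) A Birman–Schwinger argument (`finiteDimensional_of_form_lt`). If the form of `H(K) - τ` is
negative at `f`, completing the square bounds the fibre means of `f` by their coupling through `(E -
τ)⁻¹`. The diagonal couplings turn into the weights `Δ_α`; after division by `√Δ_α √Δ_β` the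
off-diagonal kernel is square integrable, because `(E - τ)⁻¹` is bounded by (1) and `Δ⁻¹` is
integrable by (2). A Hilbert–Schmidt form exceeds the square norm only on spaces of finite dimension
(`finiteDimensional_of_lt_kernel`), so only finitely many eigenvalues lie below `τ`. -/

namespace LatticeThreeBody

/-! ### Variational principles for the essential spectrum and for counting eigenvalues. -/

section Variational

variable {E : Type*} [NormedAddCommGroup E] [InnerProductSpace ℂ E]

lemma exists_ne_zero_map_eq_zero {V F : Type*} [AddCommGroup V] [Module ℂ V] [AddCommGroup F]
    [Module ℂ F] [FiniteDimensional ℂ F] (hV : ¬ FiniteDimensional ℂ V) (G : V →ₗ[ℂ] F) :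
    ∃ v, v ≠ 0 ∧ G v = 0 := by
  by_contra! h
  refine hV (FiniteDimensional.of_injective G ?_)
  rw [← LinearMap.ker_eq_bot, LinearMap.ker_eq_bot']
  intro v hv
  by_contra hne
  exact h v hne hv

/-- `B` maps `ker (A ∘ B)` into `ker A`, with kernel inside `ker B`. -/
lemma finiteDimensional_ker_comp {A B : E →ₗ[ℂ] E} (hA : FiniteDimensional ℂ (LinearMap.ker A))
    (hB : FiniteDimensional ℂ (LinearMap.ker B)) :
    FiniteDimensional ℂ (LinearMap.ker (A ∘ₗ B)) := by
  by_contra hV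
  let G : LinearMap.ker (A ∘ₗ B) →ₗ[ℂ] LinearMap.ker A :=
    (B ∘ₗ (LinearMap.ker (A ∘ₗ B)).subtype).codRestrict _ (fun x => by
      exact x.2)
  have hker : FiniteDimensional ℂ (LinearMap.ker G) := by
    let J : LinearMap.ker G →ₗ[ℂ] LinearMap.ker B :=
      ((LinearMap.ker (A ∘ₗ B)).subtype ∘ₗ (LinearMap.ker G).subtype).codRestrict _ (fun x => by
        have := x.2
        rw [LinearMap.mem_ker] at this
        exact congrArg Subtype.val this)
    refine FiniteDimensional.of_injective J ?_
    intro x y hxy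
    have := congrArg Subtype.val hxy
    exact Subtype.ext (Subtype.ext this)
  have hq : FiniteDimensional ℂ (LinearMap.ker (A ∘ₗ B) ⧸ LinearMap.ker G) :=
    Module.Finite.equiv G.quotKerEquivRange.symm
  exact hV (Module.Finite.of_submodule_quotient (LinearMap.ker G))

/-- The polynomial vanishing on the finitely many discrete spectral points replaces their spectral
projection in `exists_mem_essentialSpectrum_le`. -/
lemma finiteDimensional_ker_aeval (T : E →L[ℂ] E) (S : Finset ℝ)
    (hS : ∀ x ∈ S, FiniteDimensional ℂ (eigenspace T (x : ℂ))) :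
    FiniteDimensional ℂ (LinearMap.ker
      ((Polynomial.aeval T (∏ x ∈ S, (Polynomial.X - Polynomial.C x)) : E →L[ℂ] E) :
        E →ₗ[ℂ] E)) := by
  classical
  induction S using Finset.induction_on with
  | empty =>
    have : LinearMap.ker ((1 : E →L[ℂ] E) : E →ₗ[ℂ] E) = ⊥ :=
      LinearMap.ker_eq_bot'.2 fun x hx => by simpa using hx
    rw [Finset.prod_empty, map_one, this]
    infer_instance
  | insert x S hx ih =>
    rw [Finset.prod_insert hx, map_mul]
    refine finiteDimensional_ker_comp (A := ((Polynomial.aeval T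
      (Polynomial.X - Polynomial.C x) : E →L[ℂ] E) : E →ₗ[ℂ] E)) ?_
      (ih fun y hy => hS y (Finset.mem_insert_of_mem hy))
    have h := hS x (Finset.mem_insert_self _ _)
    have heq : LinearMap.ker ((Polynomial.aeval T (Polynomial.X - Polynomial.C x) : E →L[ℂ] E) :
        E →ₗ[ℂ] E) = eigenspace T (x : ℂ) := by
      ext v
      simp [Algebra.algebraMap_eq_smul_one, sub_eq_zero]
    rwa [heq]

lemma ofReal_mem_spectrum_iff {T : E →L[ℂ] E} {x : ℝ} :
    (x : ℂ) ∈ spectrum ℂ T ↔ x ∈ spectrum ℝ T :=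
  (spectrum.algebraMap_mem_iff (R := ℝ) ℂ (a := T) (r := x))

variable [CompleteSpace E]

/-- If `T` has no essential spectrum in `(-∞, z]`, its form is at least `z` on a subspace of finite
codimension. -/
lemma exists_mem_essentialSpectrum_le {T : E →L[ℂ] E} (hT : IsSelfAdjoint T) {z : ℝ}
    {V : Type*} [AddCommGroup V] [Module ℂ V] (hV : ¬ FiniteDimensional ℂ V) (J : V →ₗ[ℂ] E)
    (hJ : ∀ v, v ≠ 0 → (inner ℂ (J v) (T (J v))).re < z * ‖J v‖ ^ 2) :
    ∃ x : ℝ, x ≤ z ∧ (x : ℂ) ∈ essentialSpectrum T := by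
  by_contra! hess
  set S : Set ℝ := spectrum ℝ T ∩ Set.Iic z with hSdef
  have hdisc : ∀ x ∈ S, (x : ℂ) ∈ discreteSpectrum T := by
    intro x hx
    by_contra h
    exact hess x hx.2 ⟨ofReal_mem_spectrum_iff.2 hx.1, h⟩
  have hcomp : IsCompact S := (spectrum.isCompact T).inter_right isClosed_Iic
  -- An infinite compact set of spectral points would accumulate at one of its own points, which is
  -- isolated.
  have hfin : S.Finite := by
    by_contra hinf
    obtain ⟨x, hx, hacc⟩ := Set.Infinite.exists_accPt_of_subset_isCompact hinf hcomp subset_rfl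
    refine (hdisc x hx).2.1 ?_
    rw [accPt_iff_nhds] at hacc ⊢
    intro U hU
    obtain ⟨y, hy, hne⟩ := hacc _ (Complex.continuous_ofReal.continuousAt.preimage_mem_nhds hU)
    exact ⟨y, ⟨hy.1, ofReal_mem_spectrum_iff.2 hy.2.1⟩, fun h => hne (by exact_mod_cast h)⟩
  set p : Polynomial ℝ := ∏ x ∈ hfin.toFinset, (Polynomial.X - Polynomial.C x) with hp
  set P : E →L[ℂ] E := Polynomial.aeval T p with hP
  have hker : FiniteDimensional ℂ (LinearMap.ker (P : E →ₗ[ℂ] E)) :=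
    finiteDimensional_ker_aeval T _ fun x hx => (hdisc x (by simpa using hx)).2.2
  have hPsa : IsSelfAdjoint P := by
    rw [hP, ← cfc_polynomial p T hT]
    exact cfc_predicate _ _
  -- On the spectrum `(x - z) p(x)² ≥ 0`: `p` vanishes at the points up to `z`, and `x - z > 0` at
  -- the others. Hence the form of `T` is at least `z` on the range of `P = p(T)`, and by continuity
  -- on its closure `(ker P)ᗮ`.
  have hnonneg : 0 ≤ Polynomial.aeval T ((Polynomial.X - Polynomial.C z) * p * p) := by
    rw [← cfc_polynomial _ T hT]
    refine cfc_nonneg fun x hx => ?_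
    rw [Polynomial.eval_mul, Polynomial.eval_mul, mul_assoc]
    by_cases hxz : x ≤ z
    · have : p.eval x = 0 := by
        rw [hp, Polynomial.eval_prod]
        exact Finset.prod_eq_zero (i := x) (by simpa using ⟨hx, hxz⟩) (by simp)
      simp [this]
    · exact mul_nonneg (by simp; linarith) (mul_self_nonneg _)
  have hcommute : Polynomial.aeval T ((Polynomial.X - Polynomial.C z) * p * p)
      = P * (T - (z : ℂ) • 1) * P := by
    rw [mul_comm (Polynomial.X - Polynomial.C z) p, map_mul, map_mul]
    congr 2
    ext v
    simp [Algebra.algebraMap_eq_smul_one]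
  have hrange : ∀ g, z * ‖P g‖ ^ 2 ≤ (inner ℂ (P g) (T (P g))).re := by
    intro g
    have h := ((ContinuousLinearMap.nonneg_iff_isPositive _).1 hnonneg).re_inner_nonneg_right g
    rw [hcommute] at h
    have h2 : inner ℂ g ((P * (T - (z : ℂ) • 1) * P) g)
        = inner ℂ (P g) (T (P g)) - z * inner ℂ (P g) (P g) := by
      have : ((P * (T - (z : ℂ) • 1) * P) g) = P (T (P g) - (z : ℂ) • P g) := by simp
      rw [this, ← ContinuousLinearMap.adjoint_inner_left, hPsa.adjoint_eq, inner_sub_right,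
        inner_smul_right]
    rw [h2, inner_self_eq_norm_sq_to_K] at h
    simp only [RCLike.re_to_complex, Complex.sub_re] at h
    have h3 : ((z : ℂ) * ((‖P g‖ : ℝ) : ℂ) ^ 2).re = z * ‖P g‖ ^ 2 := by
      rw [← Complex.ofReal_pow, ← Complex.ofReal_mul, Complex.ofReal_re]
    have h4 : ((z : ℂ) * ((‖P g‖ : ℝ) : ℂ) ^ 2).re ≤ (inner ℂ (P g) (T (P g))).re := by
      simpa using h
    linarith
  have hclosure : ∀ u ∈ (LinearMap.range (P : E →ₗ[ℂ] E)).topologicalClosure,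
      z * ‖u‖ ^ 2 ≤ (inner ℂ u (T u)).re := by
    intro u hu
    have hcl : IsClosed {u : E | z * ‖u‖ ^ 2 ≤ (inner ℂ u (T u)).re} :=
      isClosed_le (by fun_prop) (Complex.continuous_re.comp (by fun_prop))
    refine closure_minimal ?_ hcl hu
    rintro _ ⟨g, rfl⟩
    exact hrange g
  -- Since `ker P` has finite dimension, some nonzero `v` has `J v` orthogonal to it, hence in the
  -- closure of the range of the self-adjoint `P`.
  obtain ⟨v, hv, hv0⟩ := exists_ne_zero_map_eq_zero hV
    ((LinearMap.ker (P : E →ₗ[ℂ] E)).orthogonalProjectionOnto.toLinearMap ∘ₗ J)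
  have hmem : J v ∈ (LinearMap.ker (P : E →ₗ[ℂ] E))ᗮ := by
    rw [← Submodule.orthogonalProjectionOnto_eq_zero_iff]
    exact hv0
  rw [show (LinearMap.ker (P : E →ₗ[ℂ] E))ᗮ = _ from P.orthogonal_ker, hPsa.adjoint_eq] at hmem
  exact absurd (hJ v hv) (not_lt.2 (hclosure _ hmem))

/-- Without a lower bound the real `sInf` in `essentialBottom` would be a default value. -/
lemma bddBelow_essentialSpectrum (T : E →L[ℂ] E) :
    BddBelow {x : ℝ | (x : ℂ) ∈ essentialSpectrum T} := by
  refine ⟨-(‖T‖ * ‖(1 : E →L[ℂ] E)‖), fun x hx => ?_⟩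
  have h := spectrum.norm_le_norm_mul_of_mem hx.1
  rw [Complex.norm_real, Real.norm_eq_abs] at h
  exact neg_le_of_abs_le h

lemma essentialBottom_le {T : E →L[ℂ] E} (hT : IsSelfAdjoint T) {z : ℝ}
    {V : Type*} [AddCommGroup V] [Module ℂ V] (hV : ¬ FiniteDimensional ℂ V) (J : V →ₗ[ℂ] E)
    (hJ : ∀ v, v ≠ 0 → (inner ℂ (J v) (T (J v))).re < z * ‖J v‖ ^ 2) :
    essentialBottom T ≤ z := by
  obtain ⟨x, hx, hx'⟩ := exists_mem_essentialSpectrum_le hT hV J hJ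
  exact (csInf_le (bddBelow_essentialSpectrum T) hx').trans hx

/-- An eigenvalue with infinite-dimensional eigenspace belongs to the essential spectrum, so it
cannot lie below the infimum. This settles multiplicities. -/
lemma finiteDimensional_eigenspace_of_lt {T : E →L[ℂ] E} {z : ℝ} (hz : z ∈ eigenvaluesBelow T) :
    FiniteDimensional ℂ (eigenspace T (z : ℂ)) := by
  have hspec : (z : ℂ) ∈ spectrum ℂ T := by
    rw [spectrum.mem_iff]
    intro hu
    obtain ⟨v, hv, hne⟩ := hz.2.exists_hasEigenvector
    rw [Module.End.mem_eigenspace_iff] at hv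
    obtain ⟨w, hw⟩ := hu
    have h0 : (w : E →L[ℂ] E) v = 0 := by
      rw [hw]
      have : T v = (z : ℂ) • v := hv
      simp [Algebra.algebraMap_eq_smul_one, this]
    apply hne
    have : ((w⁻¹ : (E →L[ℂ] E)ˣ) * w : E →L[ℂ] E) v = 0 := by
      rw [mul_apply_eq_comp, h0, map_zero]
    simpa using this
  by_contra h
  have : (z : ℂ) ∈ essentialSpectrum T := ⟨hspec, fun hd => h hd.2.2⟩
  exact absurd hz.1 (not_lt.2 (csInf_le (bddBelow_essentialSpectrum T) this))

/-- If the form of `T - t` has no negative subspace of infinite dimension, then `T` has finitely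
many eigenvalues below `t`. -/
lemma finite_eigenvalues_lt {T : E →L[ℂ] E} (hT : IsSelfAdjoint T) {t : ℝ}
    (h : ∀ J : (ℕ →₀ ℂ) →ₗ[ℂ] E,
      ¬ ∀ v, v ≠ 0 → (inner ℂ (J v) (T (J v))).re < t * ‖J v‖ ^ 2) :
    {x : ℝ | x < t ∧ Module.End.HasEigenvalue (T : E →ₗ[ℂ] E) (x : ℂ)}.Finite := by
  by_contra hinf
  set x : ℕ → ℝ := fun n => (Set.Infinite.natEmbedding _ hinf n : ℝ) with hx
  have hxinj : Function.Injective x :=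
    Subtype.val_injective.comp (Set.Infinite.natEmbedding _ hinf).injective
  have hxt : ∀ n, x n < t := fun n => (Set.Infinite.natEmbedding _ hinf n).2.1
  have hev : ∀ n, ∃ v : E, ‖v‖ = 1 ∧ T v = (x n : ℂ) • v := by
    intro n
    obtain ⟨v, hv, hne⟩ := (Set.Infinite.natEmbedding _ hinf n).2.2.exists_hasEigenvector
    rw [Module.End.mem_eigenspace_iff] at hv
    refine ⟨((‖v‖⁻¹ : ℝ) : ℂ) • v, ?_, ?_⟩
    · rw [norm_smul, Complex.norm_real, norm_inv, norm_norm, inv_mul_cancel₀ (norm_ne_zero_iff.2 hne)]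
    · have : T v = (x n : ℂ) • v := hv
      rw [map_smul, this, smul_comm]
  choose e he hTe using hev
  have hsym : ∀ u w, inner ℂ (T u) w = inner ℂ u (T w) := fun u w => by
    rw [← ContinuousLinearMap.adjoint_inner_right, hT.adjoint_eq]
  have hon : Orthonormal ℂ e := by
    refine ⟨he, fun i j hij => ?_⟩
    have h1 := hsym (e i) (e j)
    rw [hTe, hTe, inner_smul_left, inner_smul_right, Complex.conj_ofReal] at h1
    have h2 : ((x i : ℂ) - x j) * inner ℂ (e i) (e j) = 0 := by rw [sub_mul, h1, sub_self]
    refine (mul_eq_zero.1 h2).resolve_left ?_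
    refine sub_ne_zero.2 ?_
    exact fun h => hij (hxinj (by exact_mod_cast h))
  -- On combinations of orthonormal eigenvectors the form is `∑ |c n|² x n` with every `x n < t`.
  refine h (Finsupp.linearCombination ℂ e) fun c hc => ?_
  have hT' : T (Finsupp.linearCombination ℂ e c)
      = ∑ n ∈ c.support, (c n * x n) • e n := by
    rw [Finsupp.linearCombination_apply, Finsupp.sum, map_sum]
    exact Finset.sum_congr rfl fun n _ => by rw [map_smul, hTe, smul_smul]
  rw [hT', ← inner_self_eq_norm_sq (𝕜 := ℂ), Finsupp.linearCombination_apply, Finsupp.sum]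
  rw [hon.inner_sum, hon.inner_sum]
  simp only [RCLike.re_to_complex, Complex.re_sum, Finset.mul_sum]
  refine Finset.sum_lt_sum_of_nonempty (Finsupp.support_nonempty_iff.2 hc) fun n hn => ?_
  have hcn : 0 < Complex.normSq (c n) := Complex.normSq_pos.2 (Finsupp.mem_support_iff.1 hn)
  rw [← mul_assoc, ← Complex.normSq_eq_conj_mul_self, ← Complex.ofReal_mul, Complex.ofReal_re,
    Complex.ofReal_re]
  nlinarith [hxt n]

end Variational

/-! ### Hilbert–Schmidt forms and Bessel's inequality. -/

section HilbertSchmidt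

variable {Y : Type*} [MeasurableSpace Y] {ν : Measure Y}

lemma memLp_conj_mul_prod {f g : Y → ℂ} (hf : MemLp f 2 ν) (hg : MemLp g 2 ν) :
    MemLp (fun z : Y × Y => (starRingEnd ℂ) (f z.1) * g z.2) 2 (ν.prod ν) := by
  have hm : AEStronglyMeasurable (fun z : Y × Y => (starRingEnd ℂ) (f z.1) * g z.2)
      (ν.prod ν) :=
    (Complex.continuous_conj.comp_aestronglyMeasurable hf.1.comp_fst).mul hg.1.comp_snd
  rw [memLp_two_iff_integrable_sq_norm hm]
  have h := ((memLp_two_iff_integrable_sq_norm hf.1).1 hf).mul_prod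
    ((memLp_two_iff_integrable_sq_norm hg.1).1 hg)
  refine h.congr (Eventually.of_forall fun z => ?_)
  simp [mul_pow]

variable [SFinite ν]

/-- By Fubini the inner products factor into products of those of the `e i`. Bessel's inequality for
this family bounds the sum of the squared diagonal matrix elements of a kernel by its square norm.
-/
lemma orthonormal_conj_mul_prod {ι : Type*} {e : ι → Lp ℂ 2 ν} (he : Orthonormal ℂ e) :
    Orthonormal ℂ fun i => (memLp_conj_mul_prod (Lp.memLp (e i)) (Lp.memLp (e i))).toLp := by
  classical
  rw [orthonormal_iff_ite] at he ⊢
  intro i j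
  have h : inner ℂ (memLp_conj_mul_prod (Lp.memLp (e i)) (Lp.memLp (e i))).toLp
      (memLp_conj_mul_prod (Lp.memLp (e j)) (Lp.memLp (e j))).toLp
      = inner ℂ (e j) (e i) * inner ℂ (e i) (e j) := by
    rw [L2.inner_def, L2.inner_def, L2.inner_def, ← integral_prod_mul]
    refine integral_congr_ae ?_
    filter_upwards [(memLp_conj_mul_prod (Lp.memLp (e i)) (Lp.memLp (e i))).coeFn_toLp,
      (memLp_conj_mul_prod (Lp.memLp (e j)) (Lp.memLp (e j))).coeFn_toLp] with z h1 h2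
    rw [h1, h2]
    simp only [RCLike.inner_apply, map_mul, Complex.conj_conj]
    ring
  rw [h, he, he]
  by_cases hij : i = j
  · simp [hij]
  · simp [hij, Ne.symm hij]

/-- A Hilbert–Schmidt form dominates the square norm only on spaces of finite dimension. -/
lemma finiteDimensional_of_lt_kernel {κ : Y × Y → ℂ} (hκ : MemLp κ 2 (ν.prod ν))
    {V : Type*} [AddCommGroup V] [Module ℂ V] (J : V →ₗ[ℂ] Lp ℂ 2 ν)
    (hJ : ∀ v, v ≠ 0 → ‖J v‖ ^ 2 <
      ‖∫ z, κ z * (J v z.1 * (starRingEnd ℂ) (J v z.2)) ∂(ν.prod ν)‖) :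
    FiniteDimensional ℂ V := by
  by_contra hV
  have hinj : Function.Injective J := by
    rw [← LinearMap.ker_eq_bot, LinearMap.ker_eq_bot']
    intro v hv
    by_contra hne
    have h := hJ v hne
    have h0 : ∫ z, κ z * (J v z.1 * (starRingEnd ℂ) (J v z.2)) ∂(ν.prod ν) = 0 := by
      refine integral_eq_zero_of_ae ?_
      have := (Measure.quasiMeasurePreserving_fst (μ := ν) (ν := ν)).ae (Lp.coeFn_zero ℂ 2 ν)
      filter_upwards [this] with z hz
      rw [hv, hz]
      simp
    rw [h0, hv] at h
    simp at h
  -- In an `N`-dimensional subspace of the range of `J`, each of the `N` vectors of an orthonormal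
  -- basis gives a diagonal element of modulus above `1`; Bessel then forces `N ≤ ‖κ‖²`, against the
  -- choice of `N`.
  obtain ⟨N, hN⟩ := exists_nat_gt (‖hκ.toLp‖ ^ 2)
  have hrank : (N : Cardinal) ≤ Module.rank ℂ V := by
    refine le_trans (Cardinal.natCast_lt_aleph0 (n := N)).le ?_
    rw [← not_lt]
    exact fun h => hV (Module.rank_lt_aleph0_iff.1 h)
  obtain ⟨f, hf⟩ := exists_linearIndependent_of_le_rank hrank
  have hf' : LinearIndependent ℂ (J ∘ f) := hf.map' J (LinearMap.ker_eq_bot.2 hinj)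
  set W := Submodule.span ℂ (Set.range (J ∘ f)) with hW
  have hWfin : FiniteDimensional ℂ W := FiniteDimensional.span_of_finite ℂ (Set.finite_range _)
  have hdim : Module.finrank ℂ W = N := by
    rw [finrank_span_eq_card hf', Fintype.card_fin]
  have hWJ : W ≤ LinearMap.range J := by
    rw [hW, Submodule.span_le]
    rintro _ ⟨i, rfl⟩
    exact ⟨f i, rfl⟩
  set b := stdOrthonormalBasis ℂ W with hb
  have hbo : Orthonormal ℂ (fun i => (b i : Lp ℂ 2 ν)) :=
    b.orthonormal.comp_linearIsometry W.subtypeₗᵢ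
  have hbessel := (orthonormal_conj_mul_prod hbo).sum_inner_products_le hκ.toLp
    (s := Finset.univ)
  have hone : ∀ i, 1 ≤ ‖inner ℂ (memLp_conj_mul_prod (Lp.memLp (b i : Lp ℂ 2 ν))
      (Lp.memLp (b i : Lp ℂ 2 ν))).toLp hκ.toLp‖ ^ 2 := by
    intro i
    obtain ⟨v, hv⟩ := hWJ (b i).2
    have hnorm : ‖J v‖ = 1 := by rw [hv]; exact hbo.1 i
    have hne : v ≠ 0 := fun h => by simp [h] at hnorm
    have h := hJ v hne
    rw [hnorm] at h
    have heq : inner ℂ (memLp_conj_mul_prod (Lp.memLp (b i : Lp ℂ 2 ν))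
        (Lp.memLp (b i : Lp ℂ 2 ν))).toLp hκ.toLp
        = ∫ z, κ z * (J v z.1 * (starRingEnd ℂ) (J v z.2)) ∂(ν.prod ν) := by
      rw [L2.inner_def]
      refine integral_congr_ae ?_
      filter_upwards [(memLp_conj_mul_prod (Lp.memLp (b i : Lp ℂ 2 ν))
        (Lp.memLp (b i : Lp ℂ 2 ν))).coeFn_toLp, hκ.coeFn_toLp] with z h1 h2
      rw [h1, h2, hv]
      simp
    rw [heq]
    nlinarith
  have hsum := Finset.sum_le_sum fun i (_ : i ∈ Finset.univ) => hone i
  rw [Finset.sum_const, Finset.card_univ, Fintype.card_fin, nsmul_eq_mul, mul_one] at hsum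
  have : (Module.finrank ℂ W : ℝ) = N := by rw [hdim]
  linarith

end HilbertSchmidt

/-! ### Coordinates on the fibre `𝔽_K` and the quadratic form of `H(K)`. -/

noncomputable section Coordinates

instance isNegInvariant_circle : (volume : Measure (AddCircle (2 * π))).IsNegInvariant :=
  inferInstance

instance isNegInvariant_torus : (volume : Measure Torus).IsNegInvariant := inferInstance

/-- The configuration in `𝔽_K` with `k_α = z.1` and `k_{α+1} = z.2`. -/
def pairInv (K : Torus) (α : Fin 3) (z : Torus × Torus) : Torus × Torus :=
  ![(z.1, z.2), (K - z.1 - z.2, z.1), (z.2, K - z.1 - z.2)] α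

@[simp] lemma momenta_pairInv_fst (K : Torus) (α : Fin 3) (z : Torus × Torus) :
    momenta K (pairInv K α z) α = z.1 := by
  fin_cases α <;> simp [momenta, pairInv]

@[simp] lemma momenta_pairInv_snd (K : Torus) (α : Fin 3) (z : Torus × Torus) :
    momenta K (pairInv K α z) (α + 1) = z.2 := by
  fin_cases α <;> simp [momenta, pairInv, sub_sub]

lemma pairInv_momenta (K : Torus) (α : Fin 3) (x : Torus × Torus) :
    pairInv K α (momenta K x α, momenta K x (α + 1)) = x := by
  fin_cases α
  · simp [momenta, pairInv]
  · simp only [momenta, pairInv, Prod.ext_iff]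
    exact ⟨by change K - x.2 - (K - x.1 - x.2) = x.1; abel, by simp⟩
  · simp only [momenta, pairInv, Prod.ext_iff]
    exact ⟨by simp, by simp [sub_sub]⟩

lemma measurePreserving_reflect (K : Torus) :
    MeasurePreserving (fun x : Torus × Torus => (x.1, K - x.1 - x.2)) volume volume := by
  refine MeasurePreserving.skew_product (g := fun s x => K - s - x) (MeasurePreserving.id _) ?_ ?_
  · exact Continuous.measurable (by simp only [Function.uncurry_def]; fun_prop)
  · exact Eventually.of_forall fun s => (Measure.measurePreserving_sub_left volume (K - s)).map_eq

lemma measurePreserving_swap' :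
    MeasurePreserving (Prod.swap : Torus × Torus → Torus × Torus) volume volume :=
  Measure.measurePreserving_swap

/-- All pairs of distinct momenta arise from `(k₁, k₂)` by composing the swap with the reflection
`(k₁, k₂) ↦ (k₁, K - k₁ - k₂)`. -/
lemma measurePreserving_momenta (K : Torus) {α β : Fin 3} (h : α ≠ β) :
    MeasurePreserving (fun x : Torus × Torus => (momenta K x α, momenta K x β))
      volume volume := by
  have hr := measurePreserving_reflect K
  have hs := measurePreserving_swap'
  have hrs := hr.comp hs
  fin_cases α <;> fin_cases β
  · exact absurd rfl h
  · exact MeasurePreserving.id _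
  · exact hr
  · exact hs
  · exact absurd rfl h
  · convert hrs using 2 with x
    simp [momenta, sub_right_comm]
  · exact hs.comp hr
  · convert hs.comp hrs using 2 with x
    simp [momenta, sub_right_comm]
  · exact absurd rfl h

lemma measurePreserving_pairInv (K : Torus) (α : Fin 3) :
    MeasurePreserving (pairInv K α) volume volume := by
  have hr := measurePreserving_reflect K
  have hs := measurePreserving_swap'
  fin_cases α
  · exact MeasurePreserving.id _
  · exact hs.comp hr
  · convert hr.comp hs using 1
    funext x
    simp [pairInv, sub_right_comm]

lemma continuous_pairInv (K : Torus) (α : Fin 3) : Continuous (pairInv K α) := by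
  fin_cases α
  · exact continuous_id
  · change Continuous fun z : Torus × Torus => (K - z.1 - z.2, z.1)
    fun_prop
  · change Continuous fun z : Torus × Torus => (z.2, K - z.1 - z.2)
    fun_prop

lemma measurePreserving_momentum_fst (K : Torus) (α : Fin 3) {F : Torus → ℝ≥0∞}
    (hF : AEMeasurable F) :
    ∫⁻ x, F (momenta K x α) = volume (Set.univ : Set Torus) * ∫⁻ k, F k := by
  have hmp := measurePreserving_momenta K (show α ≠ α + 1 by fin_cases α <;> decide)
  have hF' : AEMeasurable (fun z : Torus × Torus => F z.1) volume := hF.comp_fst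
  have h : ∫⁻ x, F (momenta K x α) = ∫⁻ z : Torus × Torus, F z.1 := by
    conv_rhs => rw [← hmp.map_eq]
    rw [lintegral_map' (by rwa [hmp.map_eq]) hmp.measurable.aemeasurable]
  rw [h, Measure.volume_eq_prod, lintegral_prod _ hF']
  simp [lintegral_mul_const', mul_comm]

lemma memLp_comp_momentum (K : Torus) (α : Fin 3) {u : Torus → ℂ} (hu : MemLp u 2 volume) :
    MemLp (fun x => u (momenta K x α)) 2 (volume : Measure (Torus × Torus)) := by
  have hmp := measurePreserving_momenta K (show α ≠ α + 1 by fin_cases α <;> decide)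
  have h1 : MemLp (fun z : Torus × Torus => u z.1) 2 volume := hu.comp_fst volume
  exact h1.comp_measurePreserving hmp

/-- The index `1` is exceptional because `shift 1 s` adds `s` to the momentum of particle `0`, so
the momentum of particle `1 + 1 = 2` changes by `-s`; in the other cases particle `α + 1` receives
`s`. -/
lemma shift_eq_pairInv (K : Torus) (α : Fin 3) (x : Torus × Torus) (s : Torus) :
    x + shift α s = pairInv K α
      (momenta K x α, momenta K x (α + 1) + if α = 1 then -s else s) := by
  fin_cases α
  · simp [shift, pairInv, momenta, Prod.ext_iff]
  · simp [shift, pairInv, momenta, Prod.ext_iff]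
    abel
  · simp [shift, pairInv, momenta, Prod.ext_iff]
    abel

/-- The integral of `f` over the configurations with `k_α = k`. -/
def fibreMean (K : Torus) (α : Fin 3) (f : Torus × Torus → ℂ) (k : Torus) : ℂ :=
  ∫ q, f (pairInv K α (k, q))

/-- Invariance of the Haar measure under translation and reflection; thus the range of `V_α`
consists of functions of `k_α` alone. -/
lemma fibreIntegral_eq (K : Torus) (α : Fin 3) (f : Torus × Torus → ℂ) (x : Torus × Torus) :
    fibreIntegral α f x = fibreMean K α f (momenta K x α) := by
  unfold fibreIntegral fibreMean
  simp_rw [shift_eq_pairInv K]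
  by_cases h : α = 1
  · simp only [h, if_true]
    have h1 := integral_neg_eq_self (μ := (volume : Measure Torus))
      (fun s => f (pairInv K 1 (momenta K x 1, momenta K x (1 + 1) + s)))
    rw [h1]
    exact integral_add_left_eq_self (μ := (volume : Measure Torus))
      (fun s => f (pairInv K 1 (momenta K x 1, s))) (momenta K x (1 + 1))
  · simp only [h, if_false]
    exact integral_add_left_eq_self (μ := (volume : Measure Torus))
      (fun s => f (pairInv K α (momenta K x α, s))) (momenta K x (α + 1))

lemma fibreMean_congr (K : Torus) (α : Fin 3) {f g : Torus × Torus → ℂ} (h : f =ᵐ[volume] g) :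
    fibreMean K α f =ᵐ[volume] fibreMean K α g := by
  have h' := Measure.ae_ae_of_ae_prod ((measurePreserving_pairInv K α).quasiMeasurePreserving.ae h)
  filter_upwards [h'] with x hx
  exact integral_congr_ae hx

lemma integrable_pairInv (K : Torus) (α : Fin 3) {f : Torus × Torus → ℂ}
    (hf : MemLp f 2 volume) : ∀ᵐ k, Integrable fun q => f (pairInv K α (k, q)) := by
  have h := (measurePreserving_pairInv K α).integrable_comp_of_integrable
    (hf.integrable (by norm_num))
  exact Integrable.prod_right_ae h

/-- The lift of the mean to `𝔽_K` is the fibre integral, already known to be in `L²`; lifting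
multiplies the squared norm by the positive volume of the torus, which can be cancelled. -/
lemma memLp_fibreMean (K : Torus) (α : Fin 3) {f : Torus × Torus → ℂ} (hf : MemLp f 2 volume) :
    MemLp (fibreMean K α f) 2 volume := by
  have hm : AEStronglyMeasurable (fibreMean K α f) volume :=
    (hf.1.comp_measurePreserving (measurePreserving_pairInv K α)).integral_prod_right'
  have h := memLp_fibreIntegral α hf
  have hfun : fibreIntegral α f = fun x => fibreMean K α f (momenta K x α) :=
    funext (fibreIntegral_eq K α f)
  rw [hfun] at h
  have h2 := lintegral_rpow_enorm_lt_top_of_eLpNorm_lt_top two_ne_zero ENNReal.ofNat_ne_top h.2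
  refine ⟨hm, ?_⟩
  refine (eLpNorm_lt_top_iff_lintegral_rpow_enorm_lt_top two_ne_zero ENNReal.ofNat_ne_top).2 ?_
  have h3 := measurePreserving_momentum_fst K α
    (F := fun k => ‖fibreMean K α f k‖ₑ ^ (2 : ℝ≥0∞).toReal) (hm.enorm.pow_const _)
  rw [h3] at h2
  exact ENNReal.lt_top_of_mul_ne_top_right h2.ne (isOpen_univ.measure_pos _ Set.univ_nonempty).ne'

lemma integral_comp_measurePreserving {X Y : Type*} [MeasurableSpace X] [MeasurableSpace Y]
    {μ : Measure X} {ν : Measure Y} {φ : X → Y} (hφ : MeasurePreserving φ μ ν) {F : Type*}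
    [NormedAddCommGroup F] [NormedSpace ℝ F] {g : Y → F} (hg : AEStronglyMeasurable g ν) :
    ∫ x, g (φ x) ∂μ = ∫ y, g y ∂ν := by
  conv_rhs => rw [← hφ.map_eq]
  rw [integral_map hφ.measurable.aemeasurable (by rwa [hφ.map_eq])]

lemma integral_eq_integral_fibre (K : Torus) (α : Fin 3) {F : Type*} [NormedAddCommGroup F]
    [NormedSpace ℝ F] {g : Torus × Torus → F} (hg : Integrable g) :
    ∫ x, g x = ∫ k, ∫ q, g (pairInv K α (k, q)) := by
  have hmp := measurePreserving_pairInv K α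
  rw [← integral_comp_measurePreserving hmp hg.1]
  exact integral_prod _ (hmp.integrable_comp_of_integrable hg)

lemma integral_comp_momentum_mul (K : Torus) (α : Fin 3) {u : Torus → ℂ}
    {f : Torus × Torus → ℂ} (hu : MemLp u 2 volume) (hf : MemLp f 2 volume) :
    ∫ x, u (momenta K x α) * f x = ∫ k, u k * fibreMean K α f k := by
  have h := integral_eq_integral_fibre K α ((memLp_comp_momentum K α hu).integrable_mul hf)
  simp only [Pi.mul_apply, momenta_pairInv_fst] at h
  rw [h]
  refine integral_congr_ae (Eventually.of_forall fun k => ?_)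
  exact integral_const_mul _ _

lemma fibreMean_conj (K : Torus) (α : Fin 3) (f : Torus × Torus → ℂ) (k : Torus) :
    fibreMean K α (fun x => (starRingEnd ℂ) (f x)) k = (starRingEnd ℂ) (fibreMean K α f k) :=
  integral_conj

lemma memLp_conj {X : Type*} [MeasurableSpace X] {μ : Measure X} {p : ℝ≥0∞} {f : X → ℂ}
    (hf : MemLp f p μ) : MemLp (fun x => (starRingEnd ℂ) (f x)) p μ :=
  hf.star

lemma inner_fibreIntegralL (K : Torus) (α : Fin 3) (g f : State) :
    inner ℂ g (fibreIntegralL α f)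
      = ∫ k, fibreMean K α f k * (starRingEnd ℂ) (fibreMean K α g k) := by
  simp_rw [← fibreMean_conj]
  rw [← integral_comp_momentum_mul K α (memLp_fibreMean K α (Lp.memLp f))
    (memLp_conj (Lp.memLp g)), L2.inner_def]
  refine integral_congr_ae ?_
  filter_upwards [fibreIntegralL_apply α f] with x hx
  rw [hx, fibreIntegral_eq K, RCLike.inner_apply]

lemma inner_freeHamiltonian (l : Fin 3 → ℝ) (K : Torus) (g f : State) :
    inner ℂ g (freeHamiltonian l K f)
      = ∫ x, (kineticEnergy l K x : ℂ) * (f x * (starRingEnd ℂ) (g x)) := by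
  rw [L2.inner_def]
  refine integral_congr_ae ?_
  filter_upwards [freeHamiltonian_apply l K f] with x hx
  rw [hx, RCLike.inner_apply, mul_assoc]

lemma isSelfAdjoint_hamiltonian (l μ : Fin 3 → ℝ) (K : Torus) :
    IsSelfAdjoint (hamiltonian l μ K) := by
  have h1 : IsSelfAdjoint (freeHamiltonian l K) := by
    rw [ContinuousLinearMap.isSelfAdjoint_iff_isSymmetric]
    intro g f
    change inner ℂ (freeHamiltonian l K g) f = inner ℂ g (freeHamiltonian l K f)
    rw [← inner_conj_symm, inner_freeHamiltonian, inner_freeHamiltonian, ← integral_conj]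
    refine integral_congr_ae (Eventually.of_forall fun x => ?_)
    simp [mul_comm]
  have h2 : ∀ α, IsSelfAdjoint (interaction μ α) := by
    intro α
    refine IsSelfAdjoint.smul (Complex.conj_ofReal _) ?_
    rw [ContinuousLinearMap.isSelfAdjoint_iff_isSymmetric]
    intro g f
    change inner ℂ (fibreIntegralL α g) f = inner ℂ g (fibreIntegralL α f)
    rw [← inner_conj_symm, inner_fibreIntegralL K, inner_fibreIntegralL K, ← integral_conj]
    refine integral_congr_ae (Eventually.of_forall fun x => ?_)
    simp [mul_comm]
  exact h1.sub (isSelfAdjoint_sum _ fun α _ => h2 α)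

/-- The quadratic form of `H(K)`. -/
lemma re_inner_hamiltonian (l μ : Fin 3 → ℝ) (K : Torus) (f : State) :
    (inner ℂ f (hamiltonian l μ K f)).re = (∫ x, kineticEnergy l K x * ‖f x‖ ^ 2)
      - ∑ α, μ α / (2 * π) ^ 3 * ∫ k, ‖fibreMean K α f k‖ ^ 2 := by
  have h1 : inner ℂ f (freeHamiltonian l K f)
      = ((∫ x, kineticEnergy l K x * ‖f x‖ ^ 2 : ℝ) : ℂ) := by
    rw [inner_freeHamiltonian, ← integral_complex_ofReal]
    refine integral_congr_ae (Eventually.of_forall fun x => ?_)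
    simp [Complex.mul_conj']
  have h2 : ∀ α, inner ℂ f (interaction μ α f)
      = ((μ α / (2 * π) ^ 3 * ∫ k, ‖fibreMean K α f k‖ ^ 2 : ℝ) : ℂ) := by
    intro α
    rw [interaction, smul_apply, inner_smul_right, inner_fibreIntegralL K,
      Complex.ofReal_mul, ← integral_complex_ofReal]
    congr 1
    refine integral_congr_ae (Eventually.of_forall fun x => ?_)
    simp [Complex.mul_conj']
  rw [hamiltonian, sub_apply, inner_sub_right, h1,
    sum_apply, inner_sum, Finset.sum_congr rfl fun α _ => h2 α,
    ← Complex.ofReal_sum, ← Complex.ofReal_sub, Complex.ofReal_re]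

lemma integrable_kineticEnergy_mul (l : Fin 3 → ℝ) (K : Torus) (z : ℝ) (f : State) :
    Integrable fun x => (kineticEnergy l K x - z) * ‖f x‖ ^ 2 := by
  have hc : Continuous fun x => kineticEnergy l K x - z :=
    (continuous_kineticEnergy l K).sub continuous_const
  obtain ⟨C, hC⟩ := isCompact_univ.exists_bound_of_continuousOn hc.continuousOn
  exact ((memLp_two_iff_integrable_sq_norm (Lp.memLp f).1).1 (Lp.memLp f)).bdd_mul
    hc.aestronglyMeasurable (Eventually.of_forall fun x => hC x trivial)

lemma norm_sq_eq_integral {X : Type*} [MeasurableSpace X] {μ : Measure X} (f : Lp ℂ 2 μ) :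
    ‖f‖ ^ 2 = ∫ x, ‖f x‖ ^ 2 ∂μ := by
  rw [← inner_self_eq_norm_sq (𝕜 := ℂ), L2.inner_def]
  have : ∫ x, inner ℂ (f x) (f x) ∂μ = ((∫ x, ‖f x‖ ^ 2 ∂μ : ℝ) : ℂ) := by
    rw [← integral_complex_ofReal]
    refine integral_congr_ae (Eventually.of_forall fun x => ?_)
    simp
  rw [this]
  simp

/-- The quadratic form of `H(K) - z`. -/
lemma re_inner_hamiltonian_sub (l μ : Fin 3 → ℝ) (K : Torus) (z : ℝ) (f : State) :
    (inner ℂ f (hamiltonian l μ K f)).re - z * ‖f‖ ^ 2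
      = (∫ x, (kineticEnergy l K x - z) * ‖f x‖ ^ 2)
        - ∑ α, μ α / (2 * π) ^ 3 * ∫ k, ‖fibreMean K α f k‖ ^ 2 := by
  have h1 := integrable_kineticEnergy_mul l K 0 f
  have h2 := ((memLp_two_iff_integrable_sq_norm (Lp.memLp f).1).1 (Lp.memLp f)).const_mul z
  simp only [sub_zero] at h1
  rw [re_inner_hamiltonian, norm_sq_eq_integral, ← integral_const_mul]
  simp_rw [sub_mul]
  rw [integral_sub h1 h2]
  ring

end Coordinates

/-! ### Pair determinants, trial states and the essential spectrum. -/

noncomputable section PairDeterminant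

variable {l μ : Fin 3 → ℝ} {K : Torus} {z : ℝ}

/-- The integral over the fibre `k_α = k` of the free resolvent at `z`. -/
def resolventMean (l : Fin 3 → ℝ) (K : Torus) (z : ℝ) (α : Fin 3) (k : Torus) : ℝ :=
  ∫ q, (kineticEnergy l K (pairInv K α (k, q)) - z)⁻¹

/-- The Fredholm determinant of the pair complementary to `α`, when `k_α = k`. -/
def pairDet (l μ : Fin 3 → ℝ) (K : Torus) (z : ℝ) (α : Fin 3) (k : Torus) : ℝ :=
  1 - μ α / (2 * π) ^ 3 * resolventMean l K z α k

lemma continuous_resolvent (hz : ∀ x, z < kineticEnergy l K x) :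
    Continuous fun x => (kineticEnergy l K x - z)⁻¹ :=
  ((continuous_kineticEnergy l K).sub continuous_const).inv₀ fun x => (sub_pos.2 (hz x)).ne'

lemma continuous_resolventMean (hz : ∀ x, z < kineticEnergy l K x) (α : Fin 3) :
    Continuous (resolventMean l K z α) := by
  have h := continuous_parametric_integral_of_continuous (μ := (volume : Measure Torus))
    (f := fun k q => (kineticEnergy l K (pairInv K α (k, q)) - z)⁻¹)
    ((continuous_resolvent hz).comp (continuous_pairInv K α)) isCompact_univ
  simp only [Measure.restrict_univ] at h
  exact h

lemma continuous_pairDet (hz : ∀ x, z < kineticEnergy l K x) (α : Fin 3) :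
    Continuous (pairDet l μ K z α) :=
  continuous_const.sub (continuous_const.mul (continuous_resolventMean hz α))

lemma integrable_resolvent_fibre (hz : ∀ x, z < kineticEnergy l K x) (α : Fin 3) (k : Torus) :
    Integrable fun q => (kineticEnergy l K (pairInv K α (k, q)) - z)⁻¹ := by
  have hc : Continuous fun q : Torus => (kineticEnergy l K (pairInv K α (k, q)) - z)⁻¹ :=
    ((continuous_resolvent hz).comp (continuous_pairInv K α)).comp (by fun_prop)
  exact hc.integrable_of_hasCompactSupport (HasCompactSupport.of_compactSpace _)

lemma resolventMean_pos (hz : ∀ x, z < kineticEnergy l K x) (α : Fin 3) (k : Torus) :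
    0 < resolventMean l K z α k := by
  have hpos : ∀ q, 0 < (kineticEnergy l K (pairInv K α (k, q)) - z)⁻¹ :=
    fun q => inv_pos.2 (sub_pos.2 (hz _))
  rw [resolventMean, integral_pos_iff_support_of_nonneg (fun q => (hpos q).le)
    (integrable_resolvent_fibre hz α k)]
  rw [show (Function.support fun q => (kineticEnergy l K (pairInv K α (k, q)) - z)⁻¹) = Set.univ
    from Set.eq_univ_of_forall fun q => (hpos q).ne']
  exact isOpen_univ.measure_pos _ Set.univ_nonempty

lemma exists_resolvent_le (hz : ∀ x, z < kineticEnergy l K x) :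
    ∃ C, 0 ≤ C ∧ ∀ x, (kineticEnergy l K x - z)⁻¹ ≤ C := by
  obtain ⟨C, hC⟩ := isCompact_univ.exists_bound_of_continuousOn (continuous_resolvent hz).continuousOn
  exact ⟨C, (norm_nonneg _).trans (hC 0 trivial), fun x => (le_abs_self _).trans (hC x trivial)⟩

lemma memLp_resolvent_mul (hz : ∀ x, z < kineticEnergy l K x) {f : Torus × Torus → ℂ}
    (hf : MemLp f 2 volume) :
    MemLp (fun x => (((kineticEnergy l K x - z)⁻¹ : ℝ) : ℂ) * f x) 2 volume := by
  obtain ⟨C, -, hC⟩ := exists_resolvent_le hz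
  refine MemLp.of_le_mul (c := C) hf ?_ (Eventually.of_forall fun x => ?_)
  · exact (Complex.continuous_ofReal.comp (continuous_resolvent hz)).aestronglyMeasurable.mul hf.1
  · rw [norm_mul, Complex.norm_real, Real.norm_of_nonneg (inv_nonneg.2 (sub_pos.2 (hz x)).le)]
    exact mul_le_mul_of_nonneg_right (hC x) (norm_nonneg _)

/-- The trial state `φ(k_α) / (E - z)`. -/
def trialState (hz : ∀ x, z < kineticEnergy l K x) (α : Fin 3) {φ : Torus → ℂ}
    (hφ : MemLp φ 2 volume) : State :=
  (memLp_resolvent_mul hz (memLp_comp_momentum K α hφ)).toLp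

lemma fibreMean_trialState (hz : ∀ x, z < kineticEnergy l K x) (α : Fin 3) {φ : Torus → ℂ}
    (hφ : MemLp φ 2 volume) :
    fibreMean K α (trialState hz α hφ) =ᵐ[volume]
      fun k => (resolventMean l K z α k : ℂ) * φ k := by
  refine (fibreMean_congr K α
    (memLp_resolvent_mul hz (memLp_comp_momentum K α hφ)).coeFn_toLp).trans
    (Eventually.of_forall fun k => ?_)
  simp only [fibreMean, momenta_pairInv_fst]
  rw [integral_mul_const, resolventMean, integral_complex_ofReal]

lemma integral_kinetic_trialState (hz : ∀ x, z < kineticEnergy l K x) (α : Fin 3)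
    {φ : Torus → ℂ} (hφ : MemLp φ 2 volume) :
    ∫ x, (kineticEnergy l K x - z) * ‖trialState hz α hφ x‖ ^ 2
      = ∫ k, resolventMean l K z α k * ‖φ k‖ ^ 2 := by
  have h1 : (fun x => (kineticEnergy l K x - z) * ‖trialState hz α hφ x‖ ^ 2) =ᵐ[volume]
      fun x => (kineticEnergy l K x - z)⁻¹ * ‖φ (momenta K x α)‖ ^ 2 := by
    filter_upwards [(memLp_resolvent_mul hz (memLp_comp_momentum K α hφ)).coeFn_toLp] with x hx
    rw [trialState, hx, norm_mul, Complex.norm_real, mul_pow, Real.norm_eq_abs, sq_abs]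
    have := (sub_pos.2 (hz x)).ne'
    field_simp
  have h2 : Integrable fun x => (kineticEnergy l K x - z)⁻¹ * ‖φ (momenta K x α)‖ ^ 2 :=
    (integrable_kineticEnergy_mul l K z (trialState hz α hφ)).congr h1
  rw [integral_congr_ae h1, integral_eq_integral_fibre K α h2]
  refine integral_congr_ae (Eventually.of_forall fun k => ?_)
  simp only [momenta_pairInv_fst]
  rw [integral_mul_const, resolventMean]

/-- The interactions other than `V_α` are nonnegative and are dropped. On the trial state the rest
equals `∫ R (1 - μ_α (2π)⁻³ R) |φ|²`, where `R` is the resolvent mean. -/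
lemma trialState_form_le (hz : ∀ x, z < kineticEnergy l K x) (hμ : ∀ i, 0 < μ i) (α : Fin 3)
    {φ : Torus → ℂ} (hφ : MemLp φ 2 volume) :
    (inner ℂ (trialState hz α hφ) (hamiltonian l μ K (trialState hz α hφ))).re
        - z * ‖trialState hz α hφ‖ ^ 2
      ≤ ∫ k, resolventMean l K z α k * pairDet l μ K z α k * ‖φ k‖ ^ 2 := by
  have hφ2 := (memLp_two_iff_integrable_sq_norm hφ.1).1 hφ
  have hbdd : ∀ g : Torus → ℝ, Continuous g → Integrable fun k => g k * ‖φ k‖ ^ 2 := by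
    intro g hg
    obtain ⟨C, hC⟩ := isCompact_univ.exists_bound_of_continuousOn hg.continuousOn
    exact hφ2.bdd_mul hg.aestronglyMeasurable (Eventually.of_forall fun x => hC x trivial)
  have hR := continuous_resolventMean hz α
  rw [re_inner_hamiltonian_sub, integral_kinetic_trialState]
  have h1 : μ α / (2 * π) ^ 3 * ∫ k, ‖fibreMean K α (trialState hz α hφ) k‖ ^ 2
      ≤ ∑ β, μ β / (2 * π) ^ 3 * ∫ k, ‖fibreMean K β (trialState hz α hφ) k‖ ^ 2 :=
    Finset.single_le_sum (f := fun β => μ β / (2 * π) ^ 3 *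
      ∫ k, ‖fibreMean K β (trialState hz α hφ) k‖ ^ 2) (fun β _ => mul_nonneg
        (div_nonneg (hμ β).le (by positivity)) (integral_nonneg fun _ => by positivity))
      (Finset.mem_univ α)
  have h2 : ∫ k, ‖fibreMean K α (trialState hz α hφ) k‖ ^ 2
      = ∫ k, resolventMean l K z α k ^ 2 * ‖φ k‖ ^ 2 := by
    refine integral_congr_ae ?_
    filter_upwards [fibreMean_trialState hz α hφ] with k hk
    rw [hk, norm_mul, Complex.norm_real, mul_pow, Real.norm_eq_abs, sq_abs]
  rw [h2, ← integral_const_mul] at h1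
  have h3 : ∫ k, resolventMean l K z α k * pairDet l μ K z α k * ‖φ k‖ ^ 2
      = (∫ k, resolventMean l K z α k * ‖φ k‖ ^ 2)
        - ∫ k, μ α / (2 * π) ^ 3 * (resolventMean l K z α k ^ 2 * ‖φ k‖ ^ 2) := by
    rw [← integral_sub (hbdd _ hR) ((hbdd (fun k => resolventMean l K z α k ^ 2) (hR.pow 2)).const_mul _)]
    refine integral_congr_ae (Eventually.of_forall fun k => ?_)
    simp only [pairDet]
    ring
  linarith

instance nullSingletonClass_circle :
    NullSingletonClass (volume : Measure (AddCircle (2 * π))) where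
  measure_singleton x := by
    rw [← Metric.closedBall_zero, AddCircle.volume_closedBall]
    simp [Real.pi_pos.le]

instance nullSingletonClass_torus : NullSingletonClass (volume : Measure Torus) where
  measure_singleton x := by
    rw [← Set.univ_pi_singleton, volume_pi_pi]
    simp

/-- Nonempty open sets have positive measure and finite sets have none, so `U` is an infinite
Hausdorff space. The disjoint pieces carry infinitely many independent amplitudes for trial states.
-/
lemma exists_disjoint_open_subsets {U : Set Torus} (hU : IsOpen U) (hne : U.Nonempty) :
    ∃ W : ℕ → Set Torus, (∀ n, IsOpen (W n)) ∧ (∀ n, (W n).Nonempty) ∧ (∀ n, W n ⊆ U) ∧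
      Pairwise (Function.onFun Disjoint W) := by
  have hinf : U.Infinite := by
    intro hfin
    exact (hU.measure_pos volume hne).ne' (hfin.measure_zero _)
  have : Infinite U := hinf.to_subtype
  obtain ⟨W, hW1, hW2, hW3⟩ := exists_seq_infinite_isOpen_pairwise_disjoint U
  refine ⟨fun n => (↑) '' W n, fun n => hU.isOpenMap_subtype_val _ (hW2 n),
    fun n => (hW1 n).nonempty.image _, fun n => by simp, fun i j hij => ?_⟩
  exact (Set.disjoint_image_iff Subtype.val_injective).2 (hW3 hij)

/-- If a pair determinant is negative somewhere at an energy `z` below the free spectrum, then the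
essential spectrum reaches below `z`. -/
lemma essentialBottom_le_of_pairDet_neg (hz : ∀ x, z < kineticEnergy l K x) (hμ : ∀ i, 0 < μ i)
    {α : Fin 3} {k : Torus} (hk : pairDet l μ K z α k < 0) :
    essentialBottom (hamiltonian l μ K) ≤ z := by
  have hU : IsOpen {k | pairDet l μ K z α k < 0} :=
    isOpen_lt (continuous_pairDet hz α) continuous_const
  obtain ⟨W, hWo, hWne, hWU, hWd⟩ := exists_disjoint_open_subsets hU ⟨k, hk⟩
  -- Amplitudes constant on each `W n` and supported where the determinant is negative: the form of
  -- the trial state is then strictly negative for every nonzero `c`, so injectivity of `J` need not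
  -- be checked.
  let Φ : (ℕ →₀ ℂ) →ₗ[ℂ] (Torus → ℂ) :=
    Finsupp.linearCombination ℂ fun n => (W n).indicator 1
  have hΦ : ∀ c, MemLp (Φ c) 2 volume := by
    intro c
    simp only [Φ, Finsupp.linearCombination_apply, Finsupp.sum]
    refine memLp_finsetSum' _ fun n _ => MemLp.const_smul ?_ _
    exact memLp_indicator_const 2 (hWo n).measurableSet (1 : ℂ) (Or.inr (measure_ne_top _ _))
  let J : (ℕ →₀ ℂ) →ₗ[ℂ] State :=
    { toFun := fun c => trialState hz α (hΦ c)
      map_add' := fun c d => by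
        rw [trialState, trialState, trialState, ← MemLp.toLp_add]
        refine MemLp.toLp_congr _ _ (Eventually.of_forall fun x => ?_)
        simp [mul_add]
      map_smul' := fun a c => by
        rw [trialState, trialState, RingHom.id_apply, ← MemLp.toLp_const_smul]
        refine MemLp.toLp_congr _ _ (Eventually.of_forall fun x => ?_)
        simp [mul_left_comm] }
  refine essentialBottom_le (isSelfAdjoint_hamiltonian l μ K) (V := ℕ →₀ ℂ) ?_ J fun c hc => ?_
  · intro h
    exact not_finite_iff_infinite.2 inferInstance
      (Module.Finite.finite_basis (Finsupp.basisSingleOne (R := ℂ) (ι := ℕ)))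
  · have hform := trialState_form_le hz hμ α (hΦ c)
    obtain ⟨n, hn⟩ := Finsupp.ne_iff.1 hc
    have hval : ∀ k ∈ W n, Φ c k = c n := by
      intro k hk
      simp only [Φ, Finsupp.linearCombination_apply, Finsupp.sum, Finset.sum_apply, Pi.smul_apply]
      rw [Finset.sum_eq_single n]
      · simp [hk]
      · intro m _ hmn
        have : k ∉ W m := fun hkm => Set.disjoint_left.1 (hWd hmn) hkm hk
        simp [this]
      · intro hns
        simp [Finsupp.notMem_support_iff.1 hns]
    have hout : ∀ k, 0 ≤ pairDet l μ K z α k → Φ c k = 0 := by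
      intro k hk
      simp only [Φ, Finsupp.linearCombination_apply, Finsupp.sum, Finset.sum_apply, Pi.smul_apply]
      refine Finset.sum_eq_zero fun m _ => ?_
      have : k ∉ W m := fun hkm => absurd (hWU m hkm) (not_lt.2 hk)
      simp [this]
    have hneg : 0 < ∫ k, -(resolventMean l K z α k * pairDet l μ K z α k * ‖Φ c k‖ ^ 2) := by
      rw [integral_pos_iff_support_of_nonneg]
      · refine lt_of_lt_of_le ((hWo n).measure_pos volume (hWne n)) (measure_mono fun k hk => ?_)
        rw [Function.mem_support, neg_ne_zero, hval k hk]
        have h1 := resolventMean_pos hz α k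
        have h2 : pairDet l μ K z α k < 0 := hWU n hk
        exact mul_ne_zero (mul_ne_zero h1.ne' h2.ne) (pow_ne_zero _ (norm_ne_zero_iff.2 hn))
      · intro k
        have h1 := resolventMean_pos hz α k
        rcases le_or_gt 0 (pairDet l μ K z α k) with h2 | h2
        · simp [hout k h2]
        · have := mul_nonneg (mul_nonneg h1.le (neg_nonneg.2 h2.le)) (sq_nonneg ‖Φ c k‖)
          simp only [Pi.zero_apply]
          linarith
      · have hg : Continuous fun k => resolventMean l K z α k * pairDet l μ K z α k :=
          (continuous_resolventMean hz α).mul (continuous_pairDet hz α)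
        obtain ⟨C, hC⟩ := isCompact_univ.exists_bound_of_continuousOn hg.continuousOn
        exact (((memLp_two_iff_integrable_sq_norm (hΦ c).1).1 (hΦ c)).bdd_mul
          hg.aestronglyMeasurable (Eventually.of_forall fun x => hC x trivial)).neg
    rw [integral_neg] at hneg
    change (inner ℂ (trialState hz α (hΦ c)) (hamiltonian l μ K (trialState hz α (hΦ c)))).re
      < z * ‖trialState hz α (hΦ c)‖ ^ 2
    linarith

/-- Negativity of the determinant at `k` persists at slightly lower energies, where the non-strict
bound applies. -/
lemma essentialBottom_lt_of_pairDet_neg (hz : ∀ x, z < kineticEnergy l K x) (hμ : ∀ i, 0 < μ i)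
    {α : Fin 3} {k : Torus} (hk : pairDet l μ K z α k < 0) :
    essentialBottom (hamiltonian l μ K) < z := by
  -- The energy `z - |t|` stays below the free spectrum for every real `t`, so the parametric
  -- integral is continuous on the whole line.
  have hcont : Continuous fun t : ℝ => pairDet l μ K (z - |t|) α k := by
    have h := continuous_parametric_integral_of_continuous (μ := (volume : Measure Torus))
      (f := fun (t : ℝ) q => (kineticEnergy l K (pairInv K α (k, q)) - (z - |t|))⁻¹)
      (by
        refine Continuous.inv₀ ?_ fun p => ?_
        · have h1 : Continuous fun p : ℝ × Torus => pairInv K α (k, p.2) :=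
            (continuous_pairInv K α).comp (by fun_prop)
          have h2 := (continuous_kineticEnergy l K).comp h1
          exact h2.sub (by fun_prop)
        · have := hz (pairInv K α (k, p.2))
          have := abs_nonneg p.1
          exact ne_of_gt (by linarith)) isCompact_univ
    simp only [Measure.restrict_univ] at h
    exact continuous_const.sub (continuous_const.mul h)
  have hev : ∀ᶠ t in 𝓝 (0 : ℝ), pairDet l μ K (z - |t|) α k < 0 :=
    hcont.continuousAt.eventually_lt continuousAt_const (by simpa using hk)
  obtain ⟨ε, hε, hball⟩ := Metric.eventually_nhds_iff.1 hev
  have h := hball (y := ε / 2) (by simp [abs_of_pos hε]; linarith)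
  have hle := essentialBottom_le_of_pairDet_neg (z := z - |ε / 2|)
    (fun x => by have := hz x; have := abs_nonneg (ε / 2); linarith) hμ h
  have : 0 < |ε / 2| := abs_pos.2 (by positivity)
  linarith

end PairDeterminant

/-! ### Sums of image measures, for joining the three channels in one `L²` space. -/

noncomputable section SumMap

variable {ι X Y : Type*} [Fintype ι] [MeasurableSpace X] [MeasurableSpace Y] {μ : Measure X}
  {e : ι → X → Y}

/-- The sum of the images of `μ` under a finite family of maps. -/
def sumMap (μ : Measure X) (e : ι → X → Y) : Measure Y := Measure.sum fun i => μ.map (e i)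

instance [SFinite μ] : SFinite (sumMap μ e) := by
  unfold sumMap
  infer_instance

lemma ae_sumMap_iff (he : ∀ i, MeasurableEmbedding (e i)) {p : Y → Prop} :
    (∀ᵐ y ∂(sumMap μ e), p y) ↔ ∀ i, ∀ᵐ x ∂μ, p (e i x) := by
  rw [sumMap, Measure.ae_sum_iff]
  exact forall_congr' fun i => (he i).ae_map_iff

lemma integral_sumMap (he : ∀ i, MeasurableEmbedding (e i)) {F : Type*} [NormedAddCommGroup F]
    [NormedSpace ℝ F] {g : Y → F} (hg : Integrable g (sumMap μ e)) :
    ∫ y, g y ∂(sumMap μ e) = ∑ i, ∫ x, g (e i x) ∂μ := by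
  rw [sumMap, integral_sum_measure hg, tsum_fintype]
  exact Finset.sum_congr rfl fun i _ => (he i).integral_map g

lemma memLp_sumMap (he : ∀ i, MeasurableEmbedding (e i)) {g : Y → ℂ}
    (hg : ∀ i, MemLp (fun x => g (e i x)) 2 μ) : MemLp g 2 (sumMap μ e) := by
  refine ⟨aestronglyMeasurable_sum_measure_iff.2 fun i =>
    (he i).aestronglyMeasurable_map_iff.2 (hg i).1, ?_⟩
  refine (eLpNorm_lt_top_iff_lintegral_rpow_enorm_lt_top two_ne_zero ENNReal.ofNat_ne_top).2 ?_
  rw [sumMap, lintegral_sum_measure, tsum_fintype]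
  refine ENNReal.sum_lt_top.2 fun i _ => ?_
  rw [(he i).lintegral_map]
  exact lintegral_rpow_enorm_lt_top_of_eLpNorm_lt_top two_ne_zero ENNReal.ofNat_ne_top (hg i).2

lemma sumMap_prod_sumMap [SFinite μ] (he : ∀ i, Measurable (e i)) :
    (sumMap μ e).prod (sumMap μ e)
      = sumMap (μ.prod μ) fun p : ι × ι => Prod.map (e p.1) (e p.2) := by
  rw [sumMap, Measure.prod_sum, sumMap]
  congr 1
  funext p
  exact Measure.map_prod_map μ μ (he p.1) (he p.2)

end SumMap

/-! ### The Birman–Schwinger argument below the free spectrum. -/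

noncomputable section BirmanSchwinger

variable {l μ : Fin 3 → ℝ} {K : Torus} {z : ℝ}

/-- The sesquilinear coupling of the fibre means of `f` through the free resolvent. -/
def coupling (l : Fin 3 → ℝ) (K : Torus) (z : ℝ) (f : Torus × Torus → ℂ) (α β : Fin 3) : ℂ :=
  ∫ x, (((kineticEnergy l K x - z)⁻¹ : ℝ) : ℂ) *
    (fibreMean K α f (momenta K x α) * (starRingEnd ℂ) (fibreMean K β f (momenta K x β)))

lemma memLp_fibreMean_momentum (K : Torus) (α : Fin 3) {f : Torus × Torus → ℂ}
    (hf : MemLp f 2 volume) : MemLp (fun x => fibreMean K α f (momenta K x α)) 2 volume :=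
  memLp_comp_momentum K α (memLp_fibreMean K α hf)

lemma integrable_coupling (hz : ∀ x, z < kineticEnergy l K x) {f : Torus × Torus → ℂ}
    (hf : MemLp f 2 volume) (α β : Fin 3) :
    Integrable fun x => (((kineticEnergy l K x - z)⁻¹ : ℝ) : ℂ) *
      (fibreMean K α f (momenta K x α) * (starRingEnd ℂ) (fibreMean K β f (momenta K x β))) := by
  have h := (memLp_resolvent_mul hz (memLp_fibreMean_momentum K α hf)).integrable_mul
    (memLp_conj (memLp_fibreMean_momentum K β hf))
  refine h.congr (Eventually.of_forall fun x => ?_)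
  simp [mul_assoc]

lemma coupling_self (hz : ∀ x, z < kineticEnergy l K x) {f : Torus × Torus → ℂ}
    (hf : MemLp f 2 volume) (α : Fin 3) :
    coupling l K z f α α = ((∫ k, resolventMean l K z α k * ‖fibreMean K α f k‖ ^ 2 : ℝ) : ℂ) := by
  rw [coupling, integral_eq_integral_fibre K α (integrable_coupling hz hf α α),
    ← integral_complex_ofReal]
  refine integral_congr_ae (Eventually.of_forall fun k => ?_)
  simp only [momenta_pairInv_fst]
  rw [integral_mul_const, integral_complex_ofReal, Complex.mul_conj', resolventMean]
  push_cast
  rfl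

/-- Let `v = ∑ w_α F_α(k_α)`, where `F_α` are the fibre means of `f` and `w_α = μ_α (2π)⁻³`, and let
`S = ∑ w_α ∫ |F_α|²` be the interaction energy. Then `2S = 2 Re ∫ v̄ f ≤ ∫ (E - z)|f|² + ∫ (E - z)⁻¹
|v|²`. Negativity of the form says that the first integral is below `S`, so `S` is below the second
one, which expands into the couplings. -/
lemma sum_fibreMean_lt (hz : ∀ x, z < kineticEnergy l K x) {f : State}
    (hf : (inner ℂ f (hamiltonian l μ K f)).re < z * ‖f‖ ^ 2) :
    ∑ α, μ α / (2 * π) ^ 3 * ∫ k, ‖fibreMean K α f k‖ ^ 2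
      < ∑ α, ∑ β, μ α / (2 * π) ^ 3 * (μ β / (2 * π) ^ 3) * (coupling l K z f α β).re := by
  set w : Fin 3 → ℝ := fun α => μ α / (2 * π) ^ 3 with hw
  have hform := re_inner_hamiltonian_sub l μ K z f
  have hFm : ∀ α, MemLp (fun x => fibreMean K α f (momenta K x α)) 2 volume :=
    fun α => memLp_fibreMean_momentum K α (Lp.memLp f)
  set v : Torus × Torus → ℂ := fun x => ∑ α, (w α : ℂ) * fibreMean K α f (momenta K x α) with hv
  have hI := integrable_kineticEnergy_mul l K z f
  have hcross : ∀ α, Integrable fun x =>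
      (starRingEnd ℂ) (fibreMean K α f (momenta K x α)) * f x := fun α =>
    (memLp_conj (hFm α)).integrable_mul (Lp.memLp f)
  have hcross_eq : ∀ α, ∫ x, (starRingEnd ℂ) (fibreMean K α f (momenta K x α)) * f x
      = ((∫ k, ‖fibreMean K α f k‖ ^ 2 : ℝ) : ℂ) := by
    intro α
    rw [integral_comp_momentum_mul K α (u := fun k => (starRingEnd ℂ) (fibreMean K α f k))
      (memLp_conj (memLp_fibreMean K α (Lp.memLp f))) (Lp.memLp f), ← integral_complex_ofReal]
    refine integral_congr_ae (Eventually.of_forall fun k => ?_)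
    simp [Complex.conj_mul']
  have hvf : (fun x => (starRingEnd ℂ) (v x) * f x)
      = fun x => ∑ α, (w α : ℂ) * ((starRingEnd ℂ) (fibreMean K α f (momenta K x α)) * f x) := by
    funext x
    simp only [hv, map_sum, map_mul, Complex.conj_ofReal, Finset.sum_mul, mul_assoc]
  have hvfi : Integrable fun x => (starRingEnd ℂ) (v x) * f x := by
    rw [hvf]
    exact integrable_finsetSum _ fun α _ => (hcross α).const_mul _
  have hS : (∫ x, (starRingEnd ℂ) (v x) * f x).re = ∑ α, w α * ∫ k, ‖fibreMean K α f k‖ ^ 2 := by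
    rw [hvf, integral_finsetSum _ fun α _ => (hcross α).const_mul _]
    simp_rw [integral_const_mul, hcross_eq]
    simp [← Complex.ofReal_mul]
  have hvv : (fun x => (((kineticEnergy l K x - z)⁻¹ * ‖v x‖ ^ 2 : ℝ) : ℂ))
      = fun x => ∑ α, ∑ β, ((w α * w β : ℝ) : ℂ) * ((((kineticEnergy l K x - z)⁻¹ : ℝ) : ℂ) *
        (fibreMean K α f (momenta K x α) *
          (starRingEnd ℂ) (fibreMean K β f (momenta K x β)))) := by
    funext x
    rw [Complex.ofReal_mul, Complex.ofReal_pow, ← Complex.mul_conj']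
    simp only [hv, map_sum, map_mul, Complex.conj_ofReal]
    rw [Finset.sum_mul_sum, Finset.mul_sum]
    refine Finset.sum_congr rfl fun α _ => ?_
    rw [Finset.mul_sum]
    refine Finset.sum_congr rfl fun β _ => ?_
    push_cast
    ring
  have hvvi : Integrable fun x => (((kineticEnergy l K x - z)⁻¹ * ‖v x‖ ^ 2 : ℝ) : ℂ) := by
    rw [hvv]
    exact integrable_finsetSum _ fun α _ => integrable_finsetSum _ fun β _ =>
      (integrable_coupling hz (Lp.memLp f) α β).const_mul _
  have hvvr : Integrable fun x => (kineticEnergy l K x - z)⁻¹ * ‖v x‖ ^ 2 := by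
    simpa only [RCLike.re_to_complex, Complex.ofReal_re] using hvvi.re
  have hJ : ∫ x, (kineticEnergy l K x - z)⁻¹ * ‖v x‖ ^ 2
      = ∑ α, ∑ β, w α * w β * (coupling l K z f α β).re := by
    have h1 : ((∫ x, (kineticEnergy l K x - z)⁻¹ * ‖v x‖ ^ 2 : ℝ) : ℂ)
        = ∑ α, ∑ β, ((w α * w β : ℝ) : ℂ) * coupling l K z f α β := by
      rw [← integral_complex_ofReal, hvv, integral_finsetSum _ fun α _ =>
        integrable_finsetSum _ fun β _ =>
          (integrable_coupling hz (Lp.memLp f) α β).const_mul _]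
      refine Finset.sum_congr rfl fun α _ => ?_
      rw [integral_finsetSum _ fun β _ =>
        (integrable_coupling hz (Lp.memLp f) α β).const_mul _]
      refine Finset.sum_congr rfl fun β _ => ?_
      rw [integral_const_mul, coupling]
    have h2 := congrArg Complex.re h1
    rw [Complex.ofReal_re] at h2
    rw [h2, Complex.re_sum]
    refine Finset.sum_congr rfl fun α _ => ?_
    rw [Complex.re_sum]
    refine Finset.sum_congr rfl fun β _ => ?_
    rw [Complex.re_ofReal_mul]
  -- With `m = E - z > 0`, this is `m⁻¹ |m f - v|² ≥ 0`.
  have hpt : ∀ x, 2 * ((starRingEnd ℂ) (v x) * f x).re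
      ≤ (kineticEnergy l K x - z) * ‖f x‖ ^ 2 + (kineticEnergy l K x - z)⁻¹ * ‖v x‖ ^ 2 := by
    intro x
    have hm := sub_pos.2 (hz x)
    set m := kineticEnergy l K x - z
    have h1 := Complex.normSq_sub ((m : ℂ) * f x) (v x)
    have h2 := Complex.normSq_nonneg ((m : ℂ) * f x - v x)
    rw [h1, Complex.normSq_mul, Complex.normSq_ofReal, mul_assoc (m : ℂ), Complex.re_ofReal_mul,
      Complex.normSq_eq_norm_sq, Complex.normSq_eq_norm_sq, mul_comm (f x)] at h2
    have h3 := mul_nonneg (inv_nonneg.2 hm.le) h2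
    have h4 : m⁻¹ * (m * m * ‖f x‖ ^ 2 + ‖v x‖ ^ 2 -
        2 * (m * ((starRingEnd ℂ) (v x) * f x).re))
        = m * ‖f x‖ ^ 2 + m⁻¹ * ‖v x‖ ^ 2 - 2 * ((starRingEnd ℂ) (v x) * f x).re := by
      field_simp
    rw [h4] at h3
    linarith
  have hint := integral_mono (hvfi.re.const_mul 2) (hI.add hvvr) hpt
  have hre : ∫ x, ((starRingEnd ℂ) (v x) * f x).re = (∫ x, (starRingEnd ℂ) (v x) * f x).re :=
    integral_re hvfi
  simp only [RCLike.re_to_complex, Pi.add_apply] at hint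
  rw [integral_const_mul, hre, hS, integral_add hI hvvr, hJ] at hint
  linarith

/-- The kinetic energy above `z` in terms of the momenta `k_α`, `k_β` of two distinct particles. -/
def excessEnergy (l : Fin 3 → ℝ) (K : Torus) (z : ℝ) (α β : Fin 3) (p : Torus × Torus) : ℝ :=
  l α * dispersion p.1 + l β * dispersion p.2 + l (-α - β) * dispersion (K - p.1 - p.2) - z

/-- The third particle has index `-α - β`, because the three indices add up to `0` in `Fin 3`. -/
lemma excessEnergy_momenta (l : Fin 3 → ℝ) (K : Torus) (z : ℝ) {α β : Fin 3} (h : α ≠ β)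
    (x : Torus × Torus) :
    excessEnergy l K z α β (momenta K x α, momenta K x β) = kineticEnergy l K x - z := by
  have h1 : K - x.1 - (K - x.1 - x.2) = x.2 := by abel
  have h2 : K - x.2 - (K - x.1 - x.2) = x.1 := by abel
  have h3 : K - (K - x.1 - x.2) - x.1 = x.2 := by abel
  have h4 : K - (K - x.1 - x.2) - x.2 = x.1 := by abel
  have h5 : K - x.2 - x.1 = K - x.1 - x.2 := by abel
  fin_cases α <;> fin_cases β <;>
    first
    | exact absurd rfl h
    | (simp [excessEnergy, kineticEnergy, momenta, Fin.sum_univ_three, h1, h2, h3, h4, h5,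
        show (-1 : Fin 3) = 2 from rfl, show (-2 : Fin 3) = 1 from rfl]; try ring)

lemma continuous_excessEnergy (l : Fin 3 → ℝ) (K : Torus) (z : ℝ) (α β : Fin 3) :
    Continuous (excessEnergy l K z α β) := by
  have h := continuous_dispersion
  unfold excessEnergy
  fun_prop

lemma exists_momenta_eq (K : Torus) {α β : Fin 3} (h : α ≠ β) (p : Torus × Torus) :
    ∃ x, (momenta K x α, momenta K x β) = p := by
  have h1 : β = α + 1 ∨ α = β + 1 := by
    fin_cases α <;> fin_cases β <;> simp_all
  rcases h1 with rfl | rfl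
  · exact ⟨pairInv K α p, by simp⟩
  · exact ⟨pairInv K β (p.2, p.1), by simp⟩

lemma excessEnergy_pos (hz : ∀ x, z < kineticEnergy l K x) {α β : Fin 3} (h : α ≠ β)
    (p : Torus × Torus) : 0 < excessEnergy l K z α β p := by
  obtain ⟨x, rfl⟩ := exists_momenta_eq K h p
  rw [excessEnergy_momenta l K z h]
  exact sub_pos.2 (hz x)

lemma measurableEmbedding_mk (α : Fin 3) :
    MeasurableEmbedding (Prod.mk α : Torus → Fin 3 × Torus) :=
  measurableEmbedding_prodMk_left α

/-- The measure on three copies of the torus. -/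
def channelMeasure : Measure (Fin 3 × Torus) :=
  sumMap (volume : Measure Torus) fun α : Fin 3 => (Prod.mk α : Torus → Fin 3 × Torus)

instance : SFinite channelMeasure := by
  unfold channelMeasure
  infer_instance

lemma memLp_channel {g : Fin 3 × Torus → ℂ} (hg : ∀ α, MemLp (fun k => g (α, k)) 2 volume) :
    MemLp g 2 channelMeasure :=
  memLp_sumMap measurableEmbedding_mk hg

lemma measurableEmbedding_mk_prod (p : Fin 3 × Fin 3) :
    MeasurableEmbedding (Prod.map (Prod.mk p.1) (Prod.mk p.2) :
      Torus × Torus → (Fin 3 × Torus) × (Fin 3 × Torus)) :=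
  (measurableEmbedding_mk p.1).prodMap (measurableEmbedding_mk p.2)

lemma channelMeasure_prod : channelMeasure.prod channelMeasure
    = sumMap (volume : Measure (Torus × Torus)) fun p : Fin 3 × Fin 3 =>
      (Prod.map (Prod.mk p.1) (Prod.mk p.2) :
        Torus × Torus → (Fin 3 × Torus) × (Fin 3 × Torus)) :=
  sumMap_prod_sumMap fun i => (measurableEmbedding_mk i).measurable

/-- The components `√(μ_α (2π)⁻³ Δ_α(k)) ∫ f` of a state in the channels. -/
def channelFun (l μ : Fin 3 → ℝ) (K : Torus) (z : ℝ) (f : Torus × Torus → ℂ)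
    (y : Fin 3 × Torus) : ℂ :=
  ((√(μ y.1 / (2 * π) ^ 3) * √(pairDet l μ K z y.1 y.2) : ℝ) : ℂ) * fibreMean K y.1 f y.2

lemma memLp_channelFun (hz : ∀ x, z < kineticEnergy l K x) {f : Torus × Torus → ℂ}
    (hf : MemLp f 2 volume) : MemLp (channelFun l μ K z f) 2 channelMeasure := by
  refine memLp_channel fun α => ?_
  have hc : Continuous fun k => √(μ α / (2 * π) ^ 3) * √(pairDet l μ K z α k) :=
    continuous_const.mul (continuous_pairDet hz α).sqrt
  obtain ⟨C, hC⟩ := isCompact_univ.exists_bound_of_continuousOn hc.continuousOn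
  have hF := memLp_fibreMean K α hf
  refine MemLp.of_le_mul (c := C) hF ?_ (Eventually.of_forall fun k => ?_)
  · exact (Complex.continuous_ofReal.comp hc).aestronglyMeasurable.mul hF.1
  · rw [channelFun, norm_mul, Complex.norm_real]
    exact mul_le_mul_of_nonneg_right (hC k trivial) (norm_nonneg _)

/-- `channelFun` as a linear map. -/
def channelMap (μ : Fin 3 → ℝ) (hz : ∀ x, z < kineticEnergy l K x) :
    State →ₗ[ℂ] Lp ℂ 2 channelMeasure where
  toFun f := (memLp_channelFun (μ := μ) hz (Lp.memLp f)).toLp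
  map_add' f g := by
    rw [← MemLp.toLp_add]
    refine MemLp.toLp_congr _ _ ((ae_sumMap_iff measurableEmbedding_mk).2 fun α => ?_)
    filter_upwards [fibreMean_congr K α (Lp.coeFn_add f g), integrable_pairInv K α (Lp.memLp f),
      integrable_pairInv K α (Lp.memLp g)] with k hk hf hg
    have : fibreMean K α (f + g : Torus × Torus → ℂ) k = fibreMean K α f k + fibreMean K α g k :=
      integral_add hf hg
    simp only [channelFun, Pi.add_apply, hk, this, mul_add]
  map_smul' c f := by
    rw [RingHom.id_apply, ← MemLp.toLp_const_smul]
    refine MemLp.toLp_congr _ _ ((ae_sumMap_iff measurableEmbedding_mk).2 fun α => ?_)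
    filter_upwards [fibreMean_congr K α (Lp.coeFn_smul c f)] with k hk
    have : fibreMean K α (c • f : Torus × Torus → ℂ) k = c * fibreMean K α f k :=
      integral_const_mul c _
    simp only [channelFun, Pi.smul_apply, hk, this, smul_eq_mul]
    ring

/-- The off-diagonal kernel of the Birman–Schwinger operator, divided by the square roots of the
pair determinants. -/
def channelKernel (l μ : Fin 3 → ℝ) (K : Torus) (z : ℝ)
    (y : (Fin 3 × Torus) × (Fin 3 × Torus)) : ℂ :=
  if y.1.1 = y.2.1 then 0 else
    ((√(μ y.1.1 / (2 * π) ^ 3) * √(μ y.2.1 / (2 * π) ^ 3)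
      * (excessEnergy l K z y.1.1 y.2.1 (y.1.2, y.2.2))⁻¹ : ℝ) : ℂ) *
      ((starRingEnd ℂ) (((√(pairDet l μ K z y.1.1 y.1.2))⁻¹ : ℝ) : ℂ) *
        (((√(pairDet l μ K z y.2.1 y.2.2))⁻¹ : ℝ) : ℂ))

lemma memLp_inv_sqrt_pairDet (hz : ∀ x, z < kineticEnergy l K x) {α : Fin 3}
    (hD : ∫⁻ k, (ENNReal.ofReal (pairDet l μ K z α k))⁻¹ < ∞) :
    MemLp (fun k => (((√(pairDet l μ K z α k))⁻¹ : ℝ) : ℂ)) 2 volume := by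
  have hm : Measurable fun k => (√(pairDet l μ K z α k))⁻¹ :=
    (continuous_pairDet hz α).sqrt.measurable.inv
  refine ⟨(Complex.measurable_ofReal.comp hm).aestronglyMeasurable, ?_⟩
  refine (eLpNorm_lt_top_iff_lintegral_rpow_enorm_lt_top two_ne_zero ENNReal.ofNat_ne_top).2 ?_
  refine lt_of_le_of_lt (lintegral_mono fun k => ?_) hD
  -- Where the determinant is not positive, the real inverse square root is `0` by convention, so
  -- the bound is trivial there.
  rcases le_or_gt (pairDet l μ K z α k) 0 with h | h
  · simp [ENNReal.ofReal_eq_zero.2 h]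
  · have h1 : ‖(((√(pairDet l μ K z α k))⁻¹ : ℝ) : ℂ)‖ₑ
        = ENNReal.ofReal (√(pairDet l μ K z α k))⁻¹ := by
      rw [← ofReal_norm, Complex.norm_real, Real.norm_of_nonneg (by positivity)]
    have h2 : (2 : ℝ≥0∞).toReal = ((2 : ℕ) : ℝ) := by simp
    rw [h1, h2, ENNReal.rpow_natCast, ← ENNReal.ofReal_pow (by positivity), inv_pow,
      Real.sq_sqrt h.le, ENNReal.ofReal_inv_of_pos h]

/-- Off the diagonal, `(E - z)⁻¹` is bounded as a function of the two momenta, and what remains is a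
tensor product of the square-integrable functions `Δ_α^(-1/2)` and `Δ_β^(-1/2)`. -/
lemma memLp_channelKernel (hz : ∀ x, z < kineticEnergy l K x)
    (hD : ∀ α, ∫⁻ k, (ENNReal.ofReal (pairDet l μ K z α k))⁻¹ < ∞) :
    MemLp (channelKernel l μ K z) 2 (channelMeasure.prod channelMeasure) := by
  rw [channelMeasure_prod]
  refine memLp_sumMap measurableEmbedding_mk_prod fun p => ?_
  obtain ⟨α, β⟩ := p
  by_cases h : α = β
  · simp only [channelKernel, Prod.map_fst, Prod.map_snd, h, if_true]
    exact MemLp.zero'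
  · simp only [channelKernel, Prod.map_fst, Prod.map_snd, h, if_false]
    have hP := memLp_conj_mul_prod (memLp_inv_sqrt_pairDet hz (hD α))
      (memLp_inv_sqrt_pairDet hz (hD β))
    have hc : Continuous fun x : Torus × Torus => √(μ α / (2 * π) ^ 3) * √(μ β / (2 * π) ^ 3)
        * (excessEnergy l K z α β (x.1, x.2))⁻¹ :=
      continuous_const.mul ((continuous_excessEnergy l K z α β).inv₀
        fun p => (excessEnergy_pos hz h p).ne')
    obtain ⟨C, hC⟩ := isCompact_univ.exists_bound_of_continuousOn hc.continuousOn
    refine MemLp.of_le_mul (c := C) hP ?_ (Eventually.of_forall fun x => ?_)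
    · exact (Complex.continuous_ofReal.comp hc).aestronglyMeasurable.mul hP.1
    · rw [norm_mul, Complex.norm_real]
      exact mul_le_mul_of_nonneg_right (hC x trivial) (norm_nonneg _)

lemma coupling_of_ne (K : Torus) (z : ℝ) {f : Torus × Torus → ℂ} (hf : MemLp f 2 volume)
    {α β : Fin 3} (h : α ≠ β) :
    coupling l K z f α β = ∫ p : Torus × Torus, (((excessEnergy l K z α β p)⁻¹ : ℝ) : ℂ) *
      (fibreMean K α f p.1 * (starRingEnd ℂ) (fibreMean K β f p.2)) := by
  have hm : AEStronglyMeasurable (fun p : Torus × Torus =>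
      (((excessEnergy l K z α β p)⁻¹ : ℝ) : ℂ) *
      (fibreMean K α f p.1 * (starRingEnd ℂ) (fibreMean K β f p.2))) volume := by
    refine AEStronglyMeasurable.mul ?_ (AEStronglyMeasurable.mul ?_ ?_)
    · exact (Complex.measurable_ofReal.comp
        (continuous_excessEnergy l K z α β).measurable.inv).aestronglyMeasurable
    · exact (memLp_fibreMean K α hf).1.comp_fst
    · exact (memLp_conj (memLp_fibreMean K β hf)).1.comp_snd
  rw [← integral_comp_measurePreserving (measurePreserving_momenta K h) hm, coupling]
  simp only [excessEnergy_momenta l K z h]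

/-- The extended inverse is `∞` where the determinant is not positive, and a finite integral
excludes this almost everywhere. -/
lemma ae_pairDet_pos (hz : ∀ x, z < kineticEnergy l K x) {α : Fin 3}
    (hD : ∫⁻ k, (ENNReal.ofReal (pairDet l μ K z α k))⁻¹ < ∞) :
    ∀ᵐ k, 0 < pairDet l μ K z α k := by
  have hm : Measurable fun k => (ENNReal.ofReal (pairDet l μ K z α k))⁻¹ :=
    (continuous_pairDet hz α).measurable.ennreal_ofReal.inv
  filter_upwards [ae_lt_top hm hD.ne] with k hk
  rw [ENNReal.inv_lt_top] at hk
  exact ENNReal.ofReal_pos.1 hk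

lemma norm_channelMap_sq (hz : ∀ x, z < kineticEnergy l K x) (hμ : ∀ i, 0 < μ i)
    (hD : ∀ α, ∫⁻ k, (ENNReal.ofReal (pairDet l μ K z α k))⁻¹ < ∞) (f : State) :
    ‖channelMap μ hz f‖ ^ 2
      = ∑ α, μ α / (2 * π) ^ 3 * ∫ k, pairDet l μ K z α k * ‖fibreMean K α f k‖ ^ 2 := by
  have hmem := memLp_channelFun (μ := μ) hz (Lp.memLp f)
  have hy : channelMap μ hz f =ᵐ[channelMeasure] channelFun l μ K z f := hmem.coeFn_toLp
  have h1 : ∫ y, ‖channelMap μ hz f y‖ ^ 2 ∂channelMeasure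
      = ∫ y, ‖channelFun l μ K z f y‖ ^ 2 ∂channelMeasure :=
    integral_congr_ae (by filter_upwards [hy] with y hy; rw [hy])
  rw [norm_sq_eq_integral, h1, channelMeasure, integral_sumMap measurableEmbedding_mk
    ((memLp_two_iff_integrable_sq_norm hmem.1).1 hmem)]
  refine Finset.sum_congr rfl fun α _ => ?_
  rw [← integral_const_mul]
  refine integral_congr_ae ?_
  filter_upwards [ae_pairDet_pos hz (hD α)] with k hk
  have hw : 0 ≤ μ α / (2 * π) ^ 3 := div_nonneg (hμ α).le (by positivity)
  rw [channelFun, norm_mul, Complex.norm_real, mul_pow, Real.norm_eq_abs, sq_abs, mul_pow,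
    Real.sq_sqrt hw, Real.sq_sqrt hk.le, mul_assoc]

/-- The factors `√Δ` in the channel components cancel those in the kernel almost everywhere, which
leaves exactly the off-diagonal couplings. -/
lemma integral_channelKernel (hz : ∀ x, z < kineticEnergy l K x) (hμ : ∀ i, 0 < μ i)
    (hD : ∀ α, ∫⁻ k, (ENNReal.ofReal (pairDet l μ K z α k))⁻¹ < ∞) (f : State) :
    ∫ y, channelKernel l μ K z y * (channelMap μ hz f y.1 *
        (starRingEnd ℂ) (channelMap μ hz f y.2)) ∂(channelMeasure.prod channelMeasure)
      = ∑ p : Fin 3 × Fin 3, if p.1 = p.2 then 0 else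
        ((μ p.1 / (2 * π) ^ 3 * (μ p.2 / (2 * π) ^ 3) : ℝ) : ℂ) * coupling l K z f p.1 p.2 := by
  have hmem := memLp_channelFun (μ := μ) hz (Lp.memLp f)
  have hy : channelMap μ hz f =ᵐ[channelMeasure] channelFun l μ K z f := hmem.coeFn_toLp
  have hint : Integrable (fun y => channelKernel l μ K z y * (channelFun l μ K z f y.1 *
      (starRingEnd ℂ) (channelFun l μ K z f y.2))) (channelMeasure.prod channelMeasure) := by
    have h := (memLp_channelKernel hz hD).integrable_mul
      (memLp_conj (memLp_conj_mul_prod hmem hmem))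
    refine h.congr (Eventually.of_forall fun y => ?_)
    simp
  have h1 : ∫ y, channelKernel l μ K z y * (channelMap μ hz f y.1 *
        (starRingEnd ℂ) (channelMap μ hz f y.2)) ∂(channelMeasure.prod channelMeasure)
      = ∫ y, channelKernel l μ K z y * (channelFun l μ K z f y.1 *
        (starRingEnd ℂ) (channelFun l μ K z f y.2)) ∂(channelMeasure.prod channelMeasure) := by
    refine integral_congr_ae ?_
    filter_upwards [Measure.quasiMeasurePreserving_fst.ae hy,
      Measure.quasiMeasurePreserving_snd.ae hy] with y h1 h2
    rw [h1, h2]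
  rw [h1, channelMeasure_prod, integral_sumMap measurableEmbedding_mk_prod
    (by rwa [channelMeasure_prod] at hint)]
  refine Finset.sum_congr rfl fun p _ => ?_
  obtain ⟨α, β⟩ := p
  by_cases h : α = β
  · simp [channelKernel, h]
  · simp only [channelKernel, Prod.map_fst, Prod.map_snd, h, if_false]
    rw [coupling_of_ne K z (Lp.memLp f) h, ← integral_const_mul]
    refine integral_congr_ae ?_
    have hα : ∀ᵐ x : Torus × Torus, 0 < pairDet l μ K z α x.1 :=
      Measure.quasiMeasurePreserving_fst.ae (ae_pairDet_pos hz (hD α))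
    have hβ : ∀ᵐ x : Torus × Torus, 0 < pairDet l μ K z β x.2 :=
      Measure.quasiMeasurePreserving_snd.ae (ae_pairDet_pos hz (hD β))
    filter_upwards [hα, hβ] with x h1 h2
    have hwα : 0 < μ α / (2 * π) ^ 3 := div_pos (hμ α) (by positivity)
    have hwβ : 0 < μ β / (2 * π) ^ 3 := div_pos (hμ β) (by positivity)
    have e1 := Real.mul_self_sqrt hwα.le
    have e2 := Real.mul_self_sqrt hwβ.le
    have e3 := mul_inv_cancel₀ (Real.sqrt_pos.2 h1).ne'
    have e4 := mul_inv_cancel₀ (Real.sqrt_pos.2 h2).ne'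
    simp only [channelFun, map_mul, Complex.conj_ofReal]
    set a := √(μ α / (2 * π) ^ 3)
    set b := √(μ β / (2 * π) ^ 3)
    set c := √(pairDet l μ K z α x.1)
    set d := √(pairDet l μ K z β x.2)
    set F := fibreMean K α f x.1
    set G := (starRingEnd ℂ) (fibreMean K β f x.2)
    set E := (excessEnergy l K z α β x)⁻¹
    rw [← e1, ← e2]
    have e3' : (c : ℂ) * ((c⁻¹ : ℝ) : ℂ) = 1 := by exact_mod_cast congrArg Complex.ofReal e3
    have e4' : (d : ℂ) * ((d⁻¹ : ℝ) : ℂ) = 1 := by exact_mod_cast congrArg Complex.ofReal e4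
    rw [Complex.ofReal_mul, Complex.ofReal_mul, Complex.ofReal_mul, Complex.ofReal_mul,
      Complex.ofReal_mul, Complex.ofReal_mul, Complex.ofReal_mul]
    linear_combination (a * b * E * a * b * F * G * (d * ((d⁻¹ : ℝ) : ℂ))) * e3'
      + (a * b * E * a * b * F * G : ℂ) * e4'

/-- If the inverses of the pair determinants at an energy `z` below the free spectrum are integrable,
then the form of `H(K) - z` is negative only on spaces of finite dimension. -/
lemma finiteDimensional_of_form_lt (hz : ∀ x, z < kineticEnergy l K x) (hμ : ∀ i, 0 < μ i)
    (hD : ∀ α, ∫⁻ k, (ENNReal.ofReal (pairDet l μ K z α k))⁻¹ < ∞)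
    {V : Type*} [AddCommGroup V] [Module ℂ V] (J : V →ₗ[ℂ] State)
    (hJ : ∀ v, v ≠ 0 → (inner ℂ (J v) (hamiltonian l μ K (J v))).re < z * ‖J v‖ ^ 2) :
    FiniteDimensional ℂ V := by
  refine finiteDimensional_of_lt_kernel (memLp_channelKernel hz hD) (channelMap μ hz ∘ₗ J)
    fun v hv => ?_
  have hlt := sum_fibreMean_lt hz (hJ v hv)
  rw [LinearMap.comp_apply]
  set f := J v
  refine lt_of_lt_of_le ?_ (Complex.re_le_norm _)
  rw [norm_channelMap_sq hz hμ hD, integral_channelKernel hz hμ hD, Complex.re_sum,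
    Fintype.sum_prod_type]
  have hFsq : ∀ α, Integrable fun k => ‖fibreMean K α f k‖ ^ 2 := fun α =>
    (memLp_two_iff_integrable_sq_norm (memLp_fibreMean K α (Lp.memLp f)).1).1
      (memLp_fibreMean K α (Lp.memLp f))
  have hbdd : ∀ (α : Fin 3) (g : Torus → ℝ), Continuous g →
      Integrable fun k => g k * ‖fibreMean K α f k‖ ^ 2 := by
    intro α g hg
    obtain ⟨C, hC⟩ := isCompact_univ.exists_bound_of_continuousOn hg.continuousOn
    exact (hFsq α).bdd_mul hg.aestronglyMeasurable (Eventually.of_forall fun x => hC x trivial)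
  -- The diagonal coupling is `∫ R |F_α|²`, with `R` the resolvent mean. Moving it to the left of
  -- `sum_fibreMean_lt` turns the weight `1` into `Δ_α`, hence the left side into the square norm of
  -- the channel vector.
  have hdiag : ∀ α, μ α / (2 * π) ^ 3 * ∫ k, pairDet l μ K z α k * ‖fibreMean K α f k‖ ^ 2
      = μ α / (2 * π) ^ 3 * (∫ k, ‖fibreMean K α f k‖ ^ 2)
        - μ α / (2 * π) ^ 3 * (μ α / (2 * π) ^ 3) * (coupling l K z f α α).re := by
    intro α
    have hDF : ∫ k, pairDet l μ K z α k * ‖fibreMean K α f k‖ ^ 2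
        = (∫ k, ‖fibreMean K α f k‖ ^ 2)
          - μ α / (2 * π) ^ 3 * ∫ k, resolventMean l K z α k * ‖fibreMean K α f k‖ ^ 2 := by
      rw [← integral_const_mul, ← integral_sub (hFsq α)
        ((hbdd α _ (continuous_resolventMean hz α)).const_mul _)]
      refine integral_congr_ae (Eventually.of_forall fun k => ?_)
      simp only [pairDet]
      ring
    rw [coupling_self hz (Lp.memLp f), Complex.ofReal_re, hDF]
    ring
  simp_rw [hdiag]
  have hsplit : ∀ α, ∑ β, μ α / (2 * π) ^ 3 * (μ β / (2 * π) ^ 3) * (coupling l K z f α β).re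
      = μ α / (2 * π) ^ 3 * (μ α / (2 * π) ^ 3) * (coupling l K z f α α).re
        + ∑ β, (if α = β then 0 else ((μ α / (2 * π) ^ 3 * (μ β / (2 * π) ^ 3) : ℝ) : ℂ) *
          coupling l K z f α β).re := by
    intro α
    rw [← Finset.add_sum_erase _ _ (Finset.mem_univ α),
      ← Finset.add_sum_erase (a := α) Finset.univ (fun β => (if α = β then 0 else
        ((μ α / (2 * π) ^ 3 * (μ β / (2 * π) ^ 3) : ℝ) : ℂ) * coupling l K z f α β).re)
        (Finset.mem_univ α)]
    simp only [if_true, Complex.zero_re, zero_add]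
    congr 1
    refine Finset.sum_congr rfl fun β hβ => ?_
    rw [if_neg (Finset.ne_of_mem_erase hβ).symm, Complex.re_ofReal_mul]
  rw [Finset.sum_congr rfl fun α _ => hsplit α, Finset.sum_add_distrib] at hlt
  rw [Finset.sum_sub_distrib]
  linarith

end BirmanSchwinger

/-! ### The pair energy centred at its minimum. -/

noncomputable section Centering

lemma torusCos_coe (x : ℝ) : torusCos (x : AddCircle (2 * π)) = Real.cos x := rfl

lemma torusCos_le_one (t : AddCircle (2 * π)) : torusCos t ≤ 1 := by
  induction t using QuotientAddGroup.induction_on with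
  | H x => exact Real.cos_le_one x

lemma neg_one_le_torusCos (t : AddCircle (2 * π)) : -1 ≤ torusCos t := by
  induction t using QuotientAddGroup.induction_on with
  | H x => exact Real.neg_one_le_cos x

lemma torusCos_zero : torusCos 0 = 1 := Real.cos_zero

lemma eq_zero_of_torusCos_eq_one {t : AddCircle (2 * π)} (h : torusCos t = 1) : t = 0 := by
  induction t using QuotientAddGroup.induction_on with
  | H x =>
    obtain ⟨n, hn⟩ := (Real.cos_eq_one_iff x).1 h
    exact (AddCircle.coe_eq_zero_iff _).2 ⟨n, by simpa using hn⟩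

lemma torusCos_add_pi (t : AddCircle (2 * π)) : torusCos (t + (π : ℝ)) = -torusCos t := by
  induction t using QuotientAddGroup.induction_on with
  | H x => exact Real.cos_add_pi x

/-- The amplitude of `t ↦ b cos q + c cos (t - q)` as a function of `q`. -/
def pairAmp (b c : ℝ) (t : AddCircle (2 * π)) : ℝ :=
  √(b ^ 2 + c ^ 2 + 2 * b * c * torusCos t)

lemma pairAmp_nonneg (b c : ℝ) (t : AddCircle (2 * π)) : 0 ≤ pairAmp b c t := Real.sqrt_nonneg _

lemma pairAmp_le {b c : ℝ} (hb : 0 < b) (hc : 0 < c) (t : AddCircle (2 * π)) :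
    pairAmp b c t ≤ b + c := by
  refine Real.sqrt_le_iff.2 ⟨by positivity, ?_⟩
  nlinarith [torusCos_le_one t, mul_pos hb hc]

lemma pairAmp_lt {b c : ℝ} (hb : 0 < b) (hc : 0 < c) {t : AddCircle (2 * π)} (ht : t ≠ 0) :
    pairAmp b c t < b + c := by
  have h1 : torusCos t < 1 :=
    lt_of_le_of_ne (torusCos_le_one t) fun h => ht (eq_zero_of_torusCos_eq_one h)
  refine (Real.sqrt_lt' (by positivity)).2 ?_
  nlinarith [mul_pos hb hc]

/-- With `w = b + c exp(i t)`, `b cos q + c cos (t - q)` is the real part of `w exp(-i q)`; hence `θ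
= arg w` and the amplitude is `|w|`. -/
lemma exists_center (b c : ℝ) (t : AddCircle (2 * π)) :
    ∃ θ : AddCircle (2 * π), ∀ q, b * (1 - torusCos q) + c * (1 - torusCos (t - q))
      = b + c - pairAmp b c t * torusCos (q - θ) := by
  induction t using QuotientAddGroup.induction_on with
  | H x =>
    set w : ℂ := ⟨b + c * Real.cos x, c * Real.sin x⟩ with hw
    refine ⟨(Complex.arg w : ℝ), fun q => ?_⟩
    induction q using QuotientAddGroup.induction_on with
    | H y =>
      have hnorm : pairAmp b c (x : AddCircle (2 * π)) = ‖w‖ := by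
        rw [pairAmp, torusCos_coe, Complex.norm_def, Complex.normSq_apply]
        congr 1
        simp only [hw]
        nlinarith [Real.sin_sq_add_cos_sq x]
      have h1 := Complex.norm_mul_cos_arg w
      have h2 := Complex.norm_mul_sin_arg w
      simp only [hw] at h1 h2
      change b * (1 - Real.cos y) + c * (1 - Real.cos (x - y))
        = b + c - pairAmp b c (x : AddCircle (2 * π)) * Real.cos (y - Complex.arg w)
      rw [hnorm, Real.cos_sub, Real.cos_sub, mul_add, mul_comm (Real.cos y), ← mul_assoc,
        mul_comm (Real.sin y), ← mul_assoc, h1, h2]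
      ring

variable {l μ : Fin 3 → ℝ} {K : Torus} {z : ℝ}

/-- The kinetic energy above `z` on the fibre `k_α = k`, with the relative momentum of the pair
measured from its minimum. -/
def centeredEnergy (l : Fin 3 → ℝ) (K : Torus) (z : ℝ) (α : Fin 3) (k q : Torus) : ℝ :=
  l α * dispersion k - z + ∑ i, (l (α + 1) + l (α + 2)
    - pairAmp (l (α + 1)) (l (α + 2)) (K i - k i) * torusCos (q i))

lemma kineticEnergy_pairInv (l : Fin 3 → ℝ) (K : Torus) (α : Fin 3) (k q : Torus) :
    kineticEnergy l K (pairInv K α (k, q))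
      = l α * dispersion k + (l (α + 1) * dispersion q + l (α + 2) * dispersion (K - k - q)) := by
  have h := excessEnergy_momenta l K 0 (show α ≠ α + 1 by fin_cases α <;> decide)
    (pairInv K α (k, q))
  have h3 : -α - (α + 1) = α + 2 := by fin_cases α <;> decide
  simp only [momenta_pairInv_fst, momenta_pairInv_snd, excessEnergy, h3, sub_zero] at h
  linarith

lemma exists_kineticEnergy_eq_centered (l : Fin 3 → ℝ) (K : Torus) (z : ℝ) (α : Fin 3)
    (k : Torus) : ∃ θ : Torus, ∀ q,
      kineticEnergy l K (pairInv K α (k, q)) - z = centeredEnergy l K z α k (q - θ) := by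
  choose θ hθ using fun i => exists_center (l (α + 1)) (l (α + 2)) (K i - k i)
  refine ⟨θ, fun q => ?_⟩
  rw [kineticEnergy_pairInv, centeredEnergy]
  have h : l (α + 1) * dispersion q + l (α + 2) * dispersion (K - k - q)
      = ∑ i, (l (α + 1) + l (α + 2)
        - pairAmp (l (α + 1)) (l (α + 2)) (K i - k i) * torusCos ((q - θ) i)) := by
    simp only [dispersion, Finset.mul_sum, ← Finset.sum_add_distrib]
    exact Finset.sum_congr rfl fun i _ => hθ i (q i)
  rw [h]
  ring

lemma resolventMean_eq_centered (l : Fin 3 → ℝ) (K : Torus) (z : ℝ) (α : Fin 3) (k : Torus) :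
    resolventMean l K z α k = ∫ q, (centeredEnergy l K z α k q)⁻¹ := by
  obtain ⟨θ, hθ⟩ := exists_kineticEnergy_eq_centered l K z α k
  simp_rw [resolventMean, hθ]
  exact integral_sub_right_eq_self (μ := (volume : Measure Torus))
    (fun q => (centeredEnergy l K z α k q)⁻¹) θ

lemma centeredEnergy_pos (hz : ∀ x, z < kineticEnergy l K x) (α : Fin 3) (k q : Torus) :
    0 < centeredEnergy l K z α k q := by
  obtain ⟨θ, hθ⟩ := exists_kineticEnergy_eq_centered l K z α k
  have h := hθ (q + θ)
  rw [add_sub_cancel_right] at h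
  rw [← h]
  exact sub_pos.2 (hz _)

end Centering

/-! ### Comparison of a moving pair with the critical pair at rest. -/

noncomputable section Comparison

lemma dispersion_nonneg (q : Torus) : 0 ≤ dispersion q :=
  Finset.sum_nonneg fun i _ => sub_nonneg.2 (torusCos_le_one (q i))

lemma dispersion_le (q : Torus) : dispersion q ≤ 6 := by
  have h : dispersion q ≤ ∑ _i : Fin 3, (2 : ℝ) :=
    Finset.sum_le_sum fun i _ => by linarith [neg_one_le_torusCos (q i)]
  norm_num at h
  exact h

lemma eq_zero_of_dispersion_eq_zero {q : Torus} (h : dispersion q = 0) : q = 0 := by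
  funext i
  have h1 := (Finset.sum_eq_zero_iff_of_nonneg
    fun i _ => sub_nonneg.2 (torusCos_le_one (q i))).1 h i (Finset.mem_univ i)
  exact eq_zero_of_torusCos_eq_one (by linarith)

lemma ae_dispersion_pos : ∀ᵐ q : Torus, 0 < dispersion q := by
  have h : ∀ᵐ q : Torus, q ≠ 0 := by
    rw [ae_iff]
    simp
  filter_upwards [h] with q hq
  exact lt_of_le_of_ne (dispersion_nonneg q) fun h0 => hq (eq_zero_of_dispersion_eq_zero h0.symm)

lemma Continuous.integrable_torus {f : Torus → ℝ} (hf : Continuous f) : Integrable f :=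
  hf.integrable_of_hasCompactSupport (HasCompactSupport.of_compactSpace _)

lemma inv_convexComb_le {w x y : ℝ} (hw0 : 0 ≤ w) (hw1 : w ≤ 1) (hx : 0 < x) (hy : 0 < y) :
    (w * x + (1 - w) * y)⁻¹ ≤ w * x⁻¹ + (1 - w) * y⁻¹ := by
  have hpos : 0 < w * x + (1 - w) * y := by
    rcases hw0.eq_or_lt with rfl | hw
    · simpa using hy
    · have := mul_pos hw hx
      have := mul_nonneg (sub_nonneg.2 hw1) hy.le
      linarith
  have h : w * x⁻¹ + (1 - w) * y⁻¹ = (w * y + (1 - w) * x) / (x * y) := by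
    field_simp
  rw [h, inv_eq_one_div, div_le_div_iff₀ hpos (mul_pos hx hy)]
  nlinarith [mul_nonneg (mul_nonneg hw0 (sub_nonneg.2 hw1)) (sq_nonneg (x - y))]

/-- Raising one amplitude to its maximum increases the integral of the resolvent. -/
lemma integral_inv_le_update {s β : ℝ} (hs : 0 < s) (hβ : 0 < β) {r : Fin 3 → ℝ}
    (hr0 : ∀ i, 0 ≤ r i) (hrs : ∀ i, r i ≤ s) (i : Fin 3) :
    ∫ q : Torus, (β + ∑ j, (s - r j * torusCos (q j)))⁻¹
      ≤ ∫ q : Torus, (β + ∑ j, (s - Function.update r i s j * torusCos (q j)))⁻¹ := by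
  have hcos := continuous_torusCos
  have hpos : ∀ r' : Fin 3 → ℝ, (∀ j, 0 ≤ r' j) → (∀ j, r' j ≤ s) → ∀ q : Torus,
      0 < β + ∑ j, (s - r' j * torusCos (q j)) := by
    intro r' h0 hs' q
    have : 0 ≤ ∑ j, (s - r' j * torusCos (q j)) := Finset.sum_nonneg fun j _ => by
      nlinarith [h0 j, hs' j, torusCos_le_one (q j)]
    linarith
  have hint : ∀ r' : Fin 3 → ℝ, (∀ j, 0 ≤ r' j) → (∀ j, r' j ≤ s) →
      Integrable fun q : Torus => (β + ∑ j, (s - r' j * torusCos (q j)))⁻¹ := by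
    intro r' h0 hs'
    refine Continuous.integrable_torus (Continuous.inv₀ (by fun_prop) fun q => ?_)
    exact (hpos r' h0 hs' q).ne'
  set r' := Function.update r i s with hr'
  have hr'0 : ∀ j, 0 ≤ r' j := fun j => by
    rw [hr', Function.update_apply]
    split_ifs
    exacts [hs.le, hr0 j]
  have hr's : ∀ j, r' j ≤ s := fun j => by
    rw [hr', Function.update_apply]
    split_ifs
    exacts [le_rfl, hrs j]
  -- Translation by `π` in coordinate `i` flips the sign of that cosine. The weight `w` is chosen so
  -- that the energy with amplitude `r i` is a convex combination of the energy with amplitude `s`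
  -- and its translate; convexity of the inverse and translation invariance conclude.
  set a : Torus := Pi.single i ((π : ℝ) : AddCircle (2 * π)) with ha
  set w : ℝ := (1 + r i / s) / 2 with hw
  have hri : r i / s ≤ 1 := (div_le_one hs).2 (hrs i)
  have hri0 : 0 ≤ r i / s := div_nonneg (hr0 i) hs.le
  have hdecomp : ∀ q : Torus, β + ∑ j, (s - r j * torusCos (q j))
      = w * (β + ∑ j, (s - r' j * torusCos (q j)))
        + (1 - w) * (β + ∑ j, (s - r' j * torusCos ((q + a) j))) := by
    intro q
    have h : ∀ j, s - r j * torusCos (q j) = w * (s - r' j * torusCos (q j))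
        + (1 - w) * (s - r' j * torusCos ((q + a) j)) := by
      intro j
      by_cases hj : j = i
      · subst hj
        rw [Pi.add_apply, ha, Pi.single_eq_same, torusCos_add_pi, hr', Function.update_self, hw]
        field_simp
        ring
      · rw [Pi.add_apply, ha, Pi.single_eq_of_ne hj, add_zero, hr', Function.update_of_ne hj]
        ring
    rw [Finset.sum_congr rfl fun j _ => h j, Finset.sum_add_distrib, ← Finset.mul_sum,
      ← Finset.mul_sum]
    ring
  have hle : ∀ q : Torus, (β + ∑ j, (s - r j * torusCos (q j)))⁻¹
      ≤ w * (β + ∑ j, (s - r' j * torusCos (q j)))⁻¹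
        + (1 - w) * (β + ∑ j, (s - r' j * torusCos ((q + a) j)))⁻¹ := by
    intro q
    rw [hdecomp q]
    exact inv_convexComb_le (by linarith) (by linarith) (hpos r' hr'0 hr's q)
      (hpos r' hr'0 hr's (q + a))
  have hI := hint r' hr'0 hr's
  obtain ⟨f, hf⟩ : ∃ f : Torus → ℝ, ∀ q, f q = (β + ∑ j, (s - r' j * torusCos (q j)))⁻¹ :=
    ⟨_, fun _ => rfl⟩
  simp only [← hf] at hle hI ⊢
  have hI' := hI.comp_add_right a
  refine (integral_mono (hint r hr0 hrs) ((hI.const_mul w).add (hI'.const_mul (1 - w)))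
    hle).trans_eq ?_
  refine (integral_add (hI.const_mul w) (hI'.const_mul (1 - w))).trans ?_
  rw [integral_const_mul, integral_const_mul,
    integral_add_right_eq_self (μ := (volume : Measure Torus)) f a]
  ring

lemma integral_inv_le_dispersion {s β : ℝ} (hs : 0 < s) (hβ : 0 < β) {r : Fin 3 → ℝ}
    (hr0 : ∀ i, 0 ≤ r i) (hrs : ∀ i, r i ≤ s) :
    ∫ q : Torus, (β + ∑ j, (s - r j * torusCos (q j)))⁻¹
      ≤ ∫ q : Torus, (β + s * dispersion q)⁻¹ := by
  have hup0 : ∀ (r : Fin 3 → ℝ) i, (∀ j, 0 ≤ r j) → ∀ j, 0 ≤ Function.update r i s j := by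
    intro r i h j
    rw [Function.update_apply]
    split_ifs
    exacts [hs.le, h j]
  have hups : ∀ (r : Fin 3 → ℝ) i, (∀ j, r j ≤ s) → ∀ j, Function.update r i s j ≤ s := by
    intro r i h j
    rw [Function.update_apply]
    split_ifs
    exacts [le_rfl, h j]
  have h0 := integral_inv_le_update hs hβ hr0 hrs 0
  have h1 := integral_inv_le_update hs hβ (hup0 _ 0 hr0) (hups _ 0 hrs) 1
  have h2 := integral_inv_le_update hs hβ (hup0 _ 1 (hup0 _ 0 hr0)) (hups _ 1 (hups _ 0 hrs)) 2
  refine (h0.trans (h1.trans h2)).trans_eq ?_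
  congr 1
  funext q
  simp only [Fin.sum_univ_three, dispersion, Function.update_apply]
  simp
  ring

variable {l μ : Fin 3 → ℝ} {K : Torus} {z : ℝ}

lemma continuous_centeredEnergy_right (l : Fin 3 → ℝ) (K : Torus) (z : ℝ) (α : Fin 3)
    (k : Torus) : Continuous (centeredEnergy l K z α k) := by
  have h2 := continuous_torusCos
  unfold centeredEnergy
  fun_prop

lemma integrable_inv_centeredEnergy (hz : ∀ x, z < kineticEnergy l K x) (α : Fin 3) (k : Torus) :
    Integrable fun q => (centeredEnergy l K z α k q)⁻¹ :=
  Continuous.integrable_torus ((continuous_centeredEnergy_right l K z α k).inv₀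
    fun q => (centeredEnergy_pos hz α k q).ne')

/-- The integral of a non-integrable function is `0` by convention, which would make the critical
coupling `0`. -/
lemma integrable_dispersion_inv {α : Fin 3} (h : 0 < criticalCoupling l α) :
    Integrable fun q : Torus => (dispersion q)⁻¹ := by
  by_contra hi
  rw [criticalCoupling, integral_undef hi] at h
  simp at h

/-- At critical coupling the determinant of the pair at rest vanishes at threshold. -/
lemma criticalCoupling_mul (hl : ∀ i, 0 < l i) {α : Fin 3} (h : 0 < criticalCoupling l α) :
    criticalCoupling l α / (2 * π) ^ 3
      * ((l (α + 1) + l (α + 2))⁻¹ * ∫ q : Torus, (dispersion q)⁻¹) = 1 := by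
  have hI : (∫ q : Torus, (dispersion q)⁻¹) ≠ 0 := by
    intro h0
    rw [criticalCoupling, h0] at h
    simp at h
  have hs : l (α + 1) + l (α + 2) ≠ 0 := (add_pos (hl _) (hl _)).ne'
  have hpi : (π : ℝ) ≠ 0 := Real.pi_ne_zero
  rw [criticalCoupling]
  generalize (∫ q : Torus, (dispersion q)⁻¹) = I at hI ⊢
  field_simp

/-- A pair determinant with at most critical coupling is positive where the energy of the third
particle alone exceeds `z`. -/
lemma pairDet_pos_of_lt (hl : ∀ i, 0 < l i) (hμ : ∀ i, 0 < μ i) {α : Fin 3}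
    (hcrit : μ α ≤ criticalCoupling l α) {k : Torus} (hk : z < l α * dispersion k) :
    0 < pairDet l μ K z α k := by
  set s := l (α + 1) + l (α + 2) with hs_def
  have hs : 0 < s := add_pos (hl _) (hl _)
  set β := l α * dispersion k - z with hβ_def
  have hβ : 0 < β := sub_pos.2 hk
  have hc0 : 0 < criticalCoupling l α := (hμ α).trans_le hcrit
  have hI := integrable_dispersion_inv hc0
  have h1 : resolventMean l K z α k ≤ ∫ q : Torus, (β + s * dispersion q)⁻¹ := by
    rw [resolventMean_eq_centered]
    exact integral_inv_le_dispersion hs hβ (r := fun i => pairAmp (l (α + 1)) (l (α + 2)) (K i - k i))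
      (fun i => pairAmp_nonneg _ _ _) (fun i => pairAmp_le (hl _) (hl _) _)
  have hd := continuous_dispersion
  have hint : Integrable fun q : Torus => (β + s * dispersion q)⁻¹ := by
    refine Continuous.integrable_torus (Continuous.inv₀ (by fun_prop) fun q => ?_)
    have := mul_nonneg hs.le (dispersion_nonneg q)
    exact ne_of_gt (by linarith)
  -- Because `ε ≤ 6`, a gap `β > 0` lowers the resolvent at least by the uniform factor `6s / (6s +
  -- β) < 1`, which makes the final inequality strict.
  have h2 : ∫ q : Torus, (β + s * dispersion q)⁻¹
      ≤ ∫ q : Torus, 6 * s / (6 * s + β) * (s⁻¹ * (dispersion q)⁻¹) := by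
    refine integral_mono_ae hint ((hI.const_mul _).const_mul _) ?_
    filter_upwards [ae_dispersion_pos] with q hq
    have h6 := dispersion_le q
    rw [← mul_inv, ← div_eq_mul_inv, div_div, inv_eq_one_div, div_le_div_iff₀ (by positivity)
      (by positivity)]
    nlinarith [mul_pos hs hβ, mul_nonneg (mul_pos hs hβ).le (sub_nonneg.2 h6)]
  rw [integral_const_mul, integral_const_mul] at h2
  set T := s⁻¹ * ∫ q : Torus, (dispersion q)⁻¹ with hT
  have hcT : criticalCoupling l α / (2 * π) ^ 3 * T = 1 := criticalCoupling_mul hl hc0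
  have hT0 : 0 ≤ T := mul_nonneg (inv_nonneg.2 hs.le)
    (integral_nonneg fun q => inv_nonneg.2 (dispersion_nonneg q))
  have hw : μ α / (2 * π) ^ 3 ≤ criticalCoupling l α / (2 * π) ^ 3 := by gcongr
  have hw0 : 0 < μ α / (2 * π) ^ 3 := div_pos (hμ α) (by positivity)
  have hρ : 6 * s / (6 * s + β) < 1 := (div_lt_one (by positivity)).2 (by linarith)
  have hρ0 : 0 ≤ 6 * s / (6 * s + β) := by positivity
  have h3 : μ α / (2 * π) ^ 3 * resolventMean l K z α k
      ≤ μ α / (2 * π) ^ 3 * (6 * s / (6 * s + β) * T) :=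
    mul_le_mul_of_nonneg_left (h1.trans h2) hw0.le
  have h4 : μ α / (2 * π) ^ 3 * (6 * s / (6 * s + β) * T)
      ≤ 6 * s / (6 * s + β) * (criticalCoupling l α / (2 * π) ^ 3 * T) := by
    nlinarith [mul_nonneg hρ0 (mul_nonneg (sub_nonneg.2 hw) hT0)]
  rw [hcT, mul_one] at h4
  rw [pairDet]
  linarith

/-- With one pair amplitude below its maximum, the critical pair determinant is negative slightly
below the bottom of the pair continuum. -/
lemma exists_lt_integral_inv {s : ℝ} (hs : 0 < s) (hI : Integrable fun q : Torus => (dispersion q)⁻¹)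
    {r : Fin 3 → ℝ} (hr0 : ∀ i, 0 ≤ r i) (hrs : ∀ i, r i ≤ s) {j : Fin 3} (hj : r j < s) :
    ∃ a : ℝ, 0 < a ∧ s⁻¹ * ∫ q : Torus, (dispersion q)⁻¹
      < ∫ q : Torus, (a + ∑ i, r i * (1 - torusCos (q i)))⁻¹ := by
  have hcos := continuous_torusCos
  have hd := continuous_dispersion
  -- For `0 < a ≤ 1` the two resolvents differ by at least `g`: the energies differ by at least `(s
  -- - r j)(1 - cos q_j)`, and both are at most `1 + 6s`. Since `g` does not depend on `a`, the gain
  -- survives the limit `a → 0`.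
  set g : Torus → ℝ := fun q => (s - r j) * (1 - torusCos (q j)) / (1 + 6 * s) ^ 2 with hg
  have hgc : Continuous g := by
    rw [hg]
    fun_prop
  have hg0 : 0 ≤ g := fun q => div_nonneg (mul_nonneg (sub_pos.2 hj).le
    (sub_nonneg.2 (torusCos_le_one _))) (by positivity)
  have hκ : 0 < ∫ q, g q := by
    refine hgc.integral_pos_of_hasCompactSupport_nonneg_nonzero
      (HasCompactSupport.of_compactSpace _) hg0 (x := fun _ => ((π : ℝ) : AddCircle (2 * π))) ?_
    have : (1 - torusCos ((π : ℝ) : AddCircle (2 * π))) = 2 := by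
      rw [torusCos_coe, Real.cos_pi]
      norm_num
    simp only [hg, this]
    have := sub_pos.2 hj
    positivity
  have hY0 : ∀ q : Torus, 0 ≤ ∑ i, r i * (1 - torusCos (q i)) := fun q =>
    Finset.sum_nonneg fun i _ => mul_nonneg (hr0 i) (sub_nonneg.2 (torusCos_le_one _))
  have hYs : ∀ q : Torus, (∑ i, r i * (1 - torusCos (q i))) + (s - r j) * (1 - torusCos (q j))
      ≤ s * dispersion q := by
    intro q
    have h : s * dispersion q - ∑ i, r i * (1 - torusCos (q i))
        = ∑ i, (s - r i) * (1 - torusCos (q i)) := by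
      rw [dispersion, Finset.mul_sum, ← Finset.sum_sub_distrib]
      exact Finset.sum_congr rfl fun i _ => by ring
    have h2 := Finset.single_le_sum (f := fun i => (s - r i) * (1 - torusCos (q i)))
      (fun i _ => mul_nonneg (sub_nonneg.2 (hrs i)) (sub_nonneg.2 (torusCos_le_one _)))
      (Finset.mem_univ j)
    linarith
  have hint1 : ∀ a : ℝ, 0 < a → Integrable fun q : Torus => (a + s * dispersion q)⁻¹ := by
    intro a ha
    refine Continuous.integrable_torus (Continuous.inv₀ (by fun_prop) fun q => ?_)
    have := mul_nonneg hs.le (dispersion_nonneg q)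
    exact ne_of_gt (by linarith)
  have hint2 : ∀ a : ℝ, 0 < a →
      Integrable fun q : Torus => (a + ∑ i, r i * (1 - torusCos (q i)))⁻¹ := by
    intro a ha
    refine Continuous.integrable_torus (Continuous.inv₀ (by fun_prop) fun q => ?_)
    have := hY0 q
    exact ne_of_gt (by linarith)
  have hgap : ∀ a : ℝ, 0 < a → a ≤ 1 → (∫ q : Torus, (a + s * dispersion q)⁻¹) + ∫ q, g q
      ≤ ∫ q : Torus, (a + ∑ i, r i * (1 - torusCos (q i)))⁻¹ := by
    intro a ha ha1
    rw [← integral_add (hint1 a ha) hgc.integrable_torus]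
    refine integral_mono ((hint1 a ha).add hgc.integrable_torus) (hint2 a ha) fun q => ?_
    have h0 := hY0 q
    have h1 := hYs q
    have h6 := dispersion_le q
    have hc : 0 ≤ (s - r j) * (1 - torusCos (q j)) :=
      mul_nonneg (sub_pos.2 hj).le (sub_nonneg.2 (torusCos_le_one _))
    simp only [hg]
    set Y := ∑ i, r i * (1 - torusCos (q i))
    set c := (s - r j) * (1 - torusCos (q j))
    set D := s * dispersion q
    have hD6 : D ≤ 6 * s := by nlinarith
    have hM : (a + Y) * (a + D) ≤ (1 + 6 * s) ^ 2 := by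
      rw [sq]
      exact mul_le_mul (by linarith) (by linarith) (by linarith) (by linarith)
    have h2 : c / (1 + 6 * s) ^ 2 ≤ c / ((a + Y) * (a + D)) :=
      div_le_div_of_nonneg_left hc (mul_pos (by linarith) (by linarith)) hM
    have h3 : c / ((a + Y) * (a + D)) ≤ (D - Y) / ((a + Y) * (a + D)) :=
      div_le_div_of_nonneg_right (by linarith)
        (mul_pos (by linarith : 0 < a + Y) (by linarith : 0 < a + D)).le
    have h4 : (D - Y) / ((a + Y) * (a + D)) = (a + Y)⁻¹ - (a + D)⁻¹ := by
      have e1 : a + Y ≠ 0 := ne_of_gt (by linarith)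
      have e2 : a + D ≠ 0 := ne_of_gt (by linarith)
      field_simp
      ring
    linarith
  -- By dominated convergence the resolvent integral of the pair at rest tends to its threshold
  -- value, so for small `a` its deficit is below `∫ g`.
  have hlim : Tendsto (fun n : ℕ => ∫ q : Torus, (1 / ((n : ℝ) + 1) + s * dispersion q)⁻¹) atTop
      (𝓝 (∫ q : Torus, s⁻¹ * (dispersion q)⁻¹)) := by
    refine tendsto_integral_of_dominated_convergence (fun q => s⁻¹ * (dispersion q)⁻¹)
      (fun n => (hint1 _ (by positivity)).1) (hI.const_mul _) (fun n => ?_) ?_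
    · filter_upwards [ae_dispersion_pos] with q hq
      have hn : 0 < 1 / ((n : ℝ) + 1) := by positivity
      rw [Real.norm_of_nonneg (by positivity), ← mul_inv]
      exact inv_anti₀ (by positivity) (by linarith)
    · filter_upwards [ae_dispersion_pos] with q hq
      have h := (tendsto_one_div_add_atTop_nhds_zero_nat (𝕜 := ℝ)).add_const (s * dispersion q)
      rw [zero_add] at h
      rw [← mul_inv]
      exact h.inv₀ (by positivity)
  rw [integral_const_mul] at hlim
  obtain ⟨n, hn⟩ := (hlim.eventually (lt_mem_nhds (sub_lt_self _ hκ))).exists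
  refine ⟨1 / ((n : ℝ) + 1), by positivity, ?_⟩
  have := hgap (1 / ((n : ℝ) + 1)) (by positivity)
    ((div_le_one (by positivity)).2 (by linarith [n.cast_nonneg (α := ℝ)]))
  linarith

lemma dispersion_sub_single (k : Torus) (i : Fin 3) (t : AddCircle (2 * π)) :
    dispersion (k - Pi.single i t) = dispersion k + (torusCos (k i) - torusCos (k i - t)) := by
  have h : ∀ j, 1 - torusCos ((k - Pi.single i t : Torus) j) = (1 - torusCos (k j))
      + if j = i then torusCos (k i) - torusCos (k i - t) else 0 := by
    intro j
    by_cases hj : j = i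
    · subst hj
      simp
    · simp [hj]
  rw [dispersion, dispersion, Finset.sum_congr rfl fun j _ => h j, Finset.sum_add_distrib]
  simp

/-- A momentum `k_α = K` does not minimize the kinetic energy. -/
lemma exists_kineticEnergy_lt (hl : ∀ i, 0 < l i) (α : Fin 3) {i : Fin 3} {x : ℝ}
    (hx : K i = (x : AddCircle (2 * π))) (hsin : Real.sin x ≠ 0) :
    ∃ y, kineticEnergy l K y < l α * dispersion K := by
  by_contra! hge
  -- Starting from `k_α = K`, transfer `t` in coordinate `i` to particle `α + 1`. Its energy changes
  -- to second order only, while that of particle `α` has the nonzero derivative `-l α * sin x`; so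
  -- `K` is not a minimizer.
  have hf : ∀ t : ℝ, 0 ≤ l α * (Real.cos x - Real.cos (x - t))
      + l (α + 1) * (1 - Real.cos t) := by
    intro t
    have h := hge (pairInv K α (K - Pi.single i (t : AddCircle (2 * π)), Pi.single i t))
    have h0 : K - (K - Pi.single i (t : AddCircle (2 * π))) - Pi.single i t = 0 := by abel
    have h1 : dispersion (Pi.single i (t : AddCircle (2 * π))) = 1 - Real.cos t := by
      have h2 := dispersion_sub_single 0 i (-(t : AddCircle (2 * π)))
      have h3 : (0 : Torus) - Pi.single i (-(t : AddCircle (2 * π))) = Pi.single i t := by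
        rw [Pi.single_neg]
        simp
      have h4 : dispersion (0 : Torus) = 0 := by simp [dispersion, torusCos_zero]
      rw [h3, h4] at h2
      rw [h2]
      simp [torusCos_zero, torusCos_coe]
    have h4 : dispersion (0 : Torus) = 0 := by simp [dispersion, torusCos_zero]
    rw [kineticEnergy_pairInv, h0, h1, h4, dispersion_sub_single, hx, ← AddCircle.coe_sub,
      torusCos_coe, torusCos_coe] at h
    linarith
  have hd : HasDerivAt (fun t : ℝ => l α * (Real.cos x - Real.cos (x - t))
      + l (α + 1) * (1 - Real.cos t)) (l α * (-Real.sin x)) 0 := by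
    have h1 : HasDerivAt (fun t : ℝ => Real.cos (x - t)) (Real.sin x) 0 := by
      have := ((hasDerivAt_id (0 : ℝ)).const_sub x).cos
      simpa using this
    have h2 := Real.hasDerivAt_cos 0
    have := ((h1.const_sub (Real.cos x)).const_mul (l α)).add
      ((h2.const_sub 1).const_mul (l (α + 1)))
    exact this.congr_deriv (by simp)
  have hmin : IsLocalMin (fun t : ℝ => l α * (Real.cos x - Real.cos (x - t))
      + l (α + 1) * (1 - Real.cos t)) 0 := by
    refine Eventually.of_forall fun t => ?_
    simpa using hf t
  have := hmin.hasDerivAt_eq_zero hd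
  rcases mul_eq_zero.1 this with h | h
  · exact (hl α).ne' h
  · exact hsin (neg_eq_zero.1 h)

/-- With a critical pair, the essential spectrum starts strictly below the free spectrum. -/
lemma essentialBottom_lt_kineticEnergy (hl : ∀ i, 0 < l i) (hμ : ∀ i, 0 < μ i) {α : Fin 3}
    (hcrit : μ α = criticalCoupling l α) {i : Fin 3} {x : ℝ}
    (hx : K i = (x : AddCircle (2 * π))) (hsin : Real.sin x ≠ 0) (y : Torus × Torus) :
    essentialBottom (hamiltonian l μ K) < kineticEnergy l K y := by
  obtain ⟨y₀, -, hmin⟩ := isCompact_univ.exists_isMinOn (s := (Set.univ : Set (Torus × Torus)))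
    Set.univ_nonempty (continuous_kineticEnergy l K).continuousOn
  have hmin' : ∀ y, kineticEnergy l K y₀ ≤ kineticEnergy l K y := fun y => hmin (Set.mem_univ y)
  refine lt_of_lt_of_le ?_ (hmin' y)
  set e := kineticEnergy l K y₀ with he
  set k := momenta K y₀ α with hk
  set s := l (α + 1) + l (α + 2) with hs_def
  have hs : 0 < s := add_pos (hl _) (hl _)
  set r : Fin 3 → ℝ := fun i => pairAmp (l (α + 1)) (l (α + 2)) (K i - k i) with hr
  have hr0 : ∀ i, 0 ≤ r i := fun i => pairAmp_nonneg _ _ _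
  have hrs : ∀ i, r i ≤ s := fun i => pairAmp_le (hl _) (hl _) _
  have hy₀ : pairInv K α (k, momenta K y₀ (α + 1)) = y₀ := pairInv_momenta K α y₀
  have hkK : k ≠ K := by
    intro hkK
    obtain ⟨y', hy'⟩ := exists_kineticEnergy_lt hl α hx hsin
    have h1 := hmin' y'
    have h2 : l α * dispersion K ≤ e := by
      rw [he, ← hy₀, kineticEnergy_pairInv, hkK]
      have := mul_nonneg (hl (α + 1)).le (dispersion_nonneg (momenta K y₀ (α + 1)))
      have := mul_nonneg (hl (α + 2)).le (dispersion_nonneg (K - K - momenta K y₀ (α + 1)))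
      linarith
    linarith
  obtain ⟨j, hj⟩ : ∃ j, r j < s := by
    obtain ⟨j, hj⟩ := Function.ne_iff.1 hkK
    exact ⟨j, pairAmp_lt (hl _) (hl _) (sub_ne_zero.2 hj.symm)⟩
  -- The fibre over `k` contains the minimizer, so its bottom is at most `e`. At energy `e - a` the
  -- centred energy is therefore at most the model energy of `exists_lt_integral_inv`.
  have hce : l α * dispersion k + ∑ i, (s - r i) ≤ e := by
    obtain ⟨θ, hθ⟩ := exists_kineticEnergy_eq_centered l K 0 α k
    have h := hθ (momenta K y₀ (α + 1))
    rw [hy₀, sub_zero, centeredEnergy, sub_zero] at h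
    rw [he, h]
    have : ∑ i, (s - r i) ≤ ∑ i, (s - r i * torusCos ((momenta K y₀ (α + 1) - θ) i)) :=
      Finset.sum_le_sum fun i _ => by nlinarith [hr0 i, torusCos_le_one ((momenta K y₀ (α + 1) - θ) i)]
    linarith
  have hc0 : 0 < criticalCoupling l α := hcrit ▸ hμ α
  obtain ⟨a, ha, hlt⟩ := exists_lt_integral_inv hs (integrable_dispersion_inv hc0)
    hr0 hrs hj
  have hz : ∀ y, e - a < kineticEnergy l K y := fun y => by linarith [hmin' y]
  have hcos := continuous_torusCos
  have hY0 : ∀ q : Torus, 0 ≤ ∑ i, r i * (1 - torusCos (q i)) := fun q =>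
    Finset.sum_nonneg fun i _ => mul_nonneg (hr0 i) (sub_nonneg.2 (torusCos_le_one _))
  have hint : Integrable fun q : Torus => (a + ∑ i, r i * (1 - torusCos (q i)))⁻¹ := by
    refine Continuous.integrable_torus (Continuous.inv₀ (by fun_prop) fun q => ?_)
    exact ne_of_gt (by linarith [hY0 q])
  have hle : ∫ q : Torus, (a + ∑ i, r i * (1 - torusCos (q i)))⁻¹
      ≤ resolventMean l K (e - a) α k := by
    rw [resolventMean_eq_centered]
    refine integral_mono hint (integrable_inv_centeredEnergy hz α k)
      fun q => inv_anti₀ (centeredEnergy_pos hz α k q) ?_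
    have h1 : ∑ i, (s - r i * torusCos (q i))
        = ∑ i, (s - r i) + ∑ i, r i * (1 - torusCos (q i)) := by
      rw [← Finset.sum_add_distrib]
      exact Finset.sum_congr rfl fun i _ => by ring
    have h2 : centeredEnergy l K (e - a) α k q
        = l α * dispersion k - (e - a) + ∑ i, (s - r i * torusCos (q i)) := rfl
    rw [h2]
    linarith
  have hneg : pairDet l μ K (e - a) α k < 0 := by
    have h1 := criticalCoupling_mul hl hc0
    have hw : 0 < criticalCoupling l α / (2 * π) ^ 3 := div_pos hc0 (by positivity)
    have h2 := mul_lt_mul_of_pos_left (hlt.trans_le hle) hw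
    rw [pairDet, hcrit]
    linarith
  exact (essentialBottom_lt_of_pairDet_neg hz hμ hneg).trans (by linarith)

end Comparison

/-! ### Integrals of powers of the model resolvent, with explicit dependence on the gap `a`. -/

noncomputable section ModelIntegrals

lemma exists_coe_eq_abs_eq_norm (t : AddCircle (2 * π)) :
    ∃ x : ℝ, (x : AddCircle (2 * π)) = t ∧ |x| = ‖t‖ := by
  induction t using QuotientAddGroup.induction_on with
  | H x =>
    refine ⟨x - round ((2 * π)⁻¹ * x) * (2 * π), ?_, (AddCircle.norm_eq (2 * π)).symm⟩
    have h : ((round ((2 * π)⁻¹ * x) * (2 * π) : ℝ) : AddCircle (2 * π)) = 0 :=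
      (AddCircle.coe_eq_zero_iff _).2 ⟨round ((2 * π)⁻¹ * x), by simp⟩
    rw [AddCircle.coe_sub, h, sub_zero]

lemma one_sub_torusCos_le (t : AddCircle (2 * π)) : 1 - torusCos t ≤ ‖t‖ ^ 2 / 2 := by
  obtain ⟨x, rfl, hx⟩ := exists_coe_eq_abs_eq_norm t
  rw [torusCos_coe, ← hx, sq_abs]
  linarith [Real.one_sub_sq_div_two_le_cos (x := x)]

lemma volume_closedBall_torus {ε : ℝ} (h0 : 0 ≤ ε) (h1 : ε ≤ 1) :
    volume.real (Metric.closedBall (0 : Torus) ε) = (2 * ε) ^ 3 := by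
  have h2 : min (2 * π) (2 * ε) = 2 * ε := min_eq_right (by linarith [Real.pi_gt_three])
  rw [measureReal_def, closedBall_pi _ h0, volume_pi_pi]
  simp only [Pi.zero_apply, AddCircle.volume_closedBall, h2]
  rw [Finset.prod_const, ENNReal.toReal_pow, ENNReal.toReal_ofReal (by positivity)]
  simp

variable {a s : ℝ} {r : Fin 3 → ℝ}

/-- The energy of a pair relative to its minimum, plus `a`. -/
def modelEnergy (a : ℝ) (r : Fin 3 → ℝ) (q : Torus) : ℝ := a + ∑ i, r i * (1 - torusCos (q i))

lemma continuous_modelEnergy (a : ℝ) (r : Fin 3 → ℝ) : Continuous (modelEnergy a r) := by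
  have := continuous_torusCos
  unfold modelEnergy
  fun_prop

lemma le_modelEnergy (hr : ∀ i, 0 ≤ r i) (q : Torus) : a ≤ modelEnergy a r q := by
  have : 0 ≤ ∑ i, r i * (1 - torusCos (q i)) :=
    Finset.sum_nonneg fun i _ => mul_nonneg (hr i) (sub_nonneg.2 (torusCos_le_one _))
  unfold modelEnergy
  linarith

lemma mul_le_modelEnergy (ha : 0 < a) (hr : ∀ i, 0 ≤ r i) (i : Fin 3) (q : Torus) :
    r i * (1 - torusCos (q i)) ≤ modelEnergy a r q := by
  have := Finset.single_le_sum (f := fun i => r i * (1 - torusCos (q i)))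
    (fun i _ => mul_nonneg (hr i) (sub_nonneg.2 (torusCos_le_one _))) (Finset.mem_univ i)
  simp only [modelEnergy] at this ⊢
  linarith

lemma modelEnergy_le (ha : a ≤ 1) (hs : 0 ≤ s) (hrs : ∀ i, r i ≤ s) (q : Torus) :
    modelEnergy a r q ≤ 1 + 6 * s := by
  have h : ∑ i, r i * (1 - torusCos (q i)) ≤ ∑ _i : Fin 3, 2 * s := by
    refine Finset.sum_le_sum fun i _ => ?_
    nlinarith [mul_nonneg (sub_nonneg.2 (hrs i)) (sub_nonneg.2 (torusCos_le_one (q i))),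
      mul_nonneg hs (by linarith [neg_one_le_torusCos (q i)] : 0 ≤ 1 + torusCos (q i))]
  simp only [Finset.sum_const, Finset.card_univ, Fintype.card_fin, nsmul_eq_mul] at h
  norm_num at h
  unfold modelEnergy
  linarith

lemma integrable_model (ha : 0 < a) (hr : ∀ i, 0 ≤ r i) {f : Torus → ℝ} (hf : Continuous f)
    (n : ℕ) : Integrable fun q => f q * (modelEnergy a r q ^ n)⁻¹ :=
  Continuous.integrable_torus (hf.mul (((continuous_modelEnergy a r).pow n).inv₀
    fun q => (pow_pos (ha.trans_le (le_modelEnergy hr q)) n).ne'))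

lemma integrable_model_inv (ha : 0 < a) (hr : ∀ i, 0 ≤ r i) (n : ℕ) :
    Integrable fun q => (modelEnergy a r q ^ n)⁻¹ := by
  simpa using integrable_model ha hr (continuous_const (y := (1 : ℝ))) n

/-- On the ball of radius `√a` the energy is at most `a (1 + 3s/2)`, and the ball has volume `8
a^(3/2)`: the squared resolvent has an integral of order at least `a^(-1/2)`. -/
lemma integral_model_lower (ha : 0 < a) (ha1 : a ≤ 1) (hs : 0 < s) (hr : ∀ i, 0 ≤ r i)
    (hrs : ∀ i, r i ≤ s) :
    8 / (1 + 3 * s / 2) ^ 2 ≤ √a * ∫ q, (modelEnergy a r q ^ 2)⁻¹ := by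
  have hsq : √a ^ 2 = a := Real.sq_sqrt ha.le
  have hs0 : 0 < √a := Real.sqrt_pos.2 ha
  have hs1 : √a ≤ 1 := Real.sqrt_le_one.2 ha1
  set D := Metric.closedBall (0 : Torus) √a with hD
  have hbound : ∀ q ∈ D, ((a * (1 + 3 * s / 2)) ^ 2)⁻¹ ≤ (modelEnergy a r q ^ 2)⁻¹ := by
    intro q hq
    have hX := ha.trans_le (le_modelEnergy (a := a) hr q)
    refine inv_anti₀ (pow_pos hX 2) (pow_le_pow_left₀ hX.le ?_ 2)
    have hq' : ∀ i, 1 - torusCos (q i) ≤ a / 2 := by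
      intro i
      have h1 : ‖q i‖ ≤ √a := (norm_le_pi_norm q i).trans (by simpa [hD] using hq)
      have h2 := pow_le_pow_left₀ (norm_nonneg _) h1 2
      linarith [one_sub_torusCos_le (q i)]
    have h : ∑ i, r i * (1 - torusCos (q i)) ≤ ∑ _i : Fin 3, s * (a / 2) :=
      Finset.sum_le_sum fun i _ => mul_le_mul (hrs i) (hq' i)
        (sub_nonneg.2 (torusCos_le_one _)) hs.le
    simp only [Finset.sum_const, Finset.card_univ, Fintype.card_fin, nsmul_eq_mul] at h
    norm_num at h
    unfold modelEnergy
    linarith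
  have hint := integrable_model_inv (r := r) ha hr 2
  have h1 : ∫ q in D, ((a * (1 + 3 * s / 2)) ^ 2)⁻¹ ≤ ∫ q in D, (modelEnergy a r q ^ 2)⁻¹ :=
    setIntegral_mono_on (integrable_const _) hint.integrableOn
      Metric.isClosed_closedBall.measurableSet hbound
  have h2 : ∫ q in D, (modelEnergy a r q ^ 2)⁻¹ ≤ ∫ q, (modelEnergy a r q ^ 2)⁻¹ :=
    setIntegral_le_integral hint (Eventually.of_forall fun q => by
      have := le_modelEnergy (a := a) hr q
      positivity)
  rw [setIntegral_const, volume_closedBall_torus hs0.le hs1, smul_eq_mul] at h1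
  refine le_trans (le_of_eq ?_) (mul_le_mul_of_nonneg_left (h1.trans h2) hs0.le)
  have h4 : √a * ((2 * √a) ^ 3 * ((a * (1 + 3 * s / 2)) ^ 2)⁻¹)
      = 8 * (√a ^ 2) ^ 2 * ((a * (1 + 3 * s / 2)) ^ 2)⁻¹ := by ring
  rw [h4, hsq]
  field_simp

lemma integral_model_cube_le (ha : 0 < a) (hr : ∀ i, 0 ≤ r i) :
    ∫ q, (modelEnergy a r q ^ 3)⁻¹ ≤ (∫ q, (modelEnergy a r q ^ 2)⁻¹) / a := by
  rw [← integral_div]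
  refine integral_mono (integrable_model_inv ha hr 3) ((integrable_model_inv ha hr 2).div_const a)
    fun q => ?_
  have h := le_modelEnergy (a := a) hr q
  have hX := ha.trans_le h
  simp only
  rw [inv_eq_one_div, inv_eq_one_div, div_div]
  refine one_div_le_one_div_of_le (by positivity) ?_
  nlinarith [pow_pos hX 2]

/-- The factor `1 - cos q_i` is at most `2/s` times the energy and absorbs one power of the
resolvent. -/
lemma integral_model_one_sub_le (ha : 0 < a) (hs : 0 < s) (hr : ∀ i, s / 2 ≤ r i) (i : Fin 3) :
    ∫ q, (1 - torusCos (q i)) * (modelEnergy a r q ^ 2)⁻¹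
      ≤ 2 / s * ∫ q, (modelEnergy a r q)⁻¹ := by
  have hr0 : ∀ i, 0 ≤ r i := fun i => le_trans (by positivity) (hr i)
  have hcos := continuous_torusCos
  rw [← integral_const_mul]
  have hint := integrable_model_inv (r := r) ha hr0 1
  simp only [pow_one] at hint
  refine integral_mono (integrable_model ha hr0 (by fun_prop) 2) (hint.const_mul _) fun q => ?_
  have hX := ha.trans_le (le_modelEnergy (a := a) hr0 q)
  have h := mul_le_modelEnergy ha hr0 i q
  have h0 := sub_nonneg.2 (torusCos_le_one (q i))
  have h1 : s / 2 * (1 - torusCos (q i)) ≤ modelEnergy a r q :=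
    (mul_le_mul_of_nonneg_right (hr i) h0).trans h
  simp only
  rw [← div_eq_mul_inv, ← div_eq_mul_inv, div_div, div_le_div_iff₀ (by positivity) (by positivity)]
  nlinarith

lemma integral_model_one_sub_sq_le (ha : 0 < a) (hs : 0 < s) (hr : ∀ i, s / 2 ≤ r i)
    (i : Fin 3) :
    ∫ q, (1 - torusCos (q i)) ^ 2 * (modelEnergy a r q ^ 3)⁻¹
      ≤ 4 / s ^ 2 * ∫ q, (modelEnergy a r q)⁻¹ := by
  have hr0 : ∀ i, 0 ≤ r i := fun i => le_trans (by positivity) (hr i)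
  have hcos := continuous_torusCos
  rw [← integral_const_mul]
  have hint := integrable_model_inv (r := r) ha hr0 1
  simp only [pow_one] at hint
  refine integral_mono (integrable_model ha hr0 (by fun_prop) 3) (hint.const_mul _) fun q => ?_
  have hX := ha.trans_le (le_modelEnergy (a := a) hr0 q)
  have h := mul_le_modelEnergy ha hr0 i q
  have h0 := sub_nonneg.2 (torusCos_le_one (q i))
  have h1 : s / 2 * (1 - torusCos (q i)) ≤ modelEnergy a r q :=
    (mul_le_mul_of_nonneg_right (hr i) h0).trans h
  have h2 : (s / 2 * (1 - torusCos (q i))) ^ 2 ≤ modelEnergy a r q ^ 2 :=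
    pow_le_pow_left₀ (by positivity) h1 2
  simp only
  rw [← div_eq_mul_inv, ← div_eq_mul_inv, div_div, div_le_div_iff₀ (by positivity) (by positivity)]
  nlinarith

lemma integral_model_le (ha : 0 < a) (ha1 : a ≤ 1) (hs : 0 ≤ s) (hr : ∀ i, 0 ≤ r i)
    (hrs : ∀ i, r i ≤ s) :
    ∫ q, (modelEnergy a r q)⁻¹ ≤ (1 + 6 * s) * ∫ q, (modelEnergy a r q ^ 2)⁻¹ := by
  rw [← integral_const_mul]
  have hint := integrable_model_inv (r := r) ha hr 1
  simp only [pow_one] at hint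
  refine integral_mono hint ((integrable_model_inv ha hr 2).const_mul _) fun q => ?_
  have hX := ha.trans_le (le_modelEnergy (a := a) hr q)
  have h := modelEnergy_le (r := r) ha1 hs hrs q
  simp only
  rw [← div_eq_mul_inv, inv_eq_one_div, div_le_div_iff₀ hX (by positivity)]
  nlinarith

/-- The variance-type estimate of the cosine against the cubed resolvent. -/
lemma integral_model_variance_le (ha : 0 < a) (ha1 : a ≤ 1) (hs : 0 < s) (hr : ∀ i, s / 2 ≤ r i)
    (hrs : ∀ i, r i ≤ s) (i : Fin 3) {M B c : ℝ} (hM : M = ∫ q, (modelEnergy a r q)⁻¹)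
    (hB : B = ∫ q, (modelEnergy a r q ^ 2)⁻¹)
    (hc : c * B = ∫ q, torusCos (q i) * (modelEnergy a r q ^ 2)⁻¹) :
    ∫ q, (c - torusCos (q i)) ^ 2 * (modelEnergy a r q ^ 3)⁻¹
      ≤ (8 * (1 + 6 * s) / s ^ 2 + 8 * M ^ 2 / (s ^ 2 * (8 / (1 + 3 * s / 2) ^ 2) ^ 2)) * B := by
  have hr0 : ∀ i, 0 ≤ r i := fun i => le_trans (by positivity) (hr i)
  have hcos := continuous_torusCos
  have hlow := integral_model_lower ha ha1 hs hr0 hrs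
  have hone := integral_model_one_sub_le ha hs hr i
  have hsq := integral_model_one_sub_sq_le ha hs hr i
  have hcube := integral_model_cube_le ha hr0
  have hMB := integral_model_le ha ha1 hs.le hr0 hrs
  rw [← hB] at hlow hcube hMB
  rw [← hM] at hone hsq hMB
  set c0 := 8 / (1 + 3 * s / 2) ^ 2 with hc0_def
  have hc0 : 0 < c0 := by positivity
  have hsa : 0 < √a := Real.sqrt_pos.2 ha
  have hB0 : 0 < B := pos_of_mul_pos_right (hc0.trans_le hlow) hsa.le
  have hdiff : (1 - c) * B = ∫ q, (1 - torusCos (q i)) * (modelEnergy a r q ^ 2)⁻¹ := by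
    rw [sub_mul, one_mul, hc, hB, ← integral_sub (integrable_model_inv ha hr0 2)
      (integrable_model ha hr0 (by fun_prop) 2)]
    congr 1
    funext q
    ring
  have hdiff0 : 0 ≤ (1 - c) * B := by
    rw [hdiff]
    refine integral_nonneg fun q => mul_nonneg (sub_nonneg.2 (torusCos_le_one _)) ?_
    have := le_modelEnergy (a := a) hr0 q
    positivity
  rw [← hdiff] at hone
  -- Split `c - cos = (1 - cos) - (1 - c)`. The first part absorbs two powers of the resolvent; the
  -- second is controlled by the smallness of `1 - c`.
  have hmain : ∫ q, (c - torusCos (q i)) ^ 2 * (modelEnergy a r q ^ 3)⁻¹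
      ≤ 2 * (∫ q, (1 - torusCos (q i)) ^ 2 * (modelEnergy a r q ^ 3)⁻¹)
        + 2 * (1 - c) ^ 2 * ∫ q, (modelEnergy a r q ^ 3)⁻¹ := by
    have hi1 := integrable_model (r := r) ha hr0 (f := fun q => (1 - torusCos (q i)) ^ 2)
      (by fun_prop) 3
    have hi2 := integrable_model_inv (r := r) ha hr0 3
    rw [← integral_const_mul, ← integral_const_mul, ← integral_add (hi1.const_mul _)
      (hi2.const_mul _)]
    refine integral_mono (integrable_model ha hr0 (by fun_prop) 3)
      ((hi1.const_mul _).add (hi2.const_mul _)) fun q => ?_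
    have hX := ha.trans_le (le_modelEnergy (a := a) hr0 q)
    have hX3 : 0 ≤ (modelEnergy a r q ^ 3)⁻¹ := by positivity
    simp only
    rw [← mul_assoc, ← add_mul]
    refine mul_le_mul_of_nonneg_right ?_ hX3
    nlinarith [sq_nonneg ((1 - torusCos (q i)) + (1 - c))]
  -- Since `a B² ≥ c0²` and `(1 - c) B ≤ 2M/s`, the ratio `(1 - c)² / a` is bounded. This
  -- compensates the loss `1/a` in the bound of the cubed resolvent by `B / a`.
  have hlow2 : c0 ^ 2 ≤ a * B ^ 2 := by
    have := pow_le_pow_left₀ hc0.le hlow 2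
    rwa [mul_pow, Real.sq_sqrt ha.le] at this
  have h1 : 2 * (1 - c) ^ 2 * ∫ q, (modelEnergy a r q ^ 3)⁻¹ ≤ 8 * M ^ 2 / (s ^ 2 * c0 ^ 2) * B := by
    have e1 : 2 * (1 - c) ^ 2 * ∫ q, (modelEnergy a r q ^ 3)⁻¹ ≤ 2 * (1 - c) ^ 2 * (B / a) :=
      mul_le_mul_of_nonneg_left hcube (by positivity)
    have e2 : ((1 - c) * B) ^ 2 ≤ (2 / s * M) ^ 2 := pow_le_pow_left₀ hdiff0 hone 2
    have e3 : 2 * (1 - c) ^ 2 * (B / a) = 2 * ((1 - c) * B) ^ 2 / (a * B ^ 2) * B := by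
      field_simp
    have e4 : 2 * ((1 - c) * B) ^ 2 / (a * B ^ 2) ≤ 2 * (2 / s * M) ^ 2 / c0 ^ 2 :=
      div_le_div₀ (by positivity) (by linarith) (by positivity) hlow2
    have e5 : 2 * (2 / s * M) ^ 2 / c0 ^ 2 = 8 * M ^ 2 / (s ^ 2 * c0 ^ 2) := by
      field_simp
      ring
    rw [e3] at e1
    rw [e5] at e4
    exact e1.trans (mul_le_mul_of_nonneg_right e4 hB0.le)
  have h2 : 2 * (4 / s ^ 2 * M) ≤ 8 * (1 + 6 * s) / s ^ 2 * B := by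
    have : 8 * (1 + 6 * s) / s ^ 2 * B = 8 / s ^ 2 * ((1 + 6 * s) * B) := by ring
    rw [this]
    have e : 2 * (4 / s ^ 2 * M) = 8 / s ^ 2 * M := by ring
    rw [e]
    exact mul_le_mul_of_nonneg_left hMB (by positivity)
  rw [add_mul]
  linarith

end ModelIntegrals

/-! ### The pair amplitude near zero momentum: Lipschitz bounds and concavity. -/

noncomputable section RealAmplitude

/-- The pair amplitude on the real line. -/
def realAmp (b c t : ℝ) : ℝ := √(b ^ 2 + c ^ 2 + 2 * b * c * Real.cos t)

lemma pairAmp_coe (b c t : ℝ) : pairAmp b c (t : AddCircle (2 * π)) = realAmp b c t := rfl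

variable {b c t u : ℝ}

lemma realAmp_sq (hb : 0 < b) (hc : 0 < c) (t : ℝ) :
    realAmp b c t ^ 2 = b ^ 2 + c ^ 2 + 2 * b * c * Real.cos t := by
  refine Real.sq_sqrt ?_
  nlinarith [mul_pos hb hc, Real.neg_one_le_cos t, sq_nonneg (b - c)]

lemma cos_pos_of_abs_le_one (ht : |t| ≤ 1) : 1 / 2 ≤ Real.cos t := by
  have h := Real.one_sub_sq_div_two_le_cos (x := t)
  have : t ^ 2 ≤ 1 := (sq_le_one_iff_abs_le_one t).2 ht
  linarith

lemma half_le_realAmp (hb : 0 < b) (hc : 0 < c) (ht : |t| ≤ 1) : (b + c) / 2 ≤ realAmp b c t := by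
  refine Real.le_sqrt_of_sq_le ?_
  have := mul_nonneg (mul_pos hb hc).le (by linarith [cos_pos_of_abs_le_one ht] : 0 ≤ Real.cos t)
  nlinarith [sq_nonneg (b - c)]

lemma realAmp_le (hb : 0 < b) (hc : 0 < c) (t : ℝ) : realAmp b c t ≤ b + c :=
  pairAmp_le hb hc (t : AddCircle (2 * π))

lemma abs_cos_sub_cos_le (t u : ℝ) : |Real.cos t - Real.cos u| ≤ |t + u| * |t - u| / 2 := by
  rw [Real.cos_sub_cos, abs_mul, abs_mul, abs_neg, abs_two]
  have h1 := Real.abs_sin_le_abs (x := (t + u) / 2)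
  have h2 := Real.abs_sin_le_abs (x := (t - u) / 2)
  rw [abs_div, abs_two] at h1 h2
  have := mul_le_mul h1 h2 (abs_nonneg _) (by positivity)
  nlinarith

/-- The difference of the squares is a difference of cosines, and the sum of the amplitudes is at
least `b + c`. -/
lemma abs_realAmp_sub_le (hb : 0 < b) (hc : 0 < c) (ht : |t| ≤ 1) (hu : |u| ≤ 1) :
    |realAmp b c t - realAmp b c u| ≤ (b + c) * (|t + u| * |t - u|) / 4 := by
  have h1 := half_le_realAmp hb hc ht
  have h2 := half_le_realAmp hb hc hu
  have h3 : (realAmp b c t - realAmp b c u) * (realAmp b c t + realAmp b c u)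
      = 2 * b * c * (Real.cos t - Real.cos u) := by
    have e1 := realAmp_sq hb hc t
    have e2 := realAmp_sq hb hc u
    linear_combination e1 - e2
  have h4 := congrArg abs h3
  rw [abs_mul, abs_mul, abs_of_pos (by linarith : 0 < realAmp b c t + realAmp b c u),
    abs_of_pos (by positivity : 0 < 2 * b * c)] at h4
  have h5 := abs_cos_sub_cos_le t u
  have h6 : |realAmp b c t - realAmp b c u| * (b + c)
      ≤ |realAmp b c t - realAmp b c u| * (realAmp b c t + realAmp b c u) :=
    mul_le_mul_of_nonneg_left (by linarith) (abs_nonneg _)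
  have h7 : 2 * b * c * |Real.cos t - Real.cos u| ≤ 2 * b * c * (|t + u| * |t - u| / 2) :=
    mul_le_mul_of_nonneg_left h5 (by positivity)
  have h8 : b * c ≤ (b + c) ^ 2 / 4 := by nlinarith [sq_nonneg (b - c)]
  have h9 : b * c * (|t + u| * |t - u|) ≤ (b + c) ^ 2 / 4 * (|t + u| * |t - u|) :=
    mul_le_mul_of_nonneg_right h8 (by positivity)
  have hs : 0 < b + c := by positivity
  refine le_of_mul_le_mul_right ?_ hs
  nlinarith

lemma sub_realAmp_le (hb : 0 < b) (hc : 0 < c) (ht : |t| ≤ 1) :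
    b + c - realAmp b c t ≤ (b + c) * t ^ 2 / 4 := by
  have h := abs_realAmp_sub_le hb hc (t := 0) (u := t) (by simp) ht
  have h0 : realAmp b c 0 = b + c := by
    rw [realAmp, Real.cos_zero, show b ^ 2 + c ^ 2 + 2 * b * c * 1 = (b + c) ^ 2 by ring,
      Real.sqrt_sq (by positivity)]
  rw [h0, zero_add, zero_sub, abs_neg, ← sq, sq_abs] at h
  exact (le_abs_self _).trans h

/-- The square root is increasing and concave, and the cosine is concave on `[-1, 1]`. -/
lemma concaveOn_realAmp (hb : 0 < b) (hc : 0 < c) :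
    ConcaveOn ℝ (Set.Icc (-1) 1) (realAmp b c) := by
  have hcos : ConcaveOn ℝ (Set.Icc (-1 : ℝ) 1) Real.cos :=
    strictConcaveOn_cos_Icc.concaveOn.subset
      (Set.Icc_subset_Icc (by linarith [Real.pi_gt_three]) (by linarith [Real.pi_gt_three]))
      (convex_Icc _ _)
  refine ⟨convex_Icc _ _, fun x hx y hy p q hp hq hpq => ?_⟩
  have h1 := hcos.2 hx hy hp hq hpq
  simp only [smul_eq_mul] at h1 ⊢
  have hnn : ∀ t : ℝ, 0 ≤ b ^ 2 + c ^ 2 + 2 * b * c * Real.cos t := fun t => by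
    rw [← realAmp_sq hb hc t]
    positivity
  have h2 := Real.strictConcaveOn_sqrt.concaveOn.2 (hnn x) (hnn y) hp hq hpq
  simp only [smul_eq_mul] at h2
  refine h2.trans (Real.sqrt_le_sqrt ?_)
  have h3 := mul_le_mul_of_nonneg_left h1 (by positivity : 0 ≤ 2 * b * c)
  have h4 : p * (b ^ 2 + c ^ 2) + q * (b ^ 2 + c ^ 2) = b ^ 2 + c ^ 2 := by
    rw [← add_mul, hpq, one_mul]
  linarith

/-- On `[-1, 1]` the cosine is at least `1/2`, which leaves room for `u²/4`. This strong concavity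
is the source of the quadratic growth. -/
lemma concaveOn_cos_add_sq :
    ConcaveOn ℝ (Set.Icc (-1) 1) fun u : ℝ => Real.cos u + u ^ 2 / 4 := by
  refine concaveOn_of_hasDerivWithinAt2_nonpos (f' := fun u => -Real.sin u + u / 2)
    (f'' := fun u => -Real.cos u + 1 / 2) (convex_Icc _ _) (by fun_prop) ?_ ?_ ?_
  · intro u _
    have h := (Real.hasDerivAt_cos u).add (((hasDerivAt_id u).pow 2).div_const 4)
    refine (h.congr_deriv ?_).hasDerivWithinAt
    simp
    ring
  · intro u _
    have h := ((Real.hasDerivAt_sin u).neg).add ((hasDerivAt_id u).div_const 2)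
    exact (h.congr_deriv (by simp)).hasDerivWithinAt
  · intro u hu
    rw [interior_Icc] at hu
    linarith [cos_pos_of_abs_le_one (abs_le.2 ⟨hu.1.le, hu.2.le⟩)]

/-- A nonnegative combination of `1 - cos`-type terms vanishing at the origin grows quadratically. -/
lemma sq_le_of_nonneg (hb : 0 < b) (hc : 0 < c) {P Q κ p : ℝ} (hP : 0 ≤ P) (hQ : 0 ≤ Q)
    (hκ : |κ| ≤ 1 / 2) (hp : |p| ≤ 1 / 2)
    (h : ∀ t, 0 ≤ P * (Real.cos κ - Real.cos (κ + t)) + Q * (realAmp b c p - realAmp b c (p - t)))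
    {t : ℝ} (ht : |t| ≤ 1 / 2) :
    P * t ^ 2 / 4 ≤ P * (Real.cos κ - Real.cos (κ + t))
      + Q * (realAmp b c p - realAmp b c (p - t)) := by
  set ψ : ℝ → ℝ := fun t => P * (Real.cos κ - Real.cos (κ + t))
    + Q * (realAmp b c p - realAmp b c (p - t)) with hψ
  change P * t ^ 2 / 4 ≤ ψ t
  have hmem : ∀ x y : ℝ, |x| ≤ 1 / 2 → |y| ≤ 1 / 2 → x + y ∈ Set.Icc (-1 : ℝ) 1 := by
    intro x y hx hy
    rw [abs_le] at hx hy
    constructor <;> linarith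
  -- `ψ(t) - P t²/4` is convex and vanishes at `0`, so it is at most `θ` times its value at `t`
  -- after scaling `t` by `θ`. Since `ψ ≥ 0`, it is also at least `-P θ² t²/4` there; dividing by
  -- `θ` and letting `θ → 0` gives the claim without differentiating.
  have hscale : ∀ θ : ℝ, 0 < θ → θ ≤ 1 →
      ψ (θ * t) - P * (θ * t) ^ 2 / 4 ≤ θ * (ψ t - P * t ^ 2 / 4) := by
    intro θ h0 h1
    have h2 := concaveOn_cos_add_sq.2 (hmem κ t hκ ht) (hmem κ 0 hκ (by norm_num)) h0.le
      (sub_nonneg.2 h1) (by ring)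
    have h3 := (concaveOn_realAmp hb hc).2 (hmem p (-t) hp (by rwa [abs_neg]))
      (hmem p 0 hp (by norm_num)) h0.le (sub_nonneg.2 h1) (by ring)
    simp only [smul_eq_mul, add_zero] at h2 h3
    rw [show θ * (κ + t) + (1 - θ) * κ = κ + θ * t by ring] at h2
    rw [show θ * (p + -t) + (1 - θ) * p = p - θ * t by ring, ← sub_eq_add_neg] at h3
    have h4 := mul_le_mul_of_nonneg_left h2 hP
    have h5 := mul_le_mul_of_nonneg_left h3 hQ
    simp only [hψ]
    nlinarith
  have hlim : ∀ θ : ℝ, 0 < θ → θ ≤ 1 → -(P * t ^ 2 / 4) * θ ≤ ψ t - P * t ^ 2 / 4 := by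
    intro θ h0 h1
    have h2 := hscale θ h0 h1
    have h3 := h (θ * t)
    have h4 : θ * (-(P * t ^ 2 / 4) * θ) ≤ θ * (ψ t - P * t ^ 2 / 4) := by
      change 0 ≤ ψ (θ * t) at h3
      nlinarith
    exact le_of_mul_le_mul_left h4 h0
  by_contra! hlt
  have hpos : 0 < P * t ^ 2 / 4 - ψ t := sub_pos.2 hlt
  set Z := P * t ^ 2 / 4 with hZ
  have hZ0 : 0 ≤ Z := by positivity
  have hψt : 0 ≤ ψ t := h t
  have hZ1 : 0 < Z := by linarith
  -- A `θ` small enough that the error `Z θ` is only half of the supposed deficit `Z - ψ t`.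
  have h1 := hlim ((Z - ψ t) / (2 * Z)) (by positivity)
    ((div_le_one (by positivity)).2 (by linarith))
  have h2 : -Z * ((Z - ψ t) / (2 * Z)) = -(Z - ψ t) / 2 := by
    field_simp
  rw [h2] at h1
  linarith

end RealAmplitude

/-! ### Exact expansion of the mean resolvent under a displacement. -/

noncomputable section ModelGrowth

/-- The change of the pair energy in one coordinate when the momentum is moved by `t`. -/
def energyShift (A b c κ p t : ℝ) (x : AddCircle (2 * π)) : ℝ :=
  A * (Real.cos κ - Real.cos (κ + t)) + (realAmp b c p - realAmp b c (p - t)) * torusCos x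

lemma continuous_energyShift (A b c κ p t : ℝ) : Continuous (energyShift A b c κ p t) := by
  have := continuous_torusCos
  unfold energyShift
  fun_prop

lemma energyShift_zero (A b c κ p : ℝ) (x : AddCircle (2 * π)) :
    energyShift A b c κ p 0 x = 0 := by
  simp [energyShift]

variable {A a b c : ℝ} {κ p : Fin 3 → ℝ}

/-- The first-order part of the decrease of the mean resolvent. -/
def firstOrder (A a b c : ℝ) (κ p : Fin 3 → ℝ) (i : Fin 3) (t : ℝ) : ℝ :=
  A * (∫ q, (modelEnergy a (fun j => realAmp b c (p j)) q ^ 2)⁻¹)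
      * (Real.cos (κ i) - Real.cos (κ i + t))
    + (∫ q : Torus, torusCos (q i) * (modelEnergy a (fun j => realAmp b c (p j)) q ^ 2)⁻¹)
      * (realAmp b c (p i) - realAmp b c (p i - t))

lemma integral_energyShift_mul (ha : 0 < a) (i : Fin 3) (t : ℝ) :
    ∫ q : Torus, energyShift A b c (κ i) (p i) t (q i)
        * (modelEnergy a (fun j => realAmp b c (p j)) q ^ 2)⁻¹
      = firstOrder A a b c κ p i t := by
  have hr : ∀ i, 0 ≤ realAmp b c (p i) := fun i => Real.sqrt_nonneg _
  have hcos := continuous_torusCos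
  have h1 := integrable_model_inv (a := a) ha hr 2
  have h2 := integrable_model (a := a) ha hr (f := fun q => torusCos (q i)) (by fun_prop) 2
  have h3 : (fun q : Torus => energyShift A b c (κ i) (p i) t (q i)
        * (modelEnergy a (fun j => realAmp b c (p j)) q ^ 2)⁻¹)
      = fun q => (A * (Real.cos (κ i) - Real.cos (κ i + t)))
          * (modelEnergy a (fun j => realAmp b c (p j)) q ^ 2)⁻¹
        + (realAmp b c (p i) - realAmp b c (p i - t))
          * (torusCos (q i) * (modelEnergy a (fun j => realAmp b c (p j)) q ^ 2)⁻¹) := by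
    funext q
    rw [energyShift]
    ring
  rw [h3, integral_add (h1.const_mul _) (h2.const_mul _), integral_const_mul, integral_const_mul,
    firstOrder]
  ring

/-- Integrate the identity `1/X - 1/(X + d) = d/X² - d²/(X² (X + d))`. The linear term splits over
the coordinates, and the remainder is nonnegative. -/
lemma integral_inv_sub_integral_inv (ha : 0 < a) {h : Fin 3 → ℝ}
    (hpos : ∀ q : Torus, 0 < modelEnergy a (fun j => realAmp b c (p j)) q
      + ∑ i, energyShift A b c (κ i) (p i) (h i) (q i)) :
    (∫ q, (modelEnergy a (fun j => realAmp b c (p j)) q)⁻¹)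
        - ∫ q : Torus, (modelEnergy a (fun j => realAmp b c (p j)) q
          + ∑ i, energyShift A b c (κ i) (p i) (h i) (q i))⁻¹
      = ∑ i, firstOrder A a b c κ p i (h i)
        - ∫ q : Torus, (∑ i, energyShift A b c (κ i) (p i) (h i) (q i)) ^ 2
          * (modelEnergy a (fun j => realAmp b c (p j)) q ^ 2 *
            (modelEnergy a (fun j => realAmp b c (p j)) q
              + ∑ i, energyShift A b c (κ i) (p i) (h i) (q i)))⁻¹ := by
  have hr : ∀ i, 0 ≤ realAmp b c (p i) := fun i => Real.sqrt_nonneg _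
  have hcs : ∀ i, Continuous fun q : Torus => energyShift A b c (κ i) (p i) (h i) (q i) :=
    fun i => (continuous_energyShift _ _ _ _ _ _).comp (continuous_apply i)
  have hcδ : Continuous fun q : Torus => ∑ i, energyShift A b c (κ i) (p i) (h i) (q i) :=
    continuous_finsetSum _ fun i _ => hcs i
  have hcX := continuous_modelEnergy a fun j => realAmp b c (p j)
  have hX : ∀ q, 0 < modelEnergy a (fun j => realAmp b c (p j)) q :=
    fun q => ha.trans_le (le_modelEnergy hr q)
  have h1 : Integrable fun q : Torus => (modelEnergy a (fun j => realAmp b c (p j)) q)⁻¹ :=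
    Continuous.integrable_torus (hcX.inv₀ fun q => (hX q).ne')
  have h2 : Integrable fun q : Torus => (modelEnergy a (fun j => realAmp b c (p j)) q
      + ∑ i, energyShift A b c (κ i) (p i) (h i) (q i))⁻¹ :=
    Continuous.integrable_torus ((hcX.add hcδ).inv₀ fun q => (hpos q).ne')
  have h3 : ∀ i, Integrable fun q : Torus => energyShift A b c (κ i) (p i) (h i) (q i)
      * (modelEnergy a (fun j => realAmp b c (p j)) q ^ 2)⁻¹ := fun i =>
    integrable_model ha hr (hcs i) 2
  have h4 : Integrable fun q : Torus => (∑ i, energyShift A b c (κ i) (p i) (h i) (q i)) ^ 2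
      * (modelEnergy a (fun j => realAmp b c (p j)) q ^ 2 *
        (modelEnergy a (fun j => realAmp b c (p j)) q
          + ∑ i, energyShift A b c (κ i) (p i) (h i) (q i)))⁻¹ :=
    Continuous.integrable_torus ((hcδ.pow 2).mul (((hcX.pow 2).mul (hcX.add hcδ)).inv₀
      fun q => (mul_pos (pow_pos (hX q) 2) (hpos q)).ne'))
  simp_rw [← integral_energyShift_mul ha]
  rw [← integral_finsetSum _ fun i _ => h3 i, ← integral_sub h1 h2,
    ← integral_sub (integrable_finsetSum _ fun i _ => h3 i) h4]
  refine integral_congr_ae (Eventually.of_forall fun q => ?_)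
  simp only
  rw [← Finset.sum_mul]
  have e1 := (hX q).ne'
  have e2 := (hpos q).ne'
  set X := modelEnergy a (fun j => realAmp b c (p j)) q
  set d := ∑ i, energyShift A b c (κ i) (p i) (h i) (q i)
  field_simp
  ring

end ModelGrowth

/-! ### Quadratic decrease of the mean resolvent from its maximum. -/

noncomputable section QuadraticGrowth

variable {A a b c η : ℝ} {κ p : Fin 3 → ℝ}

/-- The amplitude is stationary at `0`, whence the additional factor `η`, which later makes the
fluctuation term absorbable. -/
lemma abs_realAmp_shift_le (hb : 0 < b) (hc : 0 < c) (hη : η ≤ 1 / 2) {x t : ℝ} (hx : |x| ≤ η)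
    (ht : |t| ≤ η) : |realAmp b c x - realAmp b c (x - t)| ≤ (b + c) * η * |t| := by
  have h1 : |x - t| ≤ 1 := (abs_sub x t).trans (by linarith)
  have h2 := abs_realAmp_sub_le hb hc (t := x) (u := x - t) (by linarith) h1
  rw [show x - (x - t) = t by ring] at h2
  have h3 : |x + (x - t)| ≤ 3 * η := by
    rw [abs_le] at *
    constructor <;> linarith
  have h4 : (b + c) * (|x + (x - t)| * |t|) ≤ (b + c) * (3 * η * |t|) := by gcongr
  have h5 : 0 ≤ (b + c) * (η * |t|) := by
    have := (abs_nonneg t).trans ht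
    positivity
  linarith

lemma abs_cos_shift_le (hη : η ≤ 1 / 2) {x t : ℝ} (hx : |x| ≤ η)
    (ht : |t| ≤ η) : |Real.cos x - Real.cos (x + t)| ≤ |t| := by
  have h2 := abs_cos_sub_cos_le x (x + t)
  rw [show x - (x + t) = -t by ring, abs_neg] at h2
  have h3 : |x + (x + t)| ≤ 2 := by
    rw [abs_le] at *
    constructor <;> linarith
  have := mul_le_mul_of_nonneg_right h3 (abs_nonneg t)
  linarith

lemma abs_realAmp_shift_le' (hb : 0 < b) (hc : 0 < c) (hη : η ≤ 1 / 2) {x t : ℝ} (hx : |x| ≤ η)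
    (ht : |t| ≤ η) : |realAmp b c x - realAmp b c (x - t)| ≤ (b + c) * |t| := by
  refine (abs_realAmp_shift_le hb hc hη hx ht).trans ?_
  have : (b + c) * |t| * η ≤ (b + c) * |t| * 1 :=
    mul_le_mul_of_nonneg_left (by linarith) (by positivity)
  linarith

lemma abs_linearShift_le (hA : 0 < A) (hb : 0 < b) (hc : 0 < c) (hη : η ≤ 1 / 2) {x y t u : ℝ}
    (hx : |x| ≤ η) (hy : |y| ≤ η) (ht : |t| ≤ η) (hu : |u| ≤ 1) :
    |A * (Real.cos x - Real.cos (x + t)) + (realAmp b c y - realAmp b c (y - t)) * u|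
      ≤ (A + (b + c)) * |t| := by
  have h1 := mul_le_mul_of_nonneg_left (abs_cos_shift_le hη hx ht) hA.le
  have h2 := mul_le_mul (abs_realAmp_shift_le' hb hc hη hy ht) hu (abs_nonneg _) (by positivity)
  refine (abs_add_le _ _).trans ?_
  rw [abs_mul, abs_mul, abs_of_pos hA]
  linarith

lemma abs_torusCos_le (t : AddCircle (2 * π)) : |torusCos t| ≤ 1 :=
  abs_le.2 ⟨neg_one_le_torusCos t, torusCos_le_one t⟩

/-- The shift equals `ψ/B - ρ (d - cos q_i)`: an average part given by the first-order term, and a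
fluctuation. In the application `d` is the mean of the cosine for the weight `X⁻²`, so the
fluctuation falls under the variance estimate. -/
lemma integral_energyShift_sq_le (ha : 0 < a) (i : Fin 3) (t : ℝ) {B C₁ d ψ ρ : ℝ}
    (hB : B = ∫ q, (modelEnergy a (fun j => realAmp b c (p j)) q ^ 2)⁻¹) (hB0 : 0 < B)
    (hψ : ψ = A * B * (Real.cos (κ i) - Real.cos (κ i + t)) + d * B * ρ)
    (hρ : ρ = realAmp b c (p i) - realAmp b c (p i - t))
    (hvar : ∫ q : Torus, (d - torusCos (q i)) ^ 2
      * (modelEnergy a (fun j => realAmp b c (p j)) q ^ 3)⁻¹ ≤ C₁ * B) :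
    ∫ q : Torus, energyShift A b c (κ i) (p i) t (q i) ^ 2
        * (modelEnergy a (fun j => realAmp b c (p j)) q ^ 3)⁻¹
      ≤ 2 * ψ ^ 2 / (a * B) + 2 * ρ ^ 2 * (C₁ * B) := by
  have hr : ∀ i, 0 ≤ realAmp b c (p i) := fun i => Real.sqrt_nonneg _
  have hcos := continuous_torusCos
  have hcs : Continuous fun q : Torus => energyShift A b c (κ i) (p i) t (q i) :=
    (continuous_energyShift _ _ _ _ _ _).comp (continuous_apply i)
  have h1 := integrable_model_inv (a := a) ha hr 3
  have h2 := integrable_model (a := a) ha hr (f := fun q => (d - torusCos (q i)) ^ 2)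
    (by fun_prop) 3
  have hcube := integral_model_cube_le (a := a) ha hr
  rw [← hB] at hcube
  have h3 : ∫ q : Torus, energyShift A b c (κ i) (p i) t (q i) ^ 2
        * (modelEnergy a (fun j => realAmp b c (p j)) q ^ 3)⁻¹
      ≤ ∫ q : Torus, (2 * ψ ^ 2 / B ^ 2
          * (modelEnergy a (fun j => realAmp b c (p j)) q ^ 3)⁻¹
        + 2 * ρ ^ 2 * ((d - torusCos (q i)) ^ 2
          * (modelEnergy a (fun j => realAmp b c (p j)) q ^ 3)⁻¹)) := by
    refine integral_mono (integrable_model ha hr (hcs.pow 2) 3)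
      ((h1.const_mul _).add (h2.const_mul _)) fun q => ?_
    have hX := ha.trans_le (le_modelEnergy (a := a) hr q)
    have hX3 : 0 ≤ (modelEnergy a (fun j => realAmp b c (p j)) q ^ 3)⁻¹ := by positivity
    simp only
    rw [← mul_assoc, ← add_mul]
    refine mul_le_mul_of_nonneg_right ?_ hX3
    have e : energyShift A b c (κ i) (p i) t (q i) = ψ / B - ρ * (d - torusCos (q i)) := by
      rw [energyShift, hψ, ← hρ]
      field_simp
      ring
    have e2 : 2 * ψ ^ 2 / B ^ 2 = 2 * (ψ / B) ^ 2 := by ring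
    rw [e, e2]
    nlinarith [sq_nonneg (ψ / B + ρ * (d - torusCos (q i)))]
  rw [integral_add (h1.const_mul _) (h2.const_mul _), integral_const_mul, integral_const_mul] at h3
  have h4 : 2 * ψ ^ 2 / B ^ 2 * ∫ q, (modelEnergy a (fun j => realAmp b c (p j)) q ^ 3)⁻¹
      ≤ 2 * ψ ^ 2 / B ^ 2 * (B / a) := mul_le_mul_of_nonneg_left hcube (by positivity)
  have h5 : 2 * ψ ^ 2 / B ^ 2 * (B / a) = 2 * ψ ^ 2 / (a * B) := by
    field_simp
  have h6 := mul_le_mul_of_nonneg_left hvar (by positivity : 0 ≤ 2 * ρ ^ 2)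
  linarith

lemma sum_sq_fin_three_le (x : Fin 3 → ℝ) : (∑ i, x i) ^ 2 ≤ 3 * ∑ i, x i ^ 2 := by
  simp only [Fin.sum_univ_three]
  nlinarith [sq_nonneg (x 0 - x 1), sq_nonneg (x 0 - x 2), sq_nonneg (x 1 - x 2)]

/-- Three shifts of size at most `a/24` leave at least half of the energy `X ≥ a`, which gives a
factor `2`; Cauchy–Schwarz over the three coordinates gives the factor `3`. -/
lemma integral_remainder_le (ha : 0 < a) {h : Fin 3 → ℝ}
    (hsmall : ∀ i (q : Torus), |energyShift A b c (κ i) (p i) (h i) (q i)| ≤ a / 24) :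
    ∫ q : Torus, (∑ i, energyShift A b c (κ i) (p i) (h i) (q i)) ^ 2
          * (modelEnergy a (fun j => realAmp b c (p j)) q ^ 2 *
            (modelEnergy a (fun j => realAmp b c (p j)) q
              + ∑ i, energyShift A b c (κ i) (p i) (h i) (q i)))⁻¹
      ≤ ∑ i, 6 * ∫ q : Torus, energyShift A b c (κ i) (p i) (h i) (q i) ^ 2
        * (modelEnergy a (fun j => realAmp b c (p j)) q ^ 3)⁻¹ := by
  have hr : ∀ i, 0 ≤ realAmp b c (p i) := fun i => Real.sqrt_nonneg _
  have hcs : ∀ i, Continuous fun q : Torus => energyShift A b c (κ i) (p i) (h i) (q i) :=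
    fun i => (continuous_energyShift _ _ _ _ _ _).comp (continuous_apply i)
  have hcδ : Continuous fun q : Torus => ∑ i, energyShift A b c (κ i) (p i) (h i) (q i) :=
    continuous_finsetSum _ fun i _ => hcs i
  have hcX := continuous_modelEnergy a fun j => realAmp b c (p j)
  have hX : ∀ q, a ≤ modelEnergy a (fun j => realAmp b c (p j)) q :=
    fun q => le_modelEnergy hr q
  have hδ : ∀ q : Torus, modelEnergy a (fun j => realAmp b c (p j)) q / 2
      ≤ modelEnergy a (fun j => realAmp b c (p j)) q
        + ∑ i, energyShift A b c (κ i) (p i) (h i) (q i) := by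
    intro q
    have h1 := fun i => (abs_le.1 (hsmall i q)).1
    have h2 := hX q
    rw [Fin.sum_univ_three]
    linarith [h1 0, h1 1, h1 2]
  have h3 : ∀ i, Integrable fun q : Torus => energyShift A b c (κ i) (p i) (h i) (q i) ^ 2
      * (modelEnergy a (fun j => realAmp b c (p j)) q ^ 3)⁻¹ := fun i =>
    integrable_model ha hr ((hcs i).pow 2) 3
  simp_rw [← integral_const_mul]
  rw [← integral_finsetSum _ fun i _ => (h3 i).const_mul _]
  refine integral_mono (Continuous.integrable_torus ((hcδ.pow 2).mul
    (((hcX.pow 2).mul (hcX.add hcδ)).inv₀ fun q => ?_)))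
    (integrable_finsetSum _ fun i _ => (h3 i).const_mul _) fun q => ?_
  · have h0 := ha.trans_le (hX q)
    have h1 := hδ q
    exact (mul_pos (pow_pos h0 2) ((half_pos h0).trans_le h1)).ne'
  · have h0 := ha.trans_le (hX q)
    have h1 := hδ q
    have h2 := sum_sq_fin_three_le fun i => energyShift A b c (κ i) (p i) (h i) (q i)
    simp only [← Finset.mul_sum, ← Finset.sum_mul]
    set X := modelEnergy a (fun j => realAmp b c (p j)) q
    set d := ∑ i, energyShift A b c (κ i) (p i) (h i) (q i)
    set S := ∑ i, energyShift A b c (κ i) (p i) (h i) (q i) ^ 2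
    have h4 : (X ^ 2 * (X + d))⁻¹ ≤ 2 * (X ^ 3)⁻¹ := by
      have : 2 * (X ^ 3)⁻¹ = (X ^ 2 * (X / 2))⁻¹ := by
        field_simp
      rw [this]
      exact inv_anti₀ (by positivity) (mul_le_mul_of_nonneg_left h1 (by positivity))
    calc d ^ 2 * (X ^ 2 * (X + d))⁻¹ ≤ d ^ 2 * (2 * (X ^ 3)⁻¹) :=
          mul_le_mul_of_nonneg_left h4 (sq_nonneg d)
      _ ≤ 3 * S * (2 * (X ^ 3)⁻¹) := mul_le_mul_of_nonneg_right h2 (by positivity)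
      _ = 6 * (S * (X ^ 3)⁻¹) := by ring

/-- Displace coordinate `i` alone: the total decrease is nonnegative, and it is the first-order part
minus a nonnegative remainder. -/
lemma firstOrder_nonneg (ha : 0 < a)
    (hpos : ∀ (h : Fin 3 → ℝ) (q : Torus), 0 < modelEnergy a (fun j => realAmp b c (p j)) q
      + ∑ i, energyShift A b c (κ i) (p i) (h i) (q i))
    (hnn : ∀ h : Fin 3 → ℝ, 0 ≤ (∫ q, (modelEnergy a (fun j => realAmp b c (p j)) q)⁻¹)
        - ∫ q : Torus, (modelEnergy a (fun j => realAmp b c (p j)) q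
          + ∑ i, energyShift A b c (κ i) (p i) (h i) (q i))⁻¹) (i : Fin 3) (t : ℝ) :
    0 ≤ firstOrder A a b c κ p i t := by
  have h1 := hnn (Pi.single i t)
  rw [integral_inv_sub_integral_inv ha (hpos _)] at h1
  have h2 : ∑ j, firstOrder A a b c κ p j ((Pi.single i t : Fin 3 → ℝ) j)
      = firstOrder A a b c κ p i t := by
    rw [Finset.sum_eq_single i]
    · simp
    · intro j _ hj
      simp [Pi.single_eq_of_ne hj, firstOrder]
    · simp
  rw [h2] at h1
  refine h1.trans (sub_le_self _ (integral_nonneg fun q => ?_))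
  have := hpos (Pi.single i t) q
  exact mul_nonneg (sq_nonneg _) (inv_nonneg.2 (mul_nonneg (sq_nonneg _) this.le))

/-- The constant of the variance estimate. -/
def varianceBound (s M : ℝ) : ℝ :=
  8 * (1 + 6 * s) / s ^ 2 + 8 * M ^ 2 / (s ^ 2 * (8 / (1 + 3 * s / 2) ^ 2) ^ 2)

/-- If the mean resolvent is maximal at the origin, it decreases at least quadratically. -/
lemma model_growth (hA : 0 < A) (hb : 0 < b) (hc : 0 < c) (ha : 0 < a) (ha1 : a ≤ 1)
    (hη : 0 < η) (hη2 : η ≤ 1 / 2) (hκ : ∀ i, |κ i| ≤ η) (hp : ∀ i, |p i| ≤ η) {M : ℝ}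
    (hM0 : 0 < M) (hM : M = ∫ q, (modelEnergy a (fun j => realAmp b c (p j)) q)⁻¹)
    (haM : a ≤ ((b + c) * (8 / (1 + 3 * (b + c) / 2) ^ 2) / (2 * M)) ^ 2)
    (hηA : 192 * (b + c) ^ 2 * varianceBound (b + c) M * η ^ 2 ≤ A)
    (hpos : ∀ (h : Fin 3 → ℝ) (q : Torus), 0 < modelEnergy a (fun j => realAmp b c (p j)) q
      + ∑ i, energyShift A b c (κ i) (p i) (h i) (q i))
    (hnn : ∀ h : Fin 3 → ℝ, 0 ≤ (∫ q, (modelEnergy a (fun j => realAmp b c (p j)) q)⁻¹)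
        - ∫ q : Torus, (modelEnergy a (fun j => realAmp b c (p j)) q
          + ∑ i, energyShift A b c (κ i) (p i) (h i) (q i))⁻¹) :
    ∃ C > 0, ∃ h₀ > 0, ∀ h : Fin 3 → ℝ, (∀ i, |h i| ≤ h₀) →
      C * ∑ i, h i ^ 2 ≤ (∫ q, (modelEnergy a (fun j => realAmp b c (p j)) q)⁻¹)
        - ∫ q : Torus, (modelEnergy a (fun j => realAmp b c (p j)) q
          + ∑ i, energyShift A b c (κ i) (p i) (h i) (q i))⁻¹ := by
  set s := b + c with hs_def
  have hs : 0 < s := by positivity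
  have hr : ∀ i, s / 2 ≤ realAmp b c (p i) := fun i => half_le_realAmp hb hc (by linarith [hp i])
  have hr0 : ∀ i, 0 ≤ realAmp b c (p i) := fun i => Real.sqrt_nonneg _
  have hrs : ∀ i, realAmp b c (p i) ≤ s := fun i => realAmp_le hb hc _
  have hcos := continuous_torusCos
  obtain ⟨B, hB⟩ : ∃ B, B = ∫ q, (modelEnergy a (fun j => realAmp b c (p j)) q ^ 2)⁻¹ := ⟨_, rfl⟩
  have hlow := integral_model_lower ha ha1 hs hr0 hrs
  rw [← hB] at hlow
  set c0 := 8 / (1 + 3 * s / 2) ^ 2 with hc0_def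
  have hc0 : 0 < c0 := by positivity
  have hsa : 0 < √a := Real.sqrt_pos.2 ha
  have hB0 : 0 < B := pos_of_mul_pos_right (hc0.trans_le hlow) hsa.le
  -- For a small gap `B` is large compared with `M`; this ensures that the weighted means `d i` of
  -- the cosine are nonnegative, as `sq_le_of_nonneg` requires.
  have hMB : 2 / s * M ≤ B := by
    have h1 : √a ≤ s * c0 / (2 * M) := by
      rw [Real.sqrt_le_left (by positivity)]
      exact haM
    have h2 := hlow.trans (mul_le_mul_of_nonneg_right h1 hB0.le)
    have h3 : s * c0 / (2 * M) * B = c0 * (s / (2 * M) * B) := by ring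
    rw [h3] at h2
    have h4 : 1 ≤ s / (2 * M) * B := le_of_mul_le_mul_left (by linarith) hc0
    have h5 := mul_le_mul_of_nonneg_left h4 (by positivity : 0 ≤ 2 / s * M)
    have h6 : 2 / s * M * (s / (2 * M) * B) = B := by
      field_simp
    linarith
  choose d hd using fun i : Fin 3 => show ∃ d : ℝ, d * B
      = ∫ q, torusCos (q i) * (modelEnergy a (fun j => realAmp b c (p j)) q ^ 2)⁻¹ from
    ⟨_, div_mul_cancel₀ _ hB0.ne'⟩
  have hdiff : ∀ i, (1 - d i) * B
      = ∫ q, (1 - torusCos (q i)) * (modelEnergy a (fun j => realAmp b c (p j)) q ^ 2)⁻¹ := by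
    intro i
    rw [sub_mul, one_mul, hd, hB, ← integral_sub (integrable_model_inv ha hr0 2)
      (integrable_model ha hr0 (by fun_prop) 2)]
    congr 1
    funext q
    ring
  have hd1 : ∀ i, d i ≤ 1 := by
    intro i
    have : 0 ≤ (1 - d i) * B := by
      rw [hdiff]
      refine integral_nonneg fun q => mul_nonneg (sub_nonneg.2 (torusCos_le_one _)) ?_
      have := le_modelEnergy (a := a) hr0 q
      positivity
    linarith [nonneg_of_mul_nonneg_left this hB0]
  have hd0 : ∀ i, 0 ≤ d i := by
    intro i
    have h1 := integral_model_one_sub_le ha hs hr i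
    rw [← hM, ← hdiff] at h1
    have h2 : 0 ≤ d i * B := by linarith
    exact nonneg_of_mul_nonneg_left h2 hB0
  have hvar : ∀ i, _ := fun i => integral_model_variance_le ha ha1 hs hr hrs i hM hB (hd i)
  have hC1 : 0 ≤ varianceBound s M := by
    unfold varianceBound
    positivity
  have hfo : ∀ i t, firstOrder A a b c κ p i t
      = A * B * (Real.cos (κ i) - Real.cos (κ i + t))
        + d i * B * (realAmp b c (p i) - realAmp b c (p i - t)) := by
    intro i t
    rw [firstOrder, ← hB, ← hd]
  -- The first-order part `ψ` is at least `A B h²/4`. The remainder costs at most `ψ/2` and `A B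
  -- h²/16`, which leaves `A B h²/16`. The radius keeps `h` within `η` and each energy shift below
  -- `a/24`.
  refine ⟨A * B / 16, by positivity, min η (a / (24 * (A + s))), by positivity, fun h hh => ?_⟩
  have hh1 : ∀ i, |h i| ≤ η := fun i => (hh i).trans (min_le_left _ _)
  have hh2 : ∀ i, (A + s) * |h i| ≤ a / 24 := by
    intro i
    have h1 := mul_le_mul_of_nonneg_left ((hh i).trans (min_le_right _ _))
      (by positivity : 0 ≤ A + s)
    have h2 : (A + s) * (a / (24 * (A + s))) = a / 24 := by
      field_simp
    linarith
  have hsmall : ∀ i (q : Torus), |energyShift A b c (κ i) (p i) (h i) (q i)| ≤ a / 24 :=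
    fun i q => (abs_linearShift_le hA hb hc hη2 (hκ i) (hp i) (hh1 i)
      (abs_torusCos_le _)).trans (hh2 i)
  rw [integral_inv_sub_integral_inv ha (hpos h)]
  have hrem := integral_remainder_le (A := A) (κ := κ) ha hsmall
  have hterm : ∀ i, A * B / 16 * h i ^ 2 ≤ firstOrder A a b c κ p i (h i)
      - 6 * ∫ q : Torus, energyShift A b c (κ i) (p i) (h i) (q i) ^ 2
        * (modelEnergy a (fun j => realAmp b c (p j)) q ^ 3)⁻¹ := by
    intro i
    have hnn1 : ∀ t, 0 ≤ A * B * (Real.cos (κ i) - Real.cos (κ i + t))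
        + d i * B * (realAmp b c (p i) - realAmp b c (p i - t)) := fun t => by
      rw [← hfo]
      exact firstOrder_nonneg ha hpos hnn i t
    have hq := sq_le_of_nonneg hb hc (by positivity : 0 ≤ A * B)
      (mul_nonneg (hd0 i) hB0.le) ((hκ i).trans hη2) ((hp i).trans hη2) hnn1
      ((hh1 i).trans hη2)
    have hs1 := integral_energyShift_sq_le (A := A) (κ := κ) ha i (h i) hB hB0 rfl rfl (hvar i)
    have hab := abs_linearShift_le (t := h i) (u := d i) hA hb hc hη2 (hκ i) (hp i) (hh1 i)
      (abs_le.2 ⟨by linarith [hd0 i], hd1 i⟩)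
    have hρ := abs_realAmp_shift_le hb hc hη2 (hp i) (hh1 i)
    have hψ0 := hnn1 (h i)
    have hψB : A * B * (Real.cos (κ i) - Real.cos (κ i + h i))
        + d i * B * (realAmp b c (p i) - realAmp b c (p i - h i))
        = B * (A * (Real.cos (κ i) - Real.cos (κ i + h i))
        + (realAmp b c (p i) - realAmp b c (p i - h i)) * d i) := by ring
    rw [hfo]
    change _ ≤ _ + 2 * _ * (varianceBound s M * B) at hs1
    set ρ := realAmp b c (p i) - realAmp b c (p i - h i) with hρ_def
    set ψ := A * B * (Real.cos (κ i) - Real.cos (κ i + h i)) + d i * B * ρ with hψ_def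
    have hψ1 : ψ ≤ B * (a / 24) := by
      rw [hψB]
      exact mul_le_mul_of_nonneg_left ((le_abs_self _).trans (hab.trans (hh2 i))) hB0.le
    -- The average part is quadratic in `ψ`, and `24 ψ ≤ a B` makes it at most `ψ/2`.
    have hψ2 : 6 * (2 * ψ ^ 2 / (a * B)) ≤ ψ / 2 := by
      have e : 6 * (2 * ψ ^ 2 / (a * B)) = 12 * ψ ^ 2 / (a * B) := by ring
      rw [e, div_le_iff₀ (by positivity)]
      nlinarith [mul_le_mul_of_nonneg_left hψ1 hψ0]
    have hρ2 : ρ ^ 2 ≤ (s * η * |h i|) ^ 2 := by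
      rw [← sq_abs ρ]
      exact pow_le_pow_left₀ (abs_nonneg _) hρ 2
    rw [mul_pow, sq_abs] at hρ2
    -- The fluctuation part carries `ρ² ≤ (s η h)²`; the smallness of `η` in `hηA` is tuned to this.
    have hρ3 : 6 * (2 * ρ ^ 2 * (varianceBound s M * B)) ≤ A * B / 16 * h i ^ 2 := by
      have e1 : 12 * ρ ^ 2 * (varianceBound s M * B)
          ≤ 12 * ((s * η) ^ 2 * h i ^ 2) * (varianceBound s M * B) := by gcongr
      have e2 : 12 * ((s * η) ^ 2 * h i ^ 2) * (varianceBound s M * B)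
          = 192 * s ^ 2 * varianceBound s M * η ^ 2 * (B / 16 * h i ^ 2) := by ring
      have e3 := mul_le_mul_of_nonneg_right hηA (by positivity : 0 ≤ B / 16 * h i ^ 2)
      linarith
    linarith
  have hsum := Finset.sum_le_sum fun i (_ : i ∈ Finset.univ) => hterm i
  rw [← Finset.mul_sum, Finset.sum_sub_distrib] at hsum
  linarith

end QuadraticGrowth

/-! ### Quadratic growth of the pair determinant at its zeros. -/

noncomputable section DeterminantGrowth

variable {l μ : Fin 3 → ℝ} {K : Torus} {z : ℝ}

/-- With `K = κ + p`, moving `k` from `κ` to `κ + h` moves the pair momentum from `p` to `p - h`.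
The model gap is the height above `z` of the bottom of the fibre over `κ`. -/
lemma centeredEnergy_coe (l : Fin 3 → ℝ) {κ p : Fin 3 → ℝ}
    (hK : ∀ i, K i = ((κ i + p i : ℝ) : AddCircle (2 * π))) (z : ℝ) (α : Fin 3)
    (h : Fin 3 → ℝ) (q : Torus) :
    centeredEnergy l K z α (fun i => ((κ i + h i : ℝ) : AddCircle (2 * π))) q
      = modelEnergy (l α * ∑ i, (1 - Real.cos (κ i)) - z
          + ∑ i, (l (α + 1) + l (α + 2) - realAmp (l (α + 1)) (l (α + 2)) (p i)))
          (fun i => realAmp (l (α + 1)) (l (α + 2)) (p i)) q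
        + ∑ i, energyShift (l α) (l (α + 1)) (l (α + 2)) (κ i) (p i) (h i) (q i) := by
  have h1 : ∀ i, pairAmp (l (α + 1)) (l (α + 2)) (K i - ((κ i + h i : ℝ) : AddCircle (2 * π)))
      = realAmp (l (α + 1)) (l (α + 2)) (p i - h i) := by
    intro i
    rw [hK, ← AddCircle.coe_sub, pairAmp_coe]
    congr 1
    ring
  simp only [centeredEnergy, h1, dispersion, torusCos_coe, modelEnergy, energyShift,
    Fin.sum_univ_three]
  ring

/-- At a zero of the determinant close to the origin, with small total quasi-momentum, the
determinant grows at least quadratically. -/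
lemma exists_growth_radius (hl : ∀ i, 0 < l i) (hμ : ∀ i, 0 < μ i) (α : Fin 3) :
    ∃ η > 0, η ≤ 1 / 2 ∧ ∀ (K : Torus) (z : ℝ) (κ p : Fin 3 → ℝ),
      (∀ x, z < kineticEnergy l K x) → (∀ k, 0 ≤ pairDet l μ K z α k) →
      (∀ i, |κ i| ≤ η) → (∀ i, |p i| ≤ η) →
      (∀ i, K i = ((κ i + p i : ℝ) : AddCircle (2 * π))) →
      pairDet l μ K z α (fun i => (κ i : AddCircle (2 * π))) = 0 →
      l α * dispersion (fun i => (κ i : AddCircle (2 * π))) ≤ z →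
      ∃ C > 0, ∃ h₀ > 0, ∀ h : Fin 3 → ℝ, (∀ i, |h i| ≤ h₀) →
        C * ∑ i, h i ^ 2 ≤ pairDet l μ K z α fun i => ((κ i + h i : ℝ) : AddCircle (2 * π)) := by
  set b := l (α + 1) with hb_def
  set c := l (α + 2) with hc_def
  have hb : 0 < b := hl _
  have hc : 0 < c := hl _
  have hA : 0 < l α := hl α
  set s := b + c with hs_def
  have hs : 0 < s := by positivity
  -- The value that the resolvent mean must take at a zero of the determinant. It depends on `μ α`
  -- alone, so `η` can be chosen before `K`, `z` and the zero.
  set M := (2 * π) ^ 3 / μ α with hM_def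
  have hM0 : 0 < M := div_pos (by positivity) (hμ α)
  set R := (s * (8 / (1 + 3 * s / 2) ^ 2) / (2 * M)) ^ 2 with hR_def
  have hR : 0 < R := by positivity
  have hV : 0 < varianceBound s M := by
    unfold varianceBound
    positivity
  -- The four bounds serve, in order, the estimates for momenta in `[-1, 1]`, the conditions `a ≤ 1`
  -- and `a ≤ R` on the gap, and the absorption of the fluctuation.
  set η := min (1 / 2) (min (1 / s) (min (R / s) (l α / (192 * s ^ 2 * varianceBound s M))))
    with hη_def
  have hη : 0 < η := by positivity
  have hη1 : η ≤ 1 / 2 := min_le_left _ _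
  have hηη : η ^ 2 ≤ η := by nlinarith
  have hη2 : s * η ^ 2 ≤ 1 := by
    have h1 : η ≤ 1 / s := (min_le_right _ _).trans (min_le_left _ _)
    rw [le_div_iff₀ hs] at h1
    nlinarith
  have hη3 : s * η ^ 2 ≤ R := by
    have h1 : η ≤ R / s :=
      (min_le_right _ _).trans ((min_le_right _ _).trans (min_le_left _ _))
    rw [le_div_iff₀ hs] at h1
    nlinarith
  have hη4 : 192 * s ^ 2 * varianceBound s M * η ^ 2 ≤ l α := by
    have h1 : η ≤ l α / (192 * s ^ 2 * varianceBound s M) :=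
      (min_le_right _ _).trans ((min_le_right _ _).trans (min_le_right _ _))
    rw [le_div_iff₀ (by positivity)] at h1
    have h2 : 0 ≤ 192 * s ^ 2 * varianceBound s M := by positivity
    nlinarith
  refine ⟨η, hη, hη1, fun K z κ p hz hD hκ hp hK h0 hε => ?_⟩
  set a := l α * ∑ i, (1 - Real.cos (κ i)) - z + ∑ i, (b + c - realAmp b c (p i)) with ha_def
  have hce := centeredEnergy_coe l hK z α
  rw [← hb_def, ← hc_def, ← ha_def] at hce
  have hpos : ∀ (h : Fin 3 → ℝ) (q : Torus), 0 < modelEnergy a (fun j => realAmp b c (p j)) q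
      + ∑ i, energyShift (l α) b c (κ i) (p i) (h i) (q i) := fun h q => by
    rw [← hce]
    exact centeredEnergy_pos hz α _ q
  have ha : 0 < a := by
    have := hpos 0 0
    simpa [energyShift_zero, modelEnergy, torusCos_zero] using this
  -- Where `l α * ε ≤ z` the gap comes only from the loss of pair amplitude, which is quadratic in
  -- `p`.
  have hasmall : a ≤ s * η ^ 2 := by
    have h1 : ∀ i, b + c - realAmp b c (p i) ≤ s * η ^ 2 / 4 := by
      intro i
      refine (sub_realAmp_le hb hc (by linarith [hp i])).trans ?_
      have : p i ^ 2 ≤ η ^ 2 := by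
        rw [← sq_abs]
        exact pow_le_pow_left₀ (abs_nonneg _) (hp i) 2
      gcongr
    have h2 := Finset.sum_le_sum fun i (_ : i ∈ Finset.univ) => h1 i
    simp only [Finset.sum_const, Finset.card_univ, Fintype.card_fin, nsmul_eq_mul] at h2
    push_cast at h2
    have h3 : l α * ∑ i, (1 - Real.cos (κ i)) ≤ z := by
      simpa only [dispersion, torusCos_coe] using hε
    have h4 : 0 ≤ s * η ^ 2 := by positivity
    linarith
  have hdet : ∀ h : Fin 3 → ℝ,
      pairDet l μ K z α (fun i => ((κ i + h i : ℝ) : AddCircle (2 * π)))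
        = 1 - μ α / (2 * π) ^ 3 * ∫ q : Torus, (modelEnergy a (fun j => realAmp b c (p j)) q
          + ∑ i, energyShift (l α) b c (κ i) (p i) (h i) (q i))⁻¹ := by
    intro h
    rw [pairDet, resolventMean_eq_centered]
    simp_rw [hce]
  have hμM : μ α / (2 * π) ^ 3 * M = 1 := by
    have := (hμ α).ne'
    rw [hM_def]
    field_simp
  have hM : M = ∫ q, (modelEnergy a (fun j => realAmp b c (p j)) q)⁻¹ := by
    have h1 := hdet 0
    simp only [Pi.zero_apply, add_zero, energyShift_zero, Finset.sum_const_zero] at h1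
    rw [h0, ← hμM, ← mul_sub] at h1
    have h2 : μ α / (2 * π) ^ 3 ≠ 0 := left_ne_zero_of_mul_eq_one hμM
    rcases mul_eq_zero.1 h1.symm with h | h
    · exact absurd h h2
    · exact sub_eq_zero.1 h
  have hdet2 : ∀ h : Fin 3 → ℝ,
      pairDet l μ K z α (fun i => ((κ i + h i : ℝ) : AddCircle (2 * π)))
        = μ α / (2 * π) ^ 3 * ((∫ q, (modelEnergy a (fun j => realAmp b c (p j)) q)⁻¹)
          - ∫ q : Torus, (modelEnergy a (fun j => realAmp b c (p j)) q
          + ∑ i, energyShift (l α) b c (κ i) (p i) (h i) (q i))⁻¹) := by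
    intro h
    rw [hdet, mul_sub, ← hM, hμM]
  have hμπ : 0 < μ α / (2 * π) ^ 3 := div_pos (hμ α) (by positivity)
  obtain ⟨C, hC, h₀, hh₀, hgrow⟩ := model_growth (A := l α) hA hb hc ha
    (hasmall.trans hη2) hη hη1 hκ hp hM0 hM (hasmall.trans hη3) hη4 hpos fun h => by
      have h1 := hD fun i => ((κ i + h i : ℝ) : AddCircle (2 * π))
      rw [hdet2] at h1
      exact nonneg_of_mul_nonneg_right h1 hμπ
  refine ⟨μ α / (2 * π) ^ 3 * C, mul_pos hμπ hC, h₀, hh₀, fun h hh => ?_⟩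
  rw [hdet2, mul_assoc]
  exact mul_le_mul_of_nonneg_left (hgrow h hh) hμπ.le

end DeterminantGrowth

/-! ### Integrability of the inverse of a function with quadratic growth at its zeros. -/

noncomputable section Integrability

lemma intervalIntegrable_abs_rpow {r : ℝ} (hr : -1 < r) (x y : ℝ) :
    IntervalIntegrable (fun t : ℝ => |t| ^ r) volume x y := by
  refine intervalIntegrable_of_even (fun t => by rw [abs_neg]) fun t ht => ?_
  refine (intervalIntegral.intervalIntegrable_rpow' (a := 0) (b := t) hr).congr fun u hu => ?_
  rw [Set.uIoc_of_le ht.le] at hu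
  rw [abs_of_pos hu.1]

lemma integrable_norm_rpow_addCircle {r : ℝ} (hr : -1 < r) :
    Integrable fun t : AddCircle (2 * π) => ‖t‖ ^ r := by
  have hm : Measurable fun t : AddCircle (2 * π) => ‖t‖ ^ r := by fun_prop
  refine ⟨hm.aestronglyMeasurable, ?_⟩
  rw [HasFiniteIntegral, ← AddCircle.lintegral_preimage (2 * π) (-π)]
  have h := (intervalIntegrable_abs_rpow hr (-π) (-π + 2 * π)).1.2
  rw [HasFiniteIntegral] at h
  refine lt_of_le_of_lt (le_of_eq ?_) h
  refine setLIntegral_congr_fun measurableSet_Ioc fun t ht => ?_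
  have h1 : ‖(t : AddCircle (2 * π))‖ = |t| := by
    rw [AddCircle.norm_coe_eq_abs_iff _ Real.two_pi_pos.ne', abs_of_pos Real.two_pi_pos]
    rw [abs_le]
    constructor <;> linarith [ht.1, ht.2]
  simp only [h1]

/-- An integrable majorant of `‖k - k₀‖⁻²`. -/
lemma integrable_prod_rpow (k₀ : Torus) :
    Integrable fun k : Torus => ∏ i, ‖k i - k₀ i‖ ^ (-(2 / 3) : ℝ) := by
  have h : Integrable fun k : Torus => ∏ i, ‖k i‖ ^ (-(2 / 3) : ℝ) :=
    Integrable.fintype_prod (f := fun _ (t : AddCircle (2 * π)) => ‖t‖ ^ (-(2 / 3) : ℝ))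
      fun _ => integrable_norm_rpow_addCircle (by norm_num)
  exact h.comp_sub_right k₀

/-- By the inequality of arithmetic and geometric means. Each factor has an exponent above `-1`, so
the product is integrable coordinate by coordinate, without polar coordinates. -/
lemma inv_sum_sq_le {x : Fin 3 → ℝ} (hx : ∀ i, 0 < x i) :
    (∑ i, x i ^ 2)⁻¹ ≤ ∏ i, x i ^ (-(2 / 3) : ℝ) := by
  have h := Real.geom_mean_le_arith_mean3_weighted (w₁ := 1 / 3) (w₂ := 1 / 3) (w₃ := 1 / 3)
    (by norm_num) (by norm_num) (by norm_num) (sq_nonneg (x 0)) (sq_nonneg (x 1))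
    (sq_nonneg (x 2)) (by norm_num)
  have h1 : ∀ i, (x i ^ 2) ^ (1 / 3 : ℝ) = x i ^ (2 / 3 : ℝ) := fun i => by
    rw [← Real.rpow_natCast, ← Real.rpow_mul (hx i).le]
    norm_num
  rw [h1, h1, h1] at h
  have h2 : ∏ i, x i ^ (-(2 / 3) : ℝ) = (∏ i, x i ^ (2 / 3 : ℝ))⁻¹ := by
    rw [← Finset.prod_inv_distrib]
    exact Finset.prod_congr rfl fun i _ => Real.rpow_neg (hx i).le _
  rw [h2]
  refine inv_anti₀ (Finset.prod_pos fun i _ => Real.rpow_pos_of_pos (hx i) _) ?_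
  rw [Fin.prod_univ_three, Fin.sum_univ_three]
  linarith [sq_nonneg (x 0), sq_nonneg (x 1), sq_nonneg (x 2)]

lemma setLIntegral_inv_lt_top_of_growth {D : Torus → ℝ} {k₀ : Torus} {C h₀ : ℝ} (hC : 0 < C)
    (hD : ∀ k ∈ Metric.closedBall k₀ h₀, C * ∑ i, ‖k i - k₀ i‖ ^ 2 ≤ D k) :
    ∫⁻ k in Metric.closedBall k₀ h₀, (ENNReal.ofReal (D k))⁻¹ < ∞ := by
  -- On the coordinate hyperplanes through `k₀` the majorant vanishes, because `0 ^ (-(2/3))` is `0`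
  -- by convention; they are null sets.
  have hae : ∀ᵐ k : Torus, ∀ i, k i ≠ k₀ i := by
    rw [ae_all_iff]
    intro i
    exact Measure.ae_eval_ne (μ := fun _ : Fin 3 => (volume : Measure (AddCircle (2 * π)))) i (k₀ i)
  have hint := ((integrable_prod_rpow k₀).const_mul C⁻¹).lintegral_lt_top
  refine lt_of_le_of_lt ?_ hint
  refine le_trans (setLIntegral_mono_ae' Metric.isClosed_closedBall.measurableSet ?_)
    (setLIntegral_le_lintegral (Metric.closedBall k₀ h₀) _)
  filter_upwards [hae] with k hk hmem
  have hpos : ∀ i, 0 < ‖k i - k₀ i‖ := fun i => norm_pos_iff.2 (sub_ne_zero.2 (hk i))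
  have hS : 0 < ∑ i, ‖k i - k₀ i‖ ^ 2 :=
    Finset.sum_pos (fun i _ => pow_pos (hpos i) 2) Finset.univ_nonempty
  have h1 := hD k hmem
  rw [← ENNReal.ofReal_inv_of_pos ((mul_pos hC hS).trans_le h1)]
  refine ENNReal.ofReal_le_ofReal ((inv_anti₀ (mul_pos hC hS) h1).trans ?_)
  rw [mul_inv]
  exact mul_le_mul_of_nonneg_left (inv_sum_sq_le hpos) (inv_nonneg.2 hC.le)

/-- By compactness finiteness is local: near a zero it follows from the growth, elsewhere the
inverse is locally bounded. -/
lemma lintegral_inv_lt_top_of_growth {D : Torus → ℝ} (hc : Continuous D) (hnn : ∀ k, 0 ≤ D k)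
    (hgrow : ∀ k₀, D k₀ = 0 → ∃ C > 0, ∃ h₀ > 0, ∀ k ∈ Metric.closedBall k₀ h₀,
      C * ∑ i, ‖k i - k₀ i‖ ^ 2 ≤ D k) :
    ∫⁻ k, (ENNReal.ofReal (D k))⁻¹ < ∞ := by
  rw [← setLIntegral_univ]
  refine isCompact_univ.induction_on
    (p := fun S : Set Torus => ∫⁻ k in S, (ENNReal.ofReal (D k))⁻¹ < ∞) (by simp)
    (fun s t hst ht => (lintegral_mono_set hst).trans_lt ht)
    (fun s t hs ht => (lintegral_union_le _ s t).trans_lt (ENNReal.add_lt_top.2 ⟨hs, ht⟩))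
    fun k₀ _ => ?_
  rw [nhdsWithin_univ]
  rcases (hnn k₀).eq_or_lt with h0 | h0
  · obtain ⟨C, hC, h₀, hh₀, h⟩ := hgrow k₀ h0.symm
    exact ⟨_, Metric.closedBall_mem_nhds k₀ hh₀, setLIntegral_inv_lt_top_of_growth hC h⟩
  · refine ⟨{k | D k₀ / 2 < D k},
      (isOpen_lt continuous_const hc).mem_nhds (half_lt_self h0), ?_⟩
    have hle : ∫⁻ k in {k | D k₀ / 2 < D k}, (ENNReal.ofReal (D k))⁻¹
        ≤ ∫⁻ _k in {k | D k₀ / 2 < D k}, (ENNReal.ofReal (D k₀ / 2))⁻¹ := by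
      refine setLIntegral_mono' (isOpen_lt continuous_const hc).measurableSet fun k hk => ?_
      exact ENNReal.inv_le_inv.2 (ENNReal.ofReal_le_ofReal (le_of_lt hk))
    refine hle.trans_lt ?_
    rw [setLIntegral_const]
    exact ENNReal.mul_lt_top
      (ENNReal.inv_lt_top.2 (ENNReal.ofReal_pos.2 (half_pos h0))) (measure_lt_top _ _)

end Integrability

/-! ### Location of the zeros for small `K`, and the conclusion. -/

noncomputable section ZeroLocation

variable {l μ : Fin 3 → ℝ}

/-- The configuration in which particle `α` carries all of `K` has this energy. -/
lemma mul_dispersion_lt {K : Torus} {z : ℝ} (hz : ∀ x, z < kineticEnergy l K x) (α : Fin 3) :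
    z < l α * dispersion K := by
  have h := hz (pairInv K α (K, 0))
  rw [kineticEnergy_pairInv] at h
  have h0 : dispersion 0 = 0 := by simp [dispersion, torusCos_zero]
  simpa [h0] using h

lemma dispersion_toTorus_le (K : EuclideanSpace ℝ (Fin 3)) :
    dispersion (toTorus K) ≤ ‖K‖ ^ 2 / 2 := by
  rw [EuclideanSpace.real_norm_sq_eq, Finset.sum_div]
  refine Finset.sum_le_sum fun i _ => ?_
  rw [toTorus, torusCos_coe]
  linarith [Real.one_sub_sq_div_two_le_cos (x := K i)]

/-- A torus point with small dispersion is close to the origin. -/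
lemma norm_le_of_dispersion_le {k : Torus} {r : ℝ} (hr : 0 ≤ r) (h : dispersion k ≤ r ^ 2 / 2)
    (i : Fin 3) : ‖k i‖ ≤ 2 * r := by
  have h1 : 1 - torusCos (k i) ≤ dispersion k :=
    Finset.single_le_sum (f := fun i => 1 - torusCos (k i))
      (fun i _ => sub_nonneg.2 (torusCos_le_one _)) (Finset.mem_univ i)
  obtain ⟨x, hx, hxn⟩ := exists_coe_eq_abs_eq_norm (k i)
  have hπ : ‖k i‖ ≤ π := by
    have := AddCircle.norm_le_half_period (2 * π) (x := k i) Real.two_pi_pos.ne'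
    rw [abs_of_pos Real.two_pi_pos] at this
    linarith
  rw [← hxn] at hπ ⊢
  rw [← hx, torusCos_coe] at h1
  have h2 := Real.cos_le_one_sub_mul_cos_sq hπ
  have h3 : 2 / π ^ 2 * x ^ 2 ≤ r ^ 2 / 2 := by linarith
  rw [div_mul_eq_mul_div, div_le_iff₀ (by positivity)] at h3
  have h4 : π ^ 2 ≤ 4 ^ 2 := pow_le_pow_left₀ Real.pi_pos.le Real.pi_le_four 2
  refine abs_le_of_sq_le_sq ?_ (by positivity)
  nlinarith [mul_le_mul_of_nonneg_left h4 (sq_nonneg r)]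

/-- A zero `k₀` satisfies `l_α ε(k₀) ≤ z < l_α ε(K)`, so its coordinates are at most `2‖K‖` and
those of `K - k₀` at most `3‖K‖`. Hence the radius `η / 3`. -/
lemma lintegral_inv_pairDet_lt_top (hl : ∀ i, 0 < l i) (hμ : ∀ i, 0 < μ i) {α : Fin 3}
    (hcrit : μ α ≤ criticalCoupling l α) :
    ∃ δ > 0, ∀ (K : EuclideanSpace ℝ (Fin 3)) (z : ℝ), ‖K‖ < δ →
      (∀ x, z < kineticEnergy l (toTorus K) x) → (∀ k, 0 ≤ pairDet l μ (toTorus K) z α k) →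
      ∫⁻ k, (ENNReal.ofReal (pairDet l μ (toTorus K) z α k))⁻¹ < ∞ := by
  obtain ⟨η, hη, -, hgrow⟩ := exists_growth_radius hl hμ α
  refine ⟨η / 3, by positivity, fun K z hK hz hD => ?_⟩
  refine lintegral_inv_lt_top_of_growth (continuous_pairDet hz α) hD fun k₀ hk₀ => ?_
  have hε : l α * dispersion k₀ ≤ z := by
    by_contra! h
    exact (pairDet_pos_of_lt hl hμ hcrit h).ne' hk₀
  have hε2 : dispersion k₀ ≤ ‖K‖ ^ 2 / 2 :=
    (le_of_mul_le_mul_left (hε.trans (mul_dispersion_lt hz α).le) (hl α)).trans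
      (dispersion_toTorus_le K)
  choose κ hκ hκn using fun i => exists_coe_eq_abs_eq_norm (k₀ i)
  have hκ2 : ∀ i, |κ i| ≤ 2 * ‖K‖ := fun i => by
    rw [hκn]
    exact norm_le_of_dispersion_le (norm_nonneg K) hε2 i
  have hKi : ∀ i, |K i| ≤ ‖K‖ := fun i => PiLp.norm_apply_le K i
  have hp : ∀ i, |K i - κ i| ≤ η := fun i => by
    linarith [abs_sub (K i) (κ i), hκ2 i, hKi i]
  have hk₀κ : (fun i => (κ i : AddCircle (2 * π))) = k₀ := funext hκ
  obtain ⟨C, hC, h₀, hh₀, h⟩ := hgrow (toTorus K) z κ (fun i => K i - κ i) hz hD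
    (fun i => by linarith [hκ2 i, norm_nonneg K]) hp
    (fun i => by rw [add_sub_cancel]; rfl) (by rw [hk₀κ]; exact hk₀) (by rw [hk₀κ]; exact hε)
  refine ⟨C, hC, h₀, hh₀, fun k hk => ?_⟩
  choose t ht htn using fun i => exists_coe_eq_abs_eq_norm (k i - k₀ i)
  have hk' : (fun i => ((κ i + t i : ℝ) : AddCircle (2 * π))) = k := by
    funext i
    rw [AddCircle.coe_add, hκ, ht, add_sub_cancel]
  have h1 := h t fun i => by
    rw [htn]
    exact (norm_le_pi_norm (k - k₀) i).trans (by rwa [← dist_eq_norm])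
  rw [hk'] at h1
  simpa only [← htn, sq_abs] using h1

lemma eigenvaluesBelow_finite (hl : ∀ i, 0 < l i) (hμ : ∀ i, 0 < μ i)
    (hcrit : ∀ i, μ i ≤ criticalCoupling l i) {α : Fin 3} (hα : μ α = criticalCoupling l α) :
    ∃ δ > 0, ∀ K : EuclideanSpace ℝ (Fin 3), 0 < ‖K‖ → ‖K‖ < δ →
      (eigenvaluesBelow (hamiltonian l μ (toTorus K))).Finite := by
  choose δ hδ hfin using fun i => lintegral_inv_pairDet_lt_top hl hμ (hcrit i)
  -- The bound `1` keeps each `K i` inside `(-π, π)`, so that a nonzero coordinate has nonzero sine.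
  refine ⟨min 1 (min (δ 0) (min (δ 1) (δ 2))),
    lt_min one_pos (lt_min (hδ 0) (lt_min (hδ 1) (hδ 2))), fun K hK0 hK => ?_⟩
  obtain ⟨hK1, h0, h1, h2⟩ : ‖K‖ < 1 ∧ ‖K‖ < δ 0 ∧ ‖K‖ < δ 1 ∧ ‖K‖ < δ 2 := by
    simpa only [lt_min_iff] using hK
  have hKδ : ∀ i, ‖K‖ < δ i := fun i => by fin_cases i <;> assumption
  obtain ⟨i, hi⟩ : ∃ i, K i ≠ 0 := by
    by_contra! h
    exact (norm_pos_iff.1 hK0) (by ext i; exact h i)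
  have hKi : |K i| < 1 := (PiLp.norm_apply_le K i).trans_lt hK1
  have hsin : Real.sin (K i) ≠ 0 := by
    rw [abs_lt] at hKi
    intro h
    exact hi ((Real.sin_eq_zero_iff_of_lt_of_lt (by linarith [Real.pi_gt_three])
      (by linarith [Real.pi_gt_three])).1 h)
  have hz := essentialBottom_lt_kineticEnergy (K := toTorus K) hl hμ hα rfl hsin
  refine finite_eigenvalues_lt (isSelfAdjoint_hamiltonian l μ _) fun J hJ => ?_
  -- Here the energy is the bottom of the essential spectrum itself; a negative determinant there
  -- would push the bottom strictly below itself.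
  have hfd := finiteDimensional_of_form_lt hz hμ (fun α => hfin α K _ (hKδ α) hz fun k => by
    by_contra! h
    exact lt_irrefl _ (essentialBottom_lt_of_pairDet_neg hz hμ h)) J hJ
  exact not_finite_iff_infinite.2 inferInstance
    (Module.Finite.finite_basis (Finsupp.basisSingleOne (R := ℂ) (ι := ℕ)))

end ZeroLocation

end LatticeThreeBody

theorem mainTheorem5 (l μ : Fin 3 → ℝ) (hl : ∀ i, 0 < l i) (hμ : ∀ i, 0 < μ i)
    (α β γ : Fin 3) (hαβ : α ≠ β) (hβγ : β ≠ γ) (hγα : γ ≠ α)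
    (hα : μ α = criticalCoupling l α) (hβ : μ β = criticalCoupling l β)
    (hγ : μ γ ≤ criticalCoupling l γ) :
    ∃ δ > 0, ∀ K : EuclideanSpace ℝ (Fin 3), 0 < ‖K‖ → ‖K‖ < δ →
      (eigenvaluesBelow (hamiltonian l μ (toTorus K))).Finite ∧
      ∀ z ∈ eigenvaluesBelow (hamiltonian l μ (toTorus K)),
        FiniteDimensional ℂ (eigenspace (hamiltonian l μ (toTorus K)) (z : ℂ)) := by
  have hcrit : ∀ i, μ i ≤ criticalCoupling l i := by
    intro i
    obtain rfl | rfl | rfl : i = α ∨ i = β ∨ i = γ := by omega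
    · exact hα.le
    · exact hβ.le
    · exact hγ
  obtain ⟨δ, hδ, h⟩ := eigenvaluesBelow_finite hl hμ hcrit hα
  exact ⟨δ, hδ, fun K hK0 hK => ⟨h K hK0 hK, fun z hz => finiteDimensional_eigenspace_of_lt hz⟩⟩
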